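/- Let $n\ge 1$, $0<s<n$, and let $V:\mathbb{R}^n\to[0,+\infty]$ be such that $S_V=\{V<+\infty\}$ is open and non-empty, $V$ is continuous on $S_V$, and $\int_{\mathbb{R}^n}e^{-V(x)}\,dx<+\infty$ (with $e^{-\infty}=0$). For $\beta>0$ and $N\in\mathbb{N}$ consider the Gibbs measure of the Riesz gas on $(\mathbb{R}^n)^N$, $$\mathbb{P}_N[d\mathbf{x}]=\frac1{Z_N}\exp\Big(-\beta\sum_{1\le i<j\le N}|x_i-x_j|^{-s}-\sum_{j=1}^N V(x_j)\Big)\,dx_1\cdots dx_N ,$$ where $Z_N$ is the normalization constant. Let $\gamma\ge 0$, and for probability measures $\mu$ on $\mathbb{R}^n$ let $$\mathscr{F}_\gamma(\mu)=\frac{\gamma}{2}\iint|x-z|^{-s}\,\mu(dz)\,\mu(dx)+\mathrm{H}(\mu\,|\,\mu_0),\qquad \mu_0(dx)=\frac{e^{-V(x)}\,dx}{\int e^{-V(y)}\,dy},$$ where $\mathrm{H}(\cdot\,|\,\mu_0)$ is the relative entropy (for $\gamma=0$ the first term is $0$). Then $\mathscr{F}_\gamma$ has a unique minimizer $\mu_\gamma$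 among the probability measures on $\mathbb{R}^n$; it has a density with respect to Lebesgue measure, again denoted by $\mu_\gamma$, which is continuous on $S_V$; and for every $E\in S_V$ one has $\mu_\gamma(E)>0$ and, for every sequence $\beta=\beta_N>0$ with $N\beta_N\to\gamma$ as $N\to+\infty$, under $\mathbb{P}_N$ the point process $$\Xi_N=\sum_{j=1}^N\delta_{N^{1/n}(x_j-E)}$$ converges in distribution as $N\to+\infty$ to a homogeneous Poisson point process on $\mathbb{R}^n$ with intensity $\mu_\gamma(E)$ (with respect to Lebesgue measure). Here a Poisson point process with intensity measure $\theta$ is a simple point process $\Xi$ with $\mathbb{E}[e^{-\Xi(f)}]=\exp\big(\int(e^{-f}-1)\,d\theta\big)$ for all Borel $f:\mathbb{R}^n\to[0,+\infty)$, and $\Xi_N$ converges to $\Xi$ in distribution if $\mathbb{E}[e^{-\Xi_N(f)}]\to\mathbb{E}[e^{-\Xi(f)}]$ for all continuous $f:\mathbb{R}^n\to[0,+\infty)$ with compact support. -/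

import Mathlib

open MeasureTheory Filter Topology
open scoped NNReal ENNReal

noncomputable section

namespace RieszGas

/-- Euclidean space `ℝⁿ`. -/
abbrev Space (n : ℕ) : Type := EuclideanSpace ℝ (Fin n)

/-- `e^{-t}` for `t ∈ [0, ∞]`, with `e^{-∞} = 0`. -/
def expNeg (t : ℝ≥0∞) : ℝ≥0∞ := EReal.exp (-(t : EReal))

/-- The Riesz kernel `|x - u|^{-s}`, equal to `∞` on the diagonal when `s > 0`. -/
def rieszKernel {n : ℕ} (s : ℝ) (u x : Space n) : ℝ≥0∞ := ‖x - u‖ₑ ^ (-s)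

/-- The energy `β ∑_{i < j} g_s(x_i, x_j) + ∑_j V(x_j)` of a configuration of `N` particles. -/
def hamiltonian {n : ℕ} (s β : ℝ) (V : Space n → ℝ≥0∞) {N : ℕ} (x : Fin N → Space n) : ℝ≥0∞ :=
  ENNReal.ofReal β * ∑ i, ∑ j ∈ Finset.Ioi i, rieszKernel s (x i) (x j) + ∑ j, V (x j)

/-- The partition function. -/
def partitionFunction {n : ℕ} (s β : ℝ) (V : Space n → ℝ≥0∞) (N : ℕ) : ℝ≥0∞ :=
  ∫⁻ x : Fin N → Space n, expNeg (hamiltonian s β V x)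

/-- The Gibbs measure of `N` particles on `(ℝⁿ)^N`. -/
def gibbs {n : ℕ} (s β : ℝ) (V : Space n → ℝ≥0∞) (N : ℕ) : Measure (Fin N → Space n) :=
  (partitionFunction s β V N)⁻¹ • volume.withDensity (fun x => expNeg (hamiltonian s β V x))

/-- The local point process `∑_j δ_{N^{1/n} (x_j - E)}` around `E`. -/
def localProcess {n : ℕ} (E : Space n) (N : ℕ) (x : Fin N → Space n) : Measure (Space n) :=
  ∑ j, Measure.dirac (((N : ℝ) ^ (1 / (n : ℝ))) • (x j - E))

/-- The reference probability measure `μ₀`, proportional to `e^{-V(x)} dx`. -/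
def referenceMeasure {n : ℕ} (V : Space n → ℝ≥0∞) : Measure (Space n) :=
  (∫⁻ x, expNeg (V x))⁻¹ • volume.withDensity (fun x => expNeg (V x))

/-- The interaction energy `∬ g_s(x, z) μ(dz) μ(dx)`. -/
def interactionEnergy {n : ℕ} (s : ℝ) (μ : Measure (Space n)) : ℝ≥0∞ :=
  ∫⁻ x, ∫⁻ z, rieszKernel s x z ∂μ ∂μ

/-- The free energy `(γ / 2) ℰ(μ) + H(μ | μ₀)`, `H` being the relative entropy. -/
def freeEnergy {n : ℕ} (s γ : ℝ) (V : Space n → ℝ≥0∞) (μ : ProbabilityMeasure (Space n)) : ℝ≥0∞ :=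
  ENNReal.ofReal (γ / 2) * interactionEnergy s (μ : Measure (Space n)) +
    InformationTheory.klDiv (μ : Measure (Space n)) (referenceMeasure V)

/-- `μ` minimizes the free energy over all probability measures on `ℝⁿ`. -/
def IsFreeEnergyMinimizer {n : ℕ} (s γ : ℝ) (V : Space n → ℝ≥0∞)
    (μ : ProbabilityMeasure (Space n)) : Prop :=
  ∀ ν : ProbabilityMeasure (Space n), freeEnergy s γ V μ ≤ freeEnergy s γ V ν

/-- A (simple) point process: a random measure which is almost surely of the form
`∑_{λ ∈ Λ} δ_λ` with `Λ` countable and without accumulation points. -/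
structure IsPointProcess {X : Type*} [TopologicalSpace X] [MeasurableSpace X]
    {Ω : Type*} [MeasurableSpace Ω] (P : Measure Ω) (Ξ : Ω → Measure X) : Prop where
  measurable : Measurable Ξ
  ae_eq_sum : ∀ᵐ ω ∂P, ∃ Λ : Set X, Λ.Countable ∧ (∀ x, ¬ AccPt x (𝓟 Λ)) ∧
    Ξ ω = Measure.sum (fun l : Λ => Measure.dirac (l : X))

/-- The Laplace functional `ψ(f) = 𝔼[e^{-Ξ(f)}]` of a random measure. -/
def laplaceFunctional {X : Type*} [MeasurableSpace X] {Ω : Type*} [MeasurableSpace Ω]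
    (P : Measure Ω) (Ξ : Ω → Measure X) (f : X → ℝ≥0) : ℝ≥0∞ :=
  ∫⁻ ω, expNeg (∫⁻ x, (f x : ℝ≥0∞) ∂(Ξ ω)) ∂P

/-- A Poisson point process with intensity measure `θ`: a point process with Laplace functional
`exp (∫ (e^{-f} - 1) dθ)`. -/
structure IsPoissonPointProcess {X : Type*} [TopologicalSpace X] [MeasurableSpace X]
    {Ω : Type*} [MeasurableSpace Ω] (P : Measure Ω) (Ξ : Ω → Measure X) (θ : Measure X) :
    Prop where
  isPointProcess : IsPointProcess P Ξ
  laplace_eq : ∀ f : X → ℝ≥0, Measurable f →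
    laplaceFunctional P Ξ f = expNeg (∫⁻ x, (1 - expNeg (f x : ℝ≥0∞)) ∂θ)

/-- Convergence in distribution of point processes: the Laplace functionals converge on
nonnegative continuous functions with compact support. -/
def ConvergesInDistribution {X : Type*} [TopologicalSpace X] [MeasurableSpace X]
    {Ω' : ℕ → Type*} [∀ N, MeasurableSpace (Ω' N)] (P' : ∀ N, Measure (Ω' N))
    (Ξ' : ∀ N, Ω' N → Measure X) {Ω : Type*} [MeasurableSpace Ω] (P : Measure Ω)
    (Ξ : Ω → Measure X) : Prop :=
  ∀ f : X → ℝ≥0, Continuous f → HasCompactSupport f →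
    Tendsto (fun N => laplaceFunctional (P' N) (Ξ' N) f) atTop (𝓝 (laplaceFunctional P Ξ f))

end RieszGas

end

namespace RieszGas

/-! ### The function `expNeg` -/

/-! When `N β → γ`, a particle feels the others only through their average field `γ U`, where `U` is
the Riesz potential of the limiting profile `μ`. Self-consistency reads `μ = Z⁻¹ exp (-γ U) m` with
`m = e^{-V} dx`, the Euler-Lagrange equation of the free energy. A window of size `N^{-1/n}` holds
boundedly many particles on average, and their mutual coupling is of order `N^{-1 + s/n}`, which
vanishes because `s < n`. They become independent, hence Poisson, with intensity the density of `μ`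
at `E`.

The minimizer. The Riesz kernel is a limit of mixtures of Gaussians, and each Gaussian is a
convolution square, so the interaction is positive definite and midpoint convex
(`two_mul_rieszEnergy_le`). The entropy adds a gap that controls the Hellinger distance
(`densityEnergy_midpoint_add_le`). This one inequality makes the square roots of a minimizing
sequence of densities Cauchy in `L²`, and also gives uniqueness. Perturbing the minimizer yields the
mean-field equation (`density_ae_eq_of_minimizer`). Since `s < n`, potentials of bounded densities
are bounded and continuous, whence the regularity of `μ`.

The mean field. Jensen's inequality bounds the partition function below (`le_configZ`). Positive
definiteness, applied to the empirical measure against `N μ`, bounds the Boltzmann weight above.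
Together they dominate the Gibbs measure by `e^{Nκ}` times the product measure of `μ`, with `κ` as
small as desired for large `N` (`configMeasure_le`). Exponential moments of bounded centered sums
absorb this factor (`lintegral_abs_sum_le`). The singular part of the kernel is handled by the
bounded one-particle density (`lintegral_eval_configMeasure_le`). Hence the Boltzmann factor of a
test particle at `a` is close in mean to `exp (-γ U a)`, uniformly in `a`
(`eventually_fieldWeight`).

The Poisson limit. Put `D θ = 𝔼 ∏ (1 - θ φ_N (x_j))`, where `φ_N` is `1 - e^{-f}` rescaled around
`E`. Removing one particle expresses both `D` and `D'` through the same expectation over one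
particle fewer, so that `D' ≈ -(α / Z) D` with `α = lim N ∫ exp (-γ U) φ_N dm`. Integrating from `0`
to `1` gives `D 1 → exp (-α / Z)`, the Poisson Laplace functional (`abs_integral_prod_sub_le`,
`tendsto_integral_prod`). No correlation functions of higher order are needed. -/

lemma expNeg_of_ne_top {t : ℝ≥0∞} (ht : t ≠ ⊤) :
    expNeg t = ENNReal.ofReal (Real.exp (-t.toReal)) := by
  lift t to ℝ≥0 using ht
  rw [expNeg, EReal.coe_nnreal_eq_coe_real, ← EReal.coe_neg, EReal.exp_coe]
  simp

@[simp] lemma expNeg_top : expNeg ⊤ = 0 := by simp [expNeg]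

@[simp] lemma expNeg_zero : expNeg 0 = 1 := by simp [expNeg]

lemma expNeg_ofReal {t : ℝ} (ht : 0 ≤ t) :
    expNeg (ENNReal.ofReal t) = ENNReal.ofReal (Real.exp (-t)) := by
  rw [expNeg_of_ne_top ENNReal.ofReal_ne_top, ENNReal.toReal_ofReal ht]

lemma expNeg_coe (t : ℝ≥0) : expNeg (t : ℝ≥0∞) = ENNReal.ofReal (Real.exp (-t)) := by
  rw [expNeg_of_ne_top ENNReal.coe_ne_top, ENNReal.coe_toReal]

lemma expNeg_antitone : Antitone expNeg := fun _ _ hab =>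
  EReal.exp_monotone (EReal.neg_le_neg_iff.2 (EReal.coe_ennreal_le_coe_ennreal_iff.2 hab))

lemma expNeg_le_one (t : ℝ≥0∞) : expNeg t ≤ 1 := by
  simpa using expNeg_antitone (zero_le (a := t))

lemma expNeg_ne_top (t : ℝ≥0∞) : expNeg t ≠ ⊤ :=
  ((expNeg_le_one t).trans_lt ENNReal.one_lt_top).ne

lemma expNeg_pos {t : ℝ≥0∞} (ht : t ≠ ⊤) : 0 < expNeg t := by
  rw [expNeg_of_ne_top ht]; exact ENNReal.ofReal_pos.2 (Real.exp_pos _)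

lemma expNeg_add (a b : ℝ≥0∞) : expNeg (a + b) = expNeg a * expNeg b := by
  rcases eq_or_ne a ⊤ with rfl | ha
  · simp
  rcases eq_or_ne b ⊤ with rfl | hb
  · simp
  rw [expNeg_of_ne_top ha, expNeg_of_ne_top hb, expNeg_of_ne_top (ENNReal.add_ne_top.2 ⟨ha, hb⟩),
    ← ENNReal.ofReal_mul (Real.exp_pos _).le, ← Real.exp_add, ENNReal.toReal_add ha hb, neg_add]

lemma expNeg_sum {ι : Type*} (S : Finset ι) (a : ι → ℝ≥0∞) :
    expNeg (∑ i ∈ S, a i) = ∏ i ∈ S, expNeg (a i) := by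
  classical
  induction S using Finset.induction_on with
  | empty => simp
  | insert i S hi ih => rw [Finset.sum_insert hi, Finset.prod_insert hi, expNeg_add, ih]

lemma continuous_expNeg : Continuous expNeg := by
  unfold expNeg
  exact ENNReal.continuous_exp.comp (continuous_neg.comp continuous_coe_ennreal_ereal)

@[fun_prop] lemma measurable_expNeg : Measurable expNeg := continuous_expNeg.measurable

/-- Jensen's inequality for `expNeg`. -/
lemma expNeg_lintegral_le {α : Type*} [MeasurableSpace α] (P : Measure α) [IsProbabilityMeasure P]
    {X : α → ℝ≥0∞} (hX : Measurable X) :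
    expNeg (∫⁻ a, X a ∂P) ≤ ∫⁻ a, expNeg (X a) ∂P := by
  rcases eq_or_ne (∫⁻ a, X a ∂P) ⊤ with h | h
  · simp [h]
  set c := (∫⁻ a, X a ∂P).toReal with hc
  have hXt := ae_lt_top hX h
  -- tangent line: `exp (-X) + exp (-c) X ≥ exp (-c) (1 + c)`
  have key : ENNReal.ofReal (Real.exp (-c) * (1 + c)) ≤
      ∫⁻ a, (expNeg (X a) + ENNReal.ofReal (Real.exp (-c)) * X a) ∂P := by
    calc ENNReal.ofReal (Real.exp (-c) * (1 + c))
        = ∫⁻ _, ENNReal.ofReal (Real.exp (-c) * (1 + c)) ∂P := by simp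
      _ ≤ _ := by
        refine lintegral_mono_ae ?_
        filter_upwards [hXt] with a ha
        rw [expNeg_of_ne_top ha.ne]
        conv_rhs => rw [← ENNReal.ofReal_toReal ha.ne, ENNReal.toReal_ofReal ENNReal.toReal_nonneg]
        rw [← ENNReal.ofReal_mul (Real.exp_pos _).le,
          ← ENNReal.ofReal_add (Real.exp_pos _).le (by positivity)]
        refine ENNReal.ofReal_le_ofReal ?_
        have h1 : Real.exp (-(X a).toReal) = Real.exp (-c) * Real.exp (c - (X a).toReal) := by
          rw [← Real.exp_add]; ring_nf
        have h2 := Real.add_one_le_exp (c - (X a).toReal)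
        rw [h1]
        nlinarith [Real.exp_pos (-c)]
  rw [lintegral_add_left (by fun_prop), lintegral_const_mul _ hX,
    ← ENNReal.ofReal_toReal h, ← hc, ← ENNReal.ofReal_mul (Real.exp_pos _).le, mul_add, mul_one,
    ENNReal.ofReal_add (Real.exp_pos _).le (by positivity)] at key
  rw [← ENNReal.ofReal_toReal h, ← hc, expNeg_ofReal (by positivity)]
  exact ENNReal.le_of_add_le_add_right ENNReal.ofReal_ne_top key

/-! ### The Riesz kernel and its regularization -/

variable {n : ℕ}

/-- The regularized Riesz kernel `(|x - y|² + ε)^{-s/2}`. -/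
noncomputable def softKernel (s ε : ℝ) (x y : Space n) : ℝ := (‖x - y‖ ^ 2 + ε) ^ (-(s / 2))

lemma rieszKernel_comm (s : ℝ) (x y : Space n) : rieszKernel s x y = rieszKernel s y x := by
  rw [rieszKernel, rieszKernel, ← enorm_neg, neg_sub]

lemma softKernel_pos (s : ℝ) {ε : ℝ} (hε : 0 < ε) (x y : Space n) : 0 < softKernel s ε x y :=
  Real.rpow_pos_of_pos (by positivity) _

lemma softKernel_le {s : ℝ} (hs : 0 < s) {ε : ℝ} (hε : 0 < ε) (x y : Space n) :
    softKernel s ε x y ≤ ε ^ (-(s / 2)) :=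
  Real.rpow_le_rpow_of_nonpos hε (by nlinarith [sq_nonneg ‖x - y‖]) (by linarith)

lemma softKernel_self (s ε : ℝ) (x : Space n) : softKernel s ε x x = ε ^ (-(s / 2)) := by
  simp [softKernel]

lemma continuous_softKernel_left (s : ℝ) {ε : ℝ} (hε : 0 < ε) (y : Space n) :
    Continuous fun x : Space n => softKernel s ε x y := by
  unfold softKernel
  refine Continuous.rpow_const (by fun_prop) fun p => Or.inl ?_
  positivity

@[fun_prop] lemma measurable_softKernel_comp {α : Type*} [MeasurableSpace α] {f g : α → Space n}
    (s ε : ℝ) (hf : Measurable f) (hg : Measurable g) :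
    Measurable fun a => softKernel s ε (f a) (g a) := by
  unfold softKernel; fun_prop

@[fun_prop] lemma measurable_rieszKernel_comp {α : Type*} [MeasurableSpace α] {f g : α → Space n}
    (s : ℝ) (hf : Measurable f) (hg : Measurable g) :
    Measurable fun a => rieszKernel s (f a) (g a) := by
  unfold rieszKernel; fun_prop

lemma rieszKernel_of_ne {s : ℝ} {x y : Space n} (h : x ≠ y) :
    rieszKernel s x y = ENNReal.ofReal (‖x - y‖ ^ (-s)) := by
  have : 0 < ‖x - y‖ := norm_pos_iff.2 (sub_ne_zero.2 h)
  rw [rieszKernel_comm, rieszKernel, ← ofReal_norm, ENNReal.ofReal_rpow_of_pos this]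

lemma softKernel_eq_ennreal {s ε : ℝ} (hε : 0 < ε) (x y : Space n) :
    ENNReal.ofReal (softKernel s ε x y) =
      (‖x - y‖ₑ ^ 2 + ENNReal.ofReal ε) ^ (-(s / 2)) := by
  rw [softKernel, ← ENNReal.ofReal_rpow_of_pos (by positivity),
    ENNReal.ofReal_add (by positivity) hε.le, ENNReal.ofReal_pow (norm_nonneg _), ofReal_norm]

/-- This is the case `ε = 0` of `softKernel_eq_ennreal`, diagonal included, so that convergence of
the regularized kernel is continuity of a power on `ℝ≥0∞`. -/
lemma rieszKernel_eq_ennreal (s : ℝ) (x y : Space n) :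
    rieszKernel s x y = (‖x - y‖ₑ ^ 2 + ENNReal.ofReal 0) ^ (-(s / 2)) := by
  rw [rieszKernel_comm, rieszKernel, ENNReal.ofReal_zero, add_zero, ← ENNReal.rpow_natCast_mul]
  congr 1
  push_cast; ring

lemma softKernel_le_rieszKernel {s : ℝ} (hs : 0 < s) {ε : ℝ} (hε : 0 < ε) (x y : Space n) :
    ENNReal.ofReal (softKernel s ε x y) ≤ rieszKernel s x y := by
  rw [softKernel_eq_ennreal hε, rieszKernel_eq_ennreal, ENNReal.rpow_neg, ENNReal.rpow_neg]
  gcongr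

lemma softKernel_anti {s : ℝ} (hs : 0 < s) {ε δ : ℝ} (hε : 0 < ε) (h : ε ≤ δ) (x y : Space n) :
    softKernel s δ x y ≤ softKernel s ε x y :=
  Real.rpow_le_rpow_of_nonpos (by positivity) (by linarith) (by linarith)

lemma tendsto_softKernel (s : ℝ) (x y : Space n) :
    Tendsto (fun k : ℕ => ENNReal.ofReal (softKernel s (1 / ((k : ℝ) + 1)) x y)) atTop
      (𝓝 (rieszKernel s x y)) := by
  simp_rw [fun k : ℕ => softKernel_eq_ennreal (s := s) (Nat.one_div_pos_of_nat (n := k)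
    (α := ℝ)) x y, rieszKernel_eq_ennreal]
  refine (ENNReal.continuous_rpow_const.tendsto _).comp ?_
  exact tendsto_const_nhds.add (ENNReal.tendsto_ofReal tendsto_one_div_add_atTop_nhds_zero_nat)

end RieszGas

namespace RieszGas

variable {n : ℕ}

/-! ### Positive definiteness -/

lemma ennreal_two_mul_le (a b : ℝ≥0∞) : 2 * (a * b) ≤ a * a + b * b := by
  rcases eq_or_ne a ⊤ with rfl | ha
  · simp
  rcases eq_or_ne b ⊤ with rfl | hb
  · simp
  lift a to ℝ≥0 using ha
  lift b to ℝ≥0 using hb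
  norm_cast
  rw [← NNReal.coe_le_coe]
  push_cast
  nlinarith [sq_nonneg ((a : ℝ) - b)]

/-- A kernel of the form `∫ h(x, z) h(y, z) dz` is positive definite. -/
lemma two_mul_lintegral_le_of_square {X Z : Type*} [MeasurableSpace X] [MeasurableSpace Z]
    (κ : Measure Z) [SFinite κ] (μ ν : Measure X) [SFinite μ] [SFinite ν] {h : X → Z → ℝ≥0∞}
    (hh : Measurable fun p : X × Z => h p.1 p.2) :
    2 * ∫⁻ x, ∫⁻ y, ∫⁻ z, h x z * h y z ∂κ ∂ν ∂μ ≤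
      ∫⁻ x, ∫⁻ y, ∫⁻ z, h x z * h y z ∂κ ∂μ ∂μ + ∫⁻ x, ∫⁻ y, ∫⁻ z, h x z * h y z ∂κ ∂ν ∂ν := by
  have hx : ∀ x, Measurable (h x) := fun x => hh.comp (measurable_const.prodMk measurable_id)
  have hz : ∀ z, Measurable fun x => h x z := fun z => hh.comp (measurable_id.prodMk measurable_const)
  -- By Tonelli the energy factors at each `z`, and the claim becomes `2ab ≤ a² + b²` pointwise. The
  -- inequality has no subtraction because the energies may be infinite.
  have key : ∀ (μ ν : Measure X) [SFinite μ] [SFinite ν],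
      ∫⁻ x, ∫⁻ y, ∫⁻ z, h x z * h y z ∂κ ∂ν ∂μ =
        ∫⁻ z, (∫⁻ x, h x z ∂μ) * ∫⁻ y, h y z ∂ν ∂κ := by
    intro μ ν _ _
    have h1 : ∀ x, ∫⁻ y, ∫⁻ z, h x z * h y z ∂κ ∂ν = ∫⁻ z, h x z * ∫⁻ y, h y z ∂ν ∂κ := by
      intro x
      rw [lintegral_lintegral_swap]
      · exact lintegral_congr fun z => lintegral_const_mul _ (hz z)
      · refine Measurable.aemeasurable (Measurable.mul ?_ hh)
        exact (hx x).comp measurable_snd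
    simp_rw [h1]
    have h2 : Measurable fun z => ∫⁻ y, h y z ∂ν :=
      Measurable.lintegral_prod_left' hh
    rw [lintegral_lintegral_swap]
    · exact lintegral_congr fun z => lintegral_mul_const _ (hz z)
    · exact (Measurable.mul hh (h2.comp measurable_snd)).aemeasurable
  have hm : ∀ (μ : Measure X) [SFinite μ], Measurable fun z => ∫⁻ y, h y z ∂μ :=
    fun μ _ => Measurable.lintegral_prod_left' hh
  have hμ := hm μ
  have hν := hm ν
  rw [key, key, key, ← lintegral_const_mul _ (by fun_prop), ← lintegral_add_left (by fun_prop)]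
  exact lintegral_mono fun z => ennreal_two_mul_le _ _

/-- The parallelogram law gives `2t(|p|² + |q|²) = t|p - q|² + t|p + q|²` for `p = x - z`, `q = y -
z`, and `p + q` is twice the midpoint of `x` and `y` minus `z`. Up to a constant, the Gaussian
kernel is therefore a convolution square. -/
lemma lintegral_gaussian_mul {t : ℝ} (x y : Space n) :
    ∫⁻ z, ENNReal.ofReal (Real.exp (-(2 * t * ‖x - z‖ ^ 2))) *
        ENNReal.ofReal (Real.exp (-(2 * t * ‖y - z‖ ^ 2))) =
      ENNReal.ofReal (Real.exp (-(t * ‖x - y‖ ^ 2))) *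
        ∫⁻ z : Space n, ENNReal.ofReal (Real.exp (-(4 * t) * ‖z‖ ^ 2)) := by
  conv_rhs => rw [← lintegral_const_mul _ (by fun_prop),
    ← lintegral_sub_left_eq_self _ ((1 / 2 : ℝ) • (x + y))]
  refine lintegral_congr fun z => ?_
  rw [← ENNReal.ofReal_mul (Real.exp_pos _).le, ← ENNReal.ofReal_mul (Real.exp_pos _).le,
    ← Real.exp_add, ← Real.exp_add]
  congr 2
  set p := x - z
  set q := y - z
  have h1 : x - y = p - q := by simp [p, q]
  have h2 : (1 / 2 : ℝ) • (x + y) - z = (1 / 2 : ℝ) • (p + q) := by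
    simp only [p, q]; module
  rw [h1, h2, norm_smul, mul_pow]
  have := parallelogram_law_with_norm ℝ p q
  norm_num
  linear_combination t * this

lemma lintegral_gaussian_ne {b : ℝ} (hb : 0 < b) :
    (∫⁻ z : Space n, ENNReal.ofReal (Real.exp (-b * ‖z‖ ^ 2))) ≠ 0 ∧
      (∫⁻ z : Space n, ENNReal.ofReal (Real.exp (-b * ‖z‖ ^ 2))) ≠ ⊤ := by
  have h := GaussianFourier.integral_rexp_neg_mul_sq_norm (V := Space n) hb
  have hpos : 0 < (Real.pi / b) ^ ((Module.finrank ℝ (Space n) : ℝ) / 2) :=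
    Real.rpow_pos_of_pos (div_pos Real.pi_pos hb) _
  -- A non-integrable function has Bochner integral zero, against the positive value in `h`.
  have hi : Integrable fun z : Space n => Real.exp (-b * ‖z‖ ^ 2) := by
    by_contra hcon
    rw [integral_undef hcon] at h
    exact hpos.ne h
  rw [← ofReal_integral_eq_lintegral_ofReal hi (ae_of_all _ fun _ => (Real.exp_pos _).le), h]
  exact ⟨by simpa using hpos, ENNReal.ofReal_ne_top⟩

lemma two_mul_gaussianEnergy_le {t : ℝ} (ht : 0 < t) (μ ν : Measure (Space n)) [SFinite μ]
    [SFinite ν] :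
    2 * ∫⁻ x, ∫⁻ y, ENNReal.ofReal (Real.exp (-(t * ‖x - y‖ ^ 2))) ∂ν ∂μ ≤
      ∫⁻ x, ∫⁻ y, ENNReal.ofReal (Real.exp (-(t * ‖x - y‖ ^ 2))) ∂μ ∂μ +
        ∫⁻ x, ∫⁻ y, ENNReal.ofReal (Real.exp (-(t * ‖x - y‖ ^ 2))) ∂ν ∂ν := by
  have h := two_mul_lintegral_le_of_square (volume : Measure (Space n)) μ ν
    (h := fun x z => ENNReal.ofReal (Real.exp (-(2 * t * ‖x - z‖ ^ 2)))) (by fun_prop)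
  simp_rw [lintegral_gaussian_mul] at h
  obtain ⟨h0, h1⟩ := lintegral_gaussian_ne (n := n) (b := 4 * t) (by linarith)
  have e : ∀ (μ ν : Measure (Space n)) [SFinite μ] [SFinite ν],
      ∫⁻ x, ∫⁻ y, ENNReal.ofReal (Real.exp (-(t * ‖x - y‖ ^ 2))) *
        (∫⁻ z : Space n, ENNReal.ofReal (Real.exp (-(4 * t) * ‖z‖ ^ 2))) ∂ν ∂μ =
      (∫⁻ x, ∫⁻ y, ENNReal.ofReal (Real.exp (-(t * ‖x - y‖ ^ 2))) ∂ν ∂μ) *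
        (∫⁻ z : Space n, ENNReal.ofReal (Real.exp (-(4 * t) * ‖z‖ ^ 2))) := by
    intro μ ν _ _
    simp_rw [lintegral_mul_const' _ _ h1]
  rw [e, e, e, ← mul_assoc, ← add_mul] at h
  exact (ENNReal.mul_le_mul_iff_left h0 h1).1 h

/-- The Gamma integral `r^{-s/2} = Γ(s/2)⁻¹ ∫ t^{s/2-1} e^{-rt} dt` at `r = |x - y|² + ε` exhibits
the kernel as a positive mixture of Gaussians. -/
lemma softKernel_eq_lintegral {s : ℝ} (hs : 0 < s) {ε : ℝ} (hε : 0 < ε) (x y : Space n) :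
    ENNReal.ofReal (softKernel s ε x y) =
      ∫⁻ t in Set.Ioi (0 : ℝ),
        ENNReal.ofReal (t ^ (s / 2 - 1) * Real.exp (-(ε * t)) / Real.Gamma (s / 2)) *
          ENNReal.ofReal (Real.exp (-(t * ‖x - y‖ ^ 2))) := by
  have hs2 : 0 < s / 2 := by linarith
  have hr : 0 < ‖x - y‖ ^ 2 + ε := by positivity
  have hG := Real.Gamma_pos_of_pos hs2
  have h := Real.integral_rpow_mul_exp_neg_mul_Ioi hs2 hr
  have hi : IntegrableOn (fun t : ℝ => t ^ (s / 2 - 1) * Real.exp (-((‖x - y‖ ^ 2 + ε) * t)))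
      (Set.Ioi 0) := by
    by_contra hcon
    rw [integral_undef hcon] at h
    have : 0 < (1 / (‖x - y‖ ^ 2 + ε)) ^ (s / 2) * Real.Gamma (s / 2) :=
      mul_pos (Real.rpow_pos_of_pos (by positivity) _) hG
    exact this.ne h
  have hk : softKernel s ε x y = ∫ t in Set.Ioi (0 : ℝ),
      t ^ (s / 2 - 1) * Real.exp (-((‖x - y‖ ^ 2 + ε) * t)) / Real.Gamma (s / 2) := by
    rw [integral_div, h, mul_div_assoc, div_self hG.ne', mul_one, softKernel, one_div,
      Real.inv_rpow hr.le, Real.rpow_neg hr.le]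
  rw [hk, ofReal_integral_eq_lintegral_ofReal (hi.div_const _)]
  · refine setLIntegral_congr_fun measurableSet_Ioi fun t ht => ?_
    rw [Set.mem_Ioi] at ht
    rw [← ENNReal.ofReal_mul (by positivity)]
    congr 1
    have : Real.exp (-((‖x - y‖ ^ 2 + ε) * t)) =
        Real.exp (-(ε * t)) * Real.exp (-(t * ‖x - y‖ ^ 2)) := by
      rw [← Real.exp_add]; ring_nf
    rw [this]; ring
  · filter_upwards [ae_restrict_mem measurableSet_Ioi] with t ht
    rw [Set.mem_Ioi] at ht
    simp only [Pi.zero_apply]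
    positivity

/-- The regularized Riesz kernel is positive definite. -/
lemma two_mul_softEnergy_le {s : ℝ} (hs : 0 < s) {ε : ℝ} (hε : 0 < ε) (μ ν : Measure (Space n))
    [SFinite μ] [SFinite ν] :
    2 * ∫⁻ x, ∫⁻ y, ENNReal.ofReal (softKernel s ε x y) ∂ν ∂μ ≤
      ∫⁻ x, ∫⁻ y, ENNReal.ofReal (softKernel s ε x y) ∂μ ∂μ +
        ∫⁻ x, ∫⁻ y, ENNReal.ofReal (softKernel s ε x y) ∂ν ∂ν := by
  simp_rw [softKernel_eq_lintegral hs hε]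
  set c : ℝ → ℝ≥0∞ := fun t =>
    ENNReal.ofReal (t ^ (s / 2 - 1) * Real.exp (-(ε * t)) / Real.Gamma (s / 2)) with hc
  have hcm : Measurable c := by fun_prop
  -- Tonelli takes the mixing variable `t` outside, and the Gaussian inequality is then used for
  -- each `t > 0`.
  have key : ∀ (μ ν : Measure (Space n)) [SFinite μ] [SFinite ν],
      ∫⁻ x, ∫⁻ y, (∫⁻ t in Set.Ioi (0 : ℝ),
        c t * ENNReal.ofReal (Real.exp (-(t * ‖x - y‖ ^ 2)))) ∂ν ∂μ = ∫⁻ t in Set.Ioi (0 : ℝ), c t *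
          ∫⁻ x, ∫⁻ y, ENNReal.ofReal (Real.exp (-(t * ‖x - y‖ ^ 2))) ∂ν ∂μ := by
    intro μ ν _ _
    have h1 : ∀ x, ∫⁻ y, (∫⁻ t in Set.Ioi (0 : ℝ),
        c t * ENNReal.ofReal (Real.exp (-(t * ‖x - y‖ ^ 2)))) ∂ν = ∫⁻ t in Set.Ioi (0 : ℝ), c t *
          ∫⁻ y, ENNReal.ofReal (Real.exp (-(t * ‖x - y‖ ^ 2))) ∂ν := by
      intro x
      rw [lintegral_lintegral_swap (by fun_prop)]
      exact lintegral_congr fun t => lintegral_const_mul _ (by fun_prop)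
    simp_rw [h1]
    have hm : Measurable fun p : Space n × ℝ =>
        ∫⁻ y, ENNReal.ofReal (Real.exp (-(p.2 * ‖p.1 - y‖ ^ 2))) ∂ν :=
      Measurable.lintegral_prod_right' (f := fun q : (Space n × ℝ) × Space n =>
        ENNReal.ofReal (Real.exp (-(q.1.2 * ‖q.1.1 - q.2‖ ^ 2)))) (by fun_prop)
    rw [lintegral_lintegral_swap]
    · refine lintegral_congr fun t => lintegral_const_mul _ ?_
      exact hm.comp (measurable_id.prodMk measurable_const)
    · exact ((hcm.comp measurable_snd).mul hm).aemeasurable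
  have hmt : ∀ (μ ν : Measure (Space n)) [SFinite μ] [SFinite ν], Measurable fun t : ℝ => c t *
      ∫⁻ x, ∫⁻ y, ENNReal.ofReal (Real.exp (-(t * ‖x - y‖ ^ 2))) ∂ν ∂μ := by
    intro μ ν _ _
    refine hcm.mul (Measurable.lintegral_prod_right' (f := fun q : ℝ × Space n =>
      ∫⁻ y, ENNReal.ofReal (Real.exp (-(q.1 * ‖q.2 - y‖ ^ 2))) ∂ν) ?_)
    exact Measurable.lintegral_prod_right' (f := fun q : (ℝ × Space n) × Space n =>
        ENNReal.ofReal (Real.exp (-(q.1.1 * ‖q.1.2 - q.2‖ ^ 2)))) (by fun_prop)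
  rw [key, key, key, ← lintegral_const_mul _ (hmt μ ν), ← lintegral_add_left (hmt μ μ)]
  refine setLIntegral_mono' measurableSet_Ioi fun t ht => ?_
  rw [← mul_add, mul_left_comm]
  gcongr
  exact two_mul_gaussianEnergy_le ht μ ν

/-- The regularized kernels increase as the parameter decreases, so monotone convergence applies to
both integrals without any finiteness assumption. -/
lemma tendsto_softEnergy {s : ℝ} (hs : 0 < s) (μ ν : Measure (Space n)) [SFinite μ]
    [SFinite ν] :
    Tendsto (fun k : ℕ => ∫⁻ x, ∫⁻ y, ENNReal.ofReal (softKernel s (1 / ((k : ℝ) + 1)) x y) ∂ν ∂μ)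
      atTop (𝓝 (∫⁻ x, ∫⁻ y, rieszKernel s x y ∂ν ∂μ)) := by
  have hmono : ∀ x y : Space n,
      Monotone fun k : ℕ => ENNReal.ofReal (softKernel s (1 / ((k : ℝ) + 1)) x y) := by
    intro x y k l hkl
    refine ENNReal.ofReal_le_ofReal (softKernel_anti hs Nat.one_div_pos_of_nat ?_ x y)
    exact one_div_le_one_div_of_le (by positivity) (by exact_mod_cast Nat.add_le_add_right hkl 1)
  refine lintegral_tendsto_of_tendsto_of_monotone ?_ ?_ ?_
  · intro k
    refine Measurable.aemeasurable ?_
    exact Measurable.lintegral_prod_right' (f := fun q : Space n × Space n =>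
      ENNReal.ofReal (softKernel s (1 / ((k : ℝ) + 1)) q.1 q.2)) (by fun_prop)
  · exact ae_of_all _ fun x k l hkl => lintegral_mono fun y => hmono x y hkl
  · refine ae_of_all _ fun x => lintegral_tendsto_of_tendsto_of_monotone (fun k => ?_)
      (ae_of_all _ fun y => hmono x y) (ae_of_all _ fun y => tendsto_softKernel s x y)
    fun_prop

/-- The Riesz kernel is positive definite. -/
lemma two_mul_rieszEnergy_le {s : ℝ} (hs : 0 < s) (μ ν : Measure (Space n))
    [SFinite μ] [SFinite ν] :
    2 * ∫⁻ x, ∫⁻ y, rieszKernel s x y ∂ν ∂μ ≤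
      interactionEnergy s μ + interactionEnergy s ν :=
  le_of_tendsto_of_tendsto'
    (ENNReal.Tendsto.const_mul (tendsto_softEnergy hs μ ν) (Or.inr (by norm_num)))
    ((tendsto_softEnergy hs μ μ).add (tendsto_softEnergy hs ν ν))
    fun _ => two_mul_softEnergy_le hs Nat.one_div_pos_of_nat μ ν

end RieszGas

namespace RieszGas

variable {n : ℕ}

/-! ### Potentials of measures with bounded density -/

/-- In polar coordinates this is `∫₀¹ r^{n-1-s} dr`, finite exactly because `s < n`. -/
lemma lintegral_ball_rpow_lt_top {s : ℝ} (hs : 0 < s) (hsn : s < n) :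
    ∫⁻ z in Metric.ball (0 : Space n) 1, ‖z‖ₑ ^ (-s) < ⊤ := by
  have hn : 0 < n := by exact_mod_cast hs.trans hsn
  have : Nonempty (Fin n) := ⟨⟨0, hn⟩⟩
  have hi : IntegrableOn (fun z : Space n => ‖z‖ ^ (-s)) (Metric.ball (0 : Space n) 1) := by
    rw [integrableOn_fun_norm_addHaar volume (f := fun r : ℝ => r ^ (-s)), finrank_euclideanSpace,
      Fintype.card_fin]
    have : IntegrableOn (fun y : ℝ => y ^ ((n : ℝ) - 1 - s)) (Set.Ioo 0 1) :=
      (intervalIntegral.integrableOn_Ioo_rpow_iff one_pos).2 (by linarith)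
    refine this.congr_fun (fun y hy => ?_) measurableSet_Ioo
    have hy0 : 0 < y := hy.1
    simp only [smul_eq_mul]
    rw [← Real.rpow_natCast, ← Real.rpow_add hy0]
    congr 1
    push_cast [Nat.cast_sub (Nat.one_le_iff_ne_zero.2 hn.ne')]
    ring
  have h0 : ∀ᵐ z : Space n, z ≠ 0 := by simp [ae_iff]
  refine lt_of_le_of_lt (lintegral_mono_ae ?_) hi.2
  filter_upwards [ae_restrict_of_ae h0] with z hz
  have hz' : 0 < ‖z‖ := norm_pos_iff.2 hz
  rw [← ofReal_norm, ENNReal.ofReal_rpow_of_pos hz', ← ofReal_norm,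
    Real.norm_of_nonneg (by positivity)]

/-- Within distance `1` the density bound reduces to Lebesgue measure; beyond it the kernel is at
most `1`. The bound does not depend on `x`. -/
lemma lintegral_rieszKernel_le {s : ℝ} (hs : 0 < s) {C : ℝ≥0∞} {μ : Measure (Space n)}
    (hμ : μ ≤ C • volume) (x : Space n) :
    ∫⁻ y, rieszKernel s x y ∂μ ≤
      C * (∫⁻ z in Metric.ball (0 : Space n) 1, ‖z‖ₑ ^ (-s)) + μ Set.univ := by
  have hpt : ∀ y, rieszKernel s x y ≤
      (Metric.ball (0 : Space n) 1).indicator (fun z => ‖z‖ₑ ^ (-s)) (x - y) + 1 := by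
    intro y
    rw [rieszKernel_comm, rieszKernel]
    by_cases h : x - y ∈ Metric.ball (0 : Space n) 1
    · rw [Set.indicator_of_mem h]; exact le_self_add
    · rw [Set.indicator_of_notMem h, zero_add]
      rw [mem_ball_zero_iff, not_lt] at h
      rw [ENNReal.rpow_neg, ENNReal.inv_le_one]
      have : (1 : ℝ≥0∞) ≤ ‖x - y‖ₑ := by
        rw [← ofReal_norm, ← ENNReal.ofReal_one]; exact ENNReal.ofReal_le_ofReal h
      exact ENNReal.one_le_rpow this hs
  have hm : Measurable ((Metric.ball (0 : Space n) 1).indicator fun z => ‖z‖ₑ ^ (-s)) :=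
    Measurable.indicator (by fun_prop) measurableSet_ball
  calc ∫⁻ y, rieszKernel s x y ∂μ
      ≤ ∫⁻ y, ((Metric.ball (0 : Space n) 1).indicator (fun z => ‖z‖ₑ ^ (-s)) (x - y) + 1) ∂μ :=
        lintegral_mono hpt
    _ = ∫⁻ y, (Metric.ball (0 : Space n) 1).indicator (fun z => ‖z‖ₑ ^ (-s)) (x - y) ∂μ
          + μ Set.univ := by
        rw [lintegral_add_right _ measurable_const]; simp
    _ ≤ ∫⁻ y, (Metric.ball (0 : Space n) 1).indicator (fun z => ‖z‖ₑ ^ (-s)) (x - y)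
          ∂(C • volume) + μ Set.univ := by gcongr
    _ = _ := by
        rw [lintegral_smul_measure, lintegral_sub_left_eq_self, lintegral_indicator measurableSet_ball,
          smul_eq_mul]

/-- The Riesz kernel is approximated by the regularized one, uniformly with respect to integration
against measures of bounded density. -/
lemma exists_softKernel_approx {s : ℝ} (hs : 0 < s) (hsn : s < n) {C : ℝ≥0∞} (hC : C ≠ ⊤)
    {τ : ℝ≥0∞} (hτ : τ ≠ 0) :
    ∃ ε : ℝ, 0 < ε ∧ ∀ μ : Measure (Space n), μ ≤ C • volume → μ Set.univ ≤ C → ∀ x,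
      ∫⁻ y, (rieszKernel s x y - ENNReal.ofReal (softKernel s ε x y)) ∂μ ≤ τ := by
  set D : ℕ → Space n → ℝ≥0∞ := fun k z =>
    rieszKernel s z 0 - ENNReal.ofReal (softKernel s (1 / ((k : ℝ) + 1)) z 0) with hD
  have hDm : ∀ k, Measurable (D k) := fun k => by simp only [hD]; fun_prop
  -- Far-field error: for `r ≥ 1` the deficit is `r^{-s} (1 - (1 + ε/r²)^{-s/2})`, at most `1 - (1 +
  -- ε)^{-s/2}`. The near-field deficit `D k` tends to zero in `L¹` of the unit ball by dominated
  -- convergence.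
  set c : ℕ → ℝ := fun k => 1 - (1 + 1 / ((k : ℝ) + 1)) ^ (-(s / 2)) with hc
  have hkpos : ∀ k : ℕ, (0 : ℝ) < 1 / ((k : ℝ) + 1) := fun k => Nat.one_div_pos_of_nat
  have : Nonempty (Fin n) := ⟨⟨0, by exact_mod_cast hs.trans hsn⟩⟩
  have h1 : Tendsto (fun k => C * (∫⁻ z in Metric.ball (0 : Space n) 1, D k z) +
      ENNReal.ofReal (c k) * C) atTop (𝓝 (C * 0 + ENNReal.ofReal 0 * C)) := by
    refine Tendsto.add (ENNReal.Tendsto.const_mul ?_ (Or.inr hC))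
      (ENNReal.Tendsto.mul_const (ENNReal.tendsto_ofReal ?_) (Or.inr hC))
    · have h0 : ∀ᵐ z : Space n, z ≠ 0 := by simp [ae_iff]
      have := tendsto_lintegral_of_dominated_convergence
        (μ := volume.restrict (Metric.ball (0 : Space n) 1)) (F := D) (f := fun _ => 0)
        (fun z => ‖z‖ₑ ^ (-s)) hDm (fun k => ae_of_all _ fun z => ?_)
        (lintegral_ball_rpow_lt_top hs hsn).ne ?_
      · simpa using this
      · refine tsub_le_self.trans_eq ?_
        rw [rieszKernel_comm, rieszKernel, sub_zero]
      · filter_upwards [ae_restrict_of_ae h0] with z hz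
        have hfin : rieszKernel s z 0 ≠ ⊤ := by
          rw [rieszKernel_of_ne hz]; exact ENNReal.ofReal_ne_top
        have := ENNReal.Tendsto.sub (tendsto_const_nhds (x := rieszKernel s z 0) (f := atTop))
          (tendsto_softKernel s z 0) (Or.inl hfin)
        rwa [tsub_self] at this
    · have : Tendsto (fun k : ℕ => (1 + 1 / ((k : ℝ) + 1)) ^ (-(s / 2))) atTop
          (𝓝 ((1 + 0) ^ (-(s / 2)))) :=
        (tendsto_const_nhds.add tendsto_one_div_add_atTop_nhds_zero_nat).rpow_const
          (Or.inl (by norm_num))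
      simpa [hc] using tendsto_const_nhds (x := (1 : ℝ)) |>.sub this
  rw [mul_zero, ENNReal.ofReal_zero, zero_mul, zero_add] at h1
  obtain ⟨k, hk⟩ := (h1.eventually (gt_mem_nhds (pos_iff_ne_zero.2 hτ))).exists
  refine ⟨1 / ((k : ℝ) + 1), hkpos k, fun μ hμ hμ1 x => le_trans ?_ hk.le⟩
  have hpt : ∀ y, rieszKernel s x y - ENNReal.ofReal (softKernel s (1 / ((k : ℝ) + 1)) x y) ≤
      (Metric.ball (0 : Space n) 1).indicator (D k) (x - y) + ENNReal.ofReal (c k) := by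
    intro y
    by_cases h : x - y ∈ Metric.ball (0 : Space n) 1
    · rw [Set.indicator_of_mem h]
      refine le_trans (le_of_eq ?_) le_self_add
      simp [hD, rieszKernel, softKernel, ← enorm_neg (x - y)]
    · rw [Set.indicator_of_notMem h, zero_add]
      rw [mem_ball_zero_iff, not_lt] at h
      have hne : x ≠ y := by rintro rfl; simp at h; linarith
      set r := ‖x - y‖ with hr
      have hr0 : 0 < r := by linarith
      rw [rieszKernel_of_ne hne, ← ENNReal.ofReal_sub _ (softKernel_pos s (hkpos k) x y).le]
      refine ENNReal.ofReal_le_ofReal ?_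
      simp only [softKernel, ← hr, hc]
      set ε := 1 / ((k : ℝ) + 1)
      have hε : 0 < ε := hkpos k
      have e1 : (r ^ 2 + ε) ^ (-(s / 2)) = r ^ (-s) * (1 + ε / r ^ 2) ^ (-(s / 2)) := by
        have : r ^ 2 + ε = r ^ 2 * (1 + ε / r ^ 2) := by field_simp
        rw [this, Real.mul_rpow (by positivity) (by positivity), ← Real.rpow_natCast,
          ← Real.rpow_mul hr0.le]
        congr 2
        push_cast; ring
      have e2 : (1 + ε) ^ (-(s / 2)) ≤ (1 + ε / r ^ 2) ^ (-(s / 2)) := by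
        refine Real.rpow_le_rpow_of_nonpos (by positivity) ?_ (by linarith)
        have : ε / r ^ 2 ≤ ε := div_le_self hε.le (one_le_pow₀ h)
        linarith
      have e3 : r ^ (-s) ≤ 1 := Real.rpow_le_one_of_one_le_of_nonpos h (by linarith)
      have e4 : (1 + ε) ^ (-(s / 2)) ≤ 1 :=
        Real.rpow_le_one_of_one_le_of_nonpos (by linarith) (by linarith)
      have e5 : 0 < r ^ (-s) := Real.rpow_pos_of_pos hr0 _
      rw [e1]
      nlinarith
  have hm : Measurable ((Metric.ball (0 : Space n) 1).indicator (D k)) :=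
    (hDm k).indicator measurableSet_ball
  calc ∫⁻ y, (rieszKernel s x y - ENNReal.ofReal (softKernel s (1 / ((k : ℝ) + 1)) x y)) ∂μ
      ≤ ∫⁻ y, ((Metric.ball (0 : Space n) 1).indicator (D k) (x - y) + ENNReal.ofReal (c k)) ∂μ :=
        lintegral_mono hpt
    _ = ∫⁻ y, (Metric.ball (0 : Space n) 1).indicator (D k) (x - y) ∂μ
          + ENNReal.ofReal (c k) * μ Set.univ := by
        rw [lintegral_add_right _ measurable_const]; simp
    _ ≤ ∫⁻ y, (Metric.ball (0 : Space n) 1).indicator (D k) (x - y) ∂(C • volume)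
          + ENNReal.ofReal (c k) * C := by gcongr
    _ = _ := by
        rw [lintegral_smul_measure, lintegral_sub_left_eq_self, lintegral_indicator measurableSet_ball,
          smul_eq_mul]

/-- The Riesz potential of a measure, as a real number. -/
noncomputable def potential (s : ℝ) (μ : Measure (Space n)) (x : Space n) : ℝ :=
  (∫⁻ y, rieszKernel s x y ∂μ).toReal

lemma potential_nonneg (s : ℝ) (μ : Measure (Space n)) (x : Space n) : 0 ≤ potential s μ x :=
  ENNReal.toReal_nonneg

lemma lintegral_softKernel_le (s : ℝ) (hs : 0 < s) {ε : ℝ} (hε : 0 < ε) (μ : Measure (Space n))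
    (x : Space n) :
    ∫⁻ y, ENNReal.ofReal (softKernel s ε x y) ∂μ ≤ ∫⁻ y, rieszKernel s x y ∂μ :=
  lintegral_mono fun y => softKernel_le_rieszKernel hs hε x y

lemma integrable_softKernel {s : ℝ} (hs : 0 < s) {ε : ℝ} (hε : 0 < ε) (μ : Measure (Space n))
    [IsFiniteMeasure μ] (x : Space n) : Integrable (softKernel s ε x) μ := by
  refine Integrable.of_bound (C := ε ^ (-(s / 2))) ?_ (ae_of_all _ fun y => ?_)
  · exact Measurable.aestronglyMeasurable (by fun_prop)
  · rw [Real.norm_of_nonneg (softKernel_pos s hε x y).le]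
    exact softKernel_le hs hε x y

lemma continuous_integral_softKernel {s : ℝ} (hs : 0 < s) {ε : ℝ} (hε : 0 < ε)
    (μ : Measure (Space n)) [IsFiniteMeasure μ] :
    Continuous fun x => ∫ y, softKernel s ε x y ∂μ := by
  refine continuous_of_dominated (bound := fun _ => ε ^ (-(s / 2))) (fun x => ?_) (fun x => ?_)
    (integrable_const _) (ae_of_all _ fun y => ?_)
  · exact (integrable_softKernel hs hε μ x).1
  · refine ae_of_all _ fun y => ?_
    rw [Real.norm_of_nonneg (softKernel_pos s hε x y).le]
    exact softKernel_le hs hε x y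
  · exact continuous_softKernel_left s hε y

section BoundedDensity

variable {s : ℝ} {C : ℝ≥0∞} {μ : Measure (Space n)}

lemma lintegral_rieszKernel_ne_top (hs : 0 < s) (hsn : s < n) (hC : C ≠ ⊤)
    (hμ : μ ≤ C • volume) (hμ1 : μ Set.univ ≤ C) (x : Space n) :
    ∫⁻ y, rieszKernel s x y ∂μ ≠ ⊤ := by
  refine ((lintegral_rieszKernel_le hs hμ x).trans_lt ?_).ne
  exact ENNReal.add_lt_top.2 ⟨ENNReal.mul_lt_top hC.lt_top (lintegral_ball_rpow_lt_top hs hsn),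
    hμ1.trans_lt hC.lt_top⟩

lemma ofReal_potential (hs : 0 < s) (hsn : s < n) (hC : C ≠ ⊤)
    (hμ : μ ≤ C • volume) (hμ1 : μ Set.univ ≤ C) (x : Space n) :
    ENNReal.ofReal (potential s μ x) = ∫⁻ y, rieszKernel s x y ∂μ :=
  ENNReal.ofReal_toReal (lintegral_rieszKernel_ne_top hs hsn hC hμ hμ1 x)

lemma exists_potential_le (hs : 0 < s) (hsn : s < n) (hC : C ≠ ⊤)
    (hμ : μ ≤ C • volume) (hμ1 : μ Set.univ ≤ C) : ∃ B : ℝ, ∀ x, potential s μ x ≤ B := by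
  refine ⟨(C * (∫⁻ z in Metric.ball (0 : Space n) 1, ‖z‖ₑ ^ (-s)) + C).toReal, fun x => ?_⟩
  refine ENNReal.toReal_mono ?_ ((lintegral_rieszKernel_le hs hμ x).trans (by gcongr))
  exact (ENNReal.add_lt_top.2 ⟨ENNReal.mul_lt_top hC.lt_top (lintegral_ball_rpow_lt_top hs hsn),
    hC.lt_top⟩).ne

/-- The regularized potential is uniformly close to the potential. -/
lemma exists_integral_softKernel_approx [IsFiniteMeasure μ] (hs : 0 < s) (hsn : s < n)
    (hC : C ≠ ⊤) (hμ : μ ≤ C • volume) (hμ1 : μ Set.univ ≤ C) {τ : ℝ} (hτ : 0 < τ) :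
    ∃ ε : ℝ, 0 < ε ∧ (∀ ν : Measure (Space n), ν ≤ C • volume → ν Set.univ ≤ C → ∀ x,
      ∫⁻ y, (rieszKernel s x y - ENNReal.ofReal (softKernel s ε x y)) ∂ν ≤ ENNReal.ofReal τ) ∧
      ∀ x, ∫ y, softKernel s ε x y ∂μ ≤ potential s μ x ∧
        potential s μ x ≤ ∫ y, softKernel s ε x y ∂μ + τ := by
  -- A single `ε` serves all measures bounded by `C`; later it is used for `m` and `μ` at once.
  obtain ⟨ε, hε, h⟩ := exists_softKernel_approx (n := n) hs hsn hC
    (ENNReal.ofReal_pos.2 hτ).ne'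
  refine ⟨ε, hε, h, fun x => ?_⟩
  have hnn : 0 ≤ ∫ y, softKernel s ε x y ∂μ :=
    integral_nonneg fun y => (softKernel_pos s hε x y).le
  have e : ENNReal.ofReal (∫ y, softKernel s ε x y ∂μ) =
      ∫⁻ y, ENNReal.ofReal (softKernel s ε x y) ∂μ :=
    ofReal_integral_eq_lintegral_ofReal (integrable_softKernel hs hε μ x)
      (ae_of_all _ fun y => (softKernel_pos s hε x y).le)
  constructor
  · rw [← ENNReal.ofReal_le_ofReal_iff (potential_nonneg s μ x), e,
      ofReal_potential hs hsn hC hμ hμ1]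
    exact lintegral_softKernel_le s hs hε μ x
  · rw [← ENNReal.ofReal_le_ofReal_iff (by positivity), ofReal_potential hs hsn hC hμ hμ1,
      ENNReal.ofReal_add hnn hτ.le, e]
    refine le_trans ?_ (add_le_add le_rfl (h μ hμ hμ1 x))
    rw [← lintegral_add_left (by fun_prop)]
    exact lintegral_mono fun y => le_add_tsub

/-- Regularized potentials are continuous, their kernel being bounded and continuous, and they
approximate the potential uniformly. -/
lemma continuous_potential [IsFiniteMeasure μ] (hs : 0 < s) (hsn : s < n)
    (hC : C ≠ ⊤) (hμ : μ ≤ C • volume) (hμ1 : μ Set.univ ≤ C) : Continuous (potential s μ) := by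
  refine continuous_of_uniform_approx_of_continuous fun u hu => ?_
  obtain ⟨τ, hτ, hτu⟩ := Metric.mem_uniformity_dist.1 hu
  obtain ⟨ε, hε, -, h⟩ := exists_integral_softKernel_approx hs hsn hC hμ hμ1 (half_pos hτ)
  refine ⟨_, continuous_integral_softKernel hs hε μ, fun x => hτu ?_⟩
  rw [Real.dist_eq, abs_lt]
  constructor <;> linarith [h x]

end BoundedDensity

end RieszGas

namespace RieszGas

variable {n : ℕ}

/-! ### The free energy as a function of the density -/

/-- The mutual energy of two measures. -/
noncomputable def mutualEnergy (s : ℝ) (μ ν : Measure (Space n)) : ℝ≥0∞ :=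
  ∫⁻ x, ∫⁻ z, rieszKernel s x z ∂ν ∂μ

lemma measurable_lintegral_rieszKernel (s : ℝ) (μ : Measure (Space n)) [SFinite μ] :
    Measurable fun x => ∫⁻ z, rieszKernel s x z ∂μ :=
  Measurable.lintegral_prod_right' (f := fun q : Space n × Space n => rieszKernel s q.1 q.2)
    (by fun_prop)

lemma mutualEnergy_comm (s : ℝ) (μ ν : Measure (Space n)) [SFinite μ] [SFinite ν] :
    mutualEnergy s μ ν = mutualEnergy s ν μ := by
  rw [mutualEnergy, lintegral_lintegral_swap (by fun_prop)]
  simp_rw [rieszKernel_comm s _ _]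
  rfl

lemma interactionEnergy_combination (s : ℝ) (μ ν : Measure (Space n)) [SFinite μ] [SFinite ν]
    (a b : ℝ≥0∞) :
    interactionEnergy s (a • μ + b • ν) = a * a * interactionEnergy s μ +
      2 * (a * b) * mutualEnergy s μ ν + b * b * interactionEnergy s ν := by
  have hμ := measurable_lintegral_rieszKernel s μ
  have hν := measurable_lintegral_rieszKernel s ν
  simp only [interactionEnergy, lintegral_add_measure, lintegral_smul_measure, smul_eq_mul]
  rw [lintegral_add_left (by fun_prop), lintegral_add_left (by fun_prop),
    lintegral_const_mul _ hμ, lintegral_const_mul _ hν, lintegral_const_mul _ hμ,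
    lintegral_const_mul _ hν]
  have h1 : ∫⁻ x, ∫⁻ z, rieszKernel s x z ∂ν ∂μ = mutualEnergy s μ ν := rfl
  have h2 : ∫⁻ x, ∫⁻ z, rieszKernel s x z ∂μ ∂ν = mutualEnergy s μ ν := by
    rw [mutualEnergy_comm]; rfl
  rw [h1, h2]
  ring

lemma two_mul_mutualEnergy_le {s : ℝ} (hs : 0 < s) (μ ν : Measure (Space n))
    [SFinite μ] [SFinite ν] :
    2 * mutualEnergy s μ ν ≤ interactionEnergy s μ + interactionEnergy s ν :=
  two_mul_rieszEnergy_le hs μ ν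

lemma interactionEnergy_midpoint_le {s : ℝ} (hs : 0 < s) (μ ν : Measure (Space n))
    [SFinite μ] [SFinite ν] :
    interactionEnergy s ((2⁻¹ : ℝ≥0∞) • μ + (2⁻¹ : ℝ≥0∞) • ν) ≤
      2⁻¹ * (interactionEnergy s μ + interactionEnergy s ν) := by
  rw [interactionEnergy_combination]
  set A := interactionEnergy s μ
  set B := interactionEnergy s ν
  have h22 : (2⁻¹ : ℝ≥0∞) * 2⁻¹ + 2⁻¹ * 2⁻¹ = 2⁻¹ := by
    rw [← mul_add, ENNReal.inv_two_add_inv_two, mul_one]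
  calc (2⁻¹ : ℝ≥0∞) * 2⁻¹ * A + 2 * (2⁻¹ * 2⁻¹) * mutualEnergy s μ ν + 2⁻¹ * 2⁻¹ * B
      = 2⁻¹ * 2⁻¹ * (A + B) + 2⁻¹ * 2⁻¹ * (2 * mutualEnergy s μ ν) := by ring
    _ ≤ 2⁻¹ * 2⁻¹ * (A + B) + 2⁻¹ * 2⁻¹ * (A + B) := by
        gcongr; exact two_mul_mutualEnergy_le hs μ ν
    _ = _ := by rw [← add_mul, h22]

open InformationTheory in
/-- A quantitative form of the strict convexity of `klFun`. -/
lemma klFun_midpoint_add_le {a b : ℝ} (ha : 0 ≤ a) (hb : 0 ≤ b) :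
    klFun ((a + b) / 2) + (√a - √b) ^ 2 / 4 ≤ (klFun a + klFun b) / 2 := by
  -- This is `log u ≤ u - 1` at `u = √m / √a`. Averaging it over `a` and `b`, with `m` their
  -- midpoint, bounds the entropy gap below by `2m - √m (√a + √b)`.
  have aux : ∀ {a m : ℝ}, 0 ≤ a → 0 < m → 2 * a - 2 * √a * √m + a * Real.log m ≤ a * Real.log a := by
    intro a m ha hm
    rcases ha.eq_or_lt with rfl | ha
    · simp
    have hsa : 0 < √a := Real.sqrt_pos.2 ha
    have hsm : 0 < √m := Real.sqrt_pos.2 hm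
    have h1 : Real.log (√m / √a) ≤ √m / √a - 1 := Real.log_le_sub_one_of_pos (by positivity)
    rw [Real.log_div hsm.ne' hsa.ne', Real.log_sqrt hm.le, Real.log_sqrt ha.le] at h1
    have h2 : a * (√m / √a) = √a * √m := by
      have : a = √a * √a := (Real.mul_self_sqrt ha.le).symm
      nth_rewrite 1 [this]
      field_simp
    nlinarith
  set m := (a + b) / 2 with hm
  rcases (by positivity : 0 ≤ m).eq_or_lt with h0 | hmpos
  · have ha0 : a = 0 := by linarith
    have hb0 : b = 0 := by linarith
    rw [← h0]
    simp [ha0, hb0]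
  have h1 := aux ha hmpos
  have h2 := aux hb hmpos
  have sa := Real.sq_sqrt ha
  have sb := Real.sq_sqrt hb
  have sm := Real.sq_sqrt hmpos.le
  have hsm : 0 < √m := Real.sqrt_pos.2 hmpos
  have hsa := Real.sqrt_nonneg a
  have hsb := Real.sqrt_nonneg b
  have hle : √a + √b ≤ 2 * √m := by
    nlinarith [sq_nonneg (√a - √b), sq_nonneg (√a + √b - 2 * √m)]
  -- The square factors as `(2√m - S)(2√m + S)` with `S = √a + √b`, and `S ≤ 2√m`.
  have h3 : (√a - √b) ^ 2 / 4 ≤ 2 * m - √m * (√a + √b) := by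
    have e1 : (√a - √b) ^ 2 = (2 * √m - (√a + √b)) * (2 * √m + (√a + √b)) := by nlinarith
    rw [e1]
    nlinarith [mul_nonneg (sub_nonneg.2 hle) (sub_nonneg.2 hle)]
  simp only [klFun_apply]
  have e : a + b = 2 * m := by rw [hm]; ring
  have h4 : (a + b) * Real.log m = 2 * m * Real.log m := by rw [e]
  nlinarith

section Density

variable (s γ : ℝ) (π : Measure (Space n))

/-- The free energy of the measure with density `p` with respect to `π`. -/
noncomputable def densityEnergy (p : Space n → ℝ≥0) : ℝ≥0∞ :=
  ENNReal.ofReal (γ / 2) * interactionEnergy s (π.withDensity fun x => (p x : ℝ≥0∞)) +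
    ∫⁻ x, ENNReal.ofReal (InformationTheory.klFun (p x)) ∂π

/-- `p` is a probability density with respect to `π`. -/
structure IsDensity (p : Space n → ℝ≥0) : Prop where
  measurable : Measurable p
  lintegral_eq_one : ∫⁻ x, (p x : ℝ≥0∞) ∂π = 1

variable {s γ π}

lemma IsDensity.isProbabilityMeasure {p : Space n → ℝ≥0} (hp : IsDensity π p) :
    IsProbabilityMeasure (π.withDensity fun x => (p x : ℝ≥0∞)) :=
  ⟨by rw [withDensity_apply _ MeasurableSet.univ, Measure.restrict_univ, hp.lintegral_eq_one]⟩

lemma klDiv_withDensity [IsFiniteMeasure π] {p : Space n → ℝ≥0} (hp : IsDensity π p) :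
    InformationTheory.klDiv (π.withDensity fun x => (p x : ℝ≥0∞)) π =
      ∫⁻ x, ENNReal.ofReal (InformationTheory.klFun (p x)) ∂π := by
  have := hp.isProbabilityMeasure
  rw [InformationTheory.klDiv_eq_lintegral_klFun_of_ac (withDensity_absolutelyContinuous _ _)]
  refine lintegral_congr_ae ?_
  filter_upwards [Measure.rnDeriv_withDensity π hp.measurable.coe_nnreal_ennreal] with x hx
  rw [hx, ENNReal.coe_toReal]

lemma exists_density_of_ac [IsFiniteMeasure π] (μ : Measure (Space n)) [IsProbabilityMeasure μ]
    (h : μ ≪ π) : ∃ p, IsDensity π p ∧ μ = π.withDensity fun x => (p x : ℝ≥0∞) := by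
  have := Measure.haveLebesgueDecomposition_of_sigmaFinite μ π
  have e : μ = π.withDensity fun x => ((μ.rnDeriv π x).toNNReal : ℝ≥0∞) := by
    refine (Measure.withDensity_rnDeriv_eq μ π h).symm.trans (withDensity_congr_ae ?_)
    filter_upwards [Measure.rnDeriv_lt_top μ π] with x hx
    rw [ENNReal.coe_toNNReal hx.ne]
  refine ⟨fun x => (μ.rnDeriv π x).toNNReal, ⟨(Measure.measurable_rnDeriv μ π).ennreal_toNNReal, ?_⟩, e⟩
  have h1 : μ Set.univ = 1 := measure_univ
  rw [e, withDensity_apply _ MeasurableSet.univ, Measure.restrict_univ] at h1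
  exact h1

/-- The average of two densities. -/
lemma IsDensity.combination {p q : Space n → ℝ≥0} (hp : IsDensity π p)
    (hq : IsDensity π q) {a b : ℝ≥0} (hab : a + b = 1) : IsDensity π fun x => a * p x + b * q x := by
  have h1 := hp.measurable
  have h2 := hq.measurable
  refine ⟨by fun_prop, ?_⟩
  push_cast
  rw [lintegral_add_left (by fun_prop), lintegral_const_mul _ (by fun_prop),
    lintegral_const_mul _ (by fun_prop), hp.lintegral_eq_one, hq.lintegral_eq_one]
  simp only [mul_one]
  exact_mod_cast hab

lemma withDensity_combination {p q : Space n → ℝ≥0} (hp : IsDensity π p)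
    (hq : IsDensity π q) (a b : ℝ≥0) :
    (π.withDensity fun x => ((a * p x + b * q x : ℝ≥0) : ℝ≥0∞)) =
      (a : ℝ≥0∞) • (π.withDensity fun x => (p x : ℝ≥0∞)) +
        (b : ℝ≥0∞) • (π.withDensity fun x => (q x : ℝ≥0∞)) := by
  have h1 := hp.measurable
  have h2 := hq.measurable
  rw [← withDensity_smul _ (by fun_prop), ← withDensity_smul _ (by fun_prop),
    ← withDensity_add_left (by fun_prop)]
  rfl

/-- Positive definiteness makes the interaction midpoint convex, and the entropy supplies the
squared Hellinger gap. The inequality serves both for compactness of minimizing sequences and for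
uniqueness. -/
lemma densityEnergy_midpoint_add_le [IsFiniteMeasure π] (hs : 0 < s) {p q : Space n → ℝ≥0}
    (hp : IsDensity π p) (hq : IsDensity π q) :
    densityEnergy s γ π (fun x => 2⁻¹ * p x + 2⁻¹ * q x) +
        ∫⁻ x, ENNReal.ofReal ((√(p x) - √(q x)) ^ 2 / 4) ∂π ≤
      2⁻¹ * (densityEnergy s γ π p + densityEnergy s γ π q) := by
  have h1 := hp.measurable
  have h2 := hq.measurable
  have := hp.isProbabilityMeasure
  have := hq.isProbabilityMeasure
  have hkl := InformationTheory.measurable_klFun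
  have hE := interactionEnergy_midpoint_le hs (π.withDensity fun x => (p x : ℝ≥0∞))
    (π.withDensity fun x => (q x : ℝ≥0∞))
  have hK : ∫⁻ x, ENNReal.ofReal (InformationTheory.klFun ((2⁻¹ * p x + 2⁻¹ * q x : ℝ≥0))) ∂π +
      ∫⁻ x, ENNReal.ofReal ((√(p x) - √(q x)) ^ 2 / 4) ∂π ≤
      2⁻¹ * (∫⁻ x, ENNReal.ofReal (InformationTheory.klFun (p x)) ∂π +
        ∫⁻ x, ENNReal.ofReal (InformationTheory.klFun (q x)) ∂π) := by
    rw [← lintegral_add_left (by fun_prop), ← lintegral_add_left (by fun_prop),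
      ← lintegral_const_mul _ (by fun_prop)]
    refine lintegral_mono fun x => ?_
    have k := klFun_midpoint_add_le (p x).coe_nonneg (q x).coe_nonneg
    have k1 := InformationTheory.klFun_nonneg (p x).coe_nonneg
    have k2 := InformationTheory.klFun_nonneg (q x).coe_nonneg
    have e2 : (2⁻¹ : ℝ≥0∞) = ENNReal.ofReal (2⁻¹) := by
      rw [ENNReal.ofReal_inv_of_pos (by norm_num)]; simp
    have e3 : ((2⁻¹ * p x + 2⁻¹ * q x : ℝ≥0) : ℝ) = ((p x : ℝ) + q x) / 2 := by
      push_cast; ring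
    rw [e2, e3, ← ENNReal.ofReal_add k1 k2, ← ENNReal.ofReal_mul (by norm_num),
      ← ENNReal.ofReal_add (InformationTheory.klFun_nonneg (by positivity)) (by positivity)]
    refine ENNReal.ofReal_le_ofReal (k.trans (le_of_eq ?_))
    ring
  have e4 : ((2⁻¹ : ℝ≥0) : ℝ≥0∞) = 2⁻¹ := by
    rw [ENNReal.coe_inv (by norm_num)]; simp
  rw [← e4, ← withDensity_combination hp hq, e4] at hE
  simp only [densityEnergy]
  calc _ ≤ ENNReal.ofReal (γ / 2) * (2⁻¹ * (interactionEnergy s (π.withDensity fun x => (p x : ℝ≥0∞)) +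
        interactionEnergy s (π.withDensity fun x => (q x : ℝ≥0∞)))) +
        2⁻¹ * (∫⁻ x, ENNReal.ofReal (InformationTheory.klFun (p x)) ∂π +
        ∫⁻ x, ENNReal.ofReal (InformationTheory.klFun (q x)) ∂π) := by
        rw [add_assoc]
        gcongr
    _ = _ := by ring

lemma ae_eq_of_lintegral_sqrt_sub_eq_zero {p q : Space n → ℝ≥0} (hp : Measurable p)
    (hq : Measurable q) (h : ∫⁻ x, ENNReal.ofReal ((√(p x) - √(q x)) ^ 2 / 4) ∂π = 0) :
    p =ᵐ[π] q := by
  rw [lintegral_eq_zero_iff (by fun_prop)] at h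
  filter_upwards [h] with x hx
  simp only [Pi.zero_apply, ENNReal.ofReal_eq_zero] at hx
  have h0 : √(p x) - √(q x) = 0 := by
    have : (√(p x) - √(q x)) ^ 2 = 0 := le_antisymm (by linarith) (sq_nonneg _)
    simpa using this
  have h1 : √(p x : ℝ) = √(q x) := by linarith
  rw [Real.sqrt_inj (p x).coe_nonneg (q x).coe_nonneg] at h1
  exact_mod_cast h1

end Density

end RieszGas

namespace RieszGas

variable {n : ℕ}

/-! ### Existence of a minimizing density -/

section Existence

variable {s γ : ℝ} {π : Measure (Space n)}

/-- Because `π` has mass one, the entropy can also be integrated over the product. The energy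
becomes one integral of a nonnegative function, to which Fatou's lemma applies. -/
lemma densityEnergy_eq_lintegral_prod [IsProbabilityMeasure π] {p : Space n → ℝ≥0} (hp : Measurable p) :
    densityEnergy s γ π p = ∫⁻ w, (ENNReal.ofReal (γ / 2) *
      (rieszKernel s w.1 w.2 * (p w.1 * p w.2)) +
        ENNReal.ofReal (InformationTheory.klFun (p w.1))) ∂(π.prod π) := by
  have hkl := InformationTheory.measurable_klFun
  rw [lintegral_add_right _ (by fun_prop), lintegral_const_mul _ (by fun_prop)]
  rw [lintegral_prod _ (by fun_prop), lintegral_prod _ (by fun_prop)]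
  simp only [lintegral_const, measure_univ, mul_one]
  rw [densityEnergy, interactionEnergy, lintegral_withDensity_eq_lintegral_mul _ (by fun_prop)
    (measurable_lintegral_rieszKernel s _)]
  congr 2
  refine lintegral_congr fun x => ?_
  simp only [Pi.mul_apply]
  rw [lintegral_withDensity_eq_lintegral_mul _ (by fun_prop) (by fun_prop),
    ← lintegral_const_mul _ (by fun_prop)]
  refine lintegral_congr fun z => ?_
  simp only [Pi.mul_apply]
  ring

lemma memLp_sqrt {p : Space n → ℝ≥0} (hp : IsDensity π p) :
    MemLp (fun x => √(p x : ℝ)) 2 π ∧ eLpNorm (fun x => √(p x : ℝ)) 2 π = 1 := by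
  have hm := hp.measurable
  have e : eLpNorm (fun x => √(p x : ℝ)) 2 π = 1 := by
    rw [eLpNorm_eq_lintegral_rpow_enorm_toReal (by norm_num) (by norm_num)]
    have : ∀ x, ‖√(p x : ℝ)‖ₑ ^ (2 : ℝ≥0∞).toReal = p x := by
      intro x
      rw [← ofReal_norm, Real.norm_of_nonneg (Real.sqrt_nonneg _)]
      simp only [ENNReal.toReal_ofNat, ENNReal.rpow_ofNat]
      rw [← ENNReal.ofReal_pow (Real.sqrt_nonneg _), Real.sq_sqrt (p x).coe_nonneg,
        ENNReal.ofReal_coe_nnreal]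
    simp_rw [this, hp.lintegral_eq_one, ENNReal.one_rpow]
  refine ⟨⟨Measurable.aestronglyMeasurable (by fun_prop), ?_⟩, e⟩
  rw [e]; exact ENNReal.one_lt_top

/-- The free energy attains its minimum among densities. -/
lemma exists_densityEnergy_le [IsProbabilityMeasure π] (hs : 0 < s) {q₀ : Space n → ℝ≥0} (hq₀ : IsDensity π q₀)
    (hfin : densityEnergy s γ π q₀ ≠ ⊤) :
    ∃ p, IsDensity π p ∧ ∀ q, IsDensity π q → densityEnergy s γ π p ≤ densityEnergy s γ π q := by
  have hkl := InformationTheory.measurable_klFun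
  set I : ℝ≥0∞ := ⨅ (q) (_ : IsDensity π q), densityEnergy s γ π q with hI
  have hIle : ∀ q, IsDensity π q → I ≤ densityEnergy s γ π q := fun q hq => iInf₂_le q hq
  have hItop : I ≠ ⊤ := ((hIle q₀ hq₀).trans_lt hfin.lt_top).ne
  have hex : ∀ k : ℕ, ∃ p, IsDensity π p ∧
      densityEnergy s γ π p ≤ I + ENNReal.ofReal (1 / ((k : ℝ) + 1)) := by
    intro k
    have : I < I + ENNReal.ofReal (1 / ((k : ℝ) + 1)) :=
      ENNReal.lt_add_right hItop (ENNReal.ofReal_pos.2 Nat.one_div_pos_of_nat).ne'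
    simp only [hI, iInf_lt_iff] at this
    obtain ⟨p, hp, hlt⟩ := this
    exact ⟨p, hp, hlt.le⟩
  choose p hp hpI using hex
  -- The square roots of densities are unit vectors of `L²`. For near-minimizers the midpoint energy
  -- is still at least `I`, so the Hellinger gap is at most `1/(N+1)` and the sequence is Cauchy.
  set f : ℕ → Lp ℝ 2 π := fun k => (memLp_sqrt (hp k)).1.toLp with hf
  have hdist : ∀ N k l : ℕ, N ≤ k → N ≤ l →
      edist (f k) (f l) ≤ (ENNReal.ofReal (4 * (1 / ((N : ℝ) + 1)))) ^ (1 / 2 : ℝ) := by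
    intro N k l hk hl
    have hk' : densityEnergy s γ π (p k) ≤ I + ENNReal.ofReal (1 / ((N : ℝ) + 1)) :=
      (hpI k).trans (by gcongr)
    have hl' : densityEnergy s γ π (p l) ≤ I + ENNReal.ofReal (1 / ((N : ℝ) + 1)) :=
      (hpI l).trans (by gcongr)
    have hmid := densityEnergy_midpoint_add_le (γ := γ) hs (hp k) (hp l)
    have hmid2 := hIle _ ((hp k).combination (hp l) (a := 2⁻¹) (b := 2⁻¹)
      (by rw [← NNReal.coe_inj]; norm_num))
    have h1 : I + ∫⁻ x, ENNReal.ofReal ((√(p k x) - √(p l x)) ^ 2 / 4) ∂π ≤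
        I + ENNReal.ofReal (1 / ((N : ℝ) + 1)) := by
      calc _ ≤ _ := add_le_add hmid2 le_rfl
        _ ≤ _ := hmid
        _ ≤ 2⁻¹ * ((I + ENNReal.ofReal (1 / ((N : ℝ) + 1))) +
            (I + ENNReal.ofReal (1 / ((N : ℝ) + 1)))) := by gcongr
        _ = _ := by rw [← two_mul, ← mul_assoc, ENNReal.inv_mul_cancel (by norm_num) (by norm_num),
            one_mul]
    have h2 := ENNReal.le_of_add_le_add_left hItop h1
    rw [hf, Lp.edist_toLp_toLp, eLpNorm_eq_lintegral_rpow_enorm_toReal (by norm_num) (by norm_num)]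
    simp only [ENNReal.toReal_ofNat, ENNReal.rpow_ofNat]
    gcongr
    calc ∫⁻ x, ‖((fun x => √(p k x : ℝ)) - fun x => √(p l x : ℝ)) x‖ₑ ^ 2 ∂π
        = ∫⁻ x, ENNReal.ofReal 4 * ENNReal.ofReal ((√(p k x) - √(p l x)) ^ 2 / 4) ∂π := by
          refine lintegral_congr fun x => ?_
          rw [← ENNReal.ofReal_mul (by norm_num), ← ofReal_norm, ← ENNReal.ofReal_pow (norm_nonneg _)]
          simp only [Pi.sub_apply, Real.norm_eq_abs, sq_abs]
          congr 1; ring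
      _ ≤ _ := by
          rw [lintegral_const_mul' _ _ ENNReal.ofReal_ne_top, ENNReal.ofReal_mul (by norm_num)]
          gcongr
  have hlim : Tendsto (fun N : ℕ => (ENNReal.ofReal (4 * (1 / ((N : ℝ) + 1)))) ^ (1 / 2 : ℝ)) atTop
      (𝓝 0) := by
    have h1 : Tendsto (fun N : ℕ => ENNReal.ofReal (4 * (1 / ((N : ℝ) + 1)))) atTop (𝓝 0) := by
      have := ENNReal.tendsto_ofReal ((tendsto_one_div_add_atTop_nhds_zero_nat (𝕜 := ℝ)).const_mul 4)
      simpa using this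
    have h2 := (ENNReal.continuous_rpow_const (y := (1 / 2 : ℝ))).tendsto 0 |>.comp h1
    rwa [ENNReal.zero_rpow_of_pos (by norm_num)] at h2
  have hcauchy : CauchySeq f := by
    rw [EMetric.cauchySeq_iff]
    intro δ hδ
    obtain ⟨N, hN⟩ := (hlim.eventually (gt_mem_nhds hδ)).exists
    exact ⟨N, fun k hk l hl => (hdist N k l hk hl).trans_lt hN⟩
  obtain ⟨g, hg⟩ := cauchySeq_tendsto_of_complete hcauchy
  -- the limit has norm one
  have hnorm : ‖g‖ = 1 := by
    refine tendsto_nhds_unique hg.norm ?_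
    have : ∀ k, ‖f k‖ = 1 := fun k => by
      rw [hf, Lp.norm_toLp, (memLp_sqrt (hp k)).2]; simp
    simp [this]
  obtain ⟨u, hu, hae⟩ := (tendstoInMeasure_of_tendsto_Lp hg).exists_seq_tendsto_ae
  have hae' : ∀ᵐ x ∂π, Tendsto (fun i => p (u i) x) atTop (𝓝 (Real.toNNReal ((g x) ^ 2))) := by
    have hco : ∀ᵐ x ∂π, ∀ k, f k x = √(p k x : ℝ) :=
      ae_all_iff.2 fun k => (memLp_sqrt (hp k)).1.coeFn_toLp
    filter_upwards [hae, hco] with x hx hc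
    have h1 : Tendsto (fun i => (f (u i) x) ^ 2) atTop (𝓝 ((g x) ^ 2)) := hx.pow 2
    have h2 := (continuous_real_toNNReal.tendsto _).comp h1
    refine h2.congr fun i => ?_
    simp only [Function.comp, hc]
    rw [Real.sq_sqrt (p (u i) x).coe_nonneg, Real.toNNReal_coe]
  -- Strong `L²` convergence loses no mass, so the square of the limit is again a probability
  -- density. A subsequence of the densities converges to it almost everywhere.
  set P : Space n → ℝ≥0 := fun x => Real.toNNReal ((g x) ^ 2) with hP
  have hgm : Measurable fun x => g x := (Lp.stronglyMeasurable g).measurable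
  have hPm : Measurable P := by fun_prop
  have hPd : IsDensity π P := by
    refine ⟨hPm, ?_⟩
    have e : eLpNorm g 2 π = 1 := by
      rw [Lp.norm_def] at hnorm
      rw [← ENNReal.ofReal_toReal (Lp.eLpNorm_ne_top g), hnorm, ENNReal.ofReal_one]
    rw [eLpNorm_eq_lintegral_rpow_enorm_toReal (by norm_num) (by norm_num)] at e
    simp only [ENNReal.toReal_ofNat, ENNReal.rpow_ofNat] at e
    have e2 : ∫⁻ x, ‖g x‖ₑ ^ 2 ∂π = 1 := by
      have := congrArg (fun t : ℝ≥0∞ => t ^ (2 : ℝ)) e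
      simpa only [← ENNReal.rpow_mul, ENNReal.one_rpow, one_div_mul_cancel (two_ne_zero' ℝ),
        ENNReal.rpow_one] using this
    rw [← e2]
    refine lintegral_congr fun x => ?_
    rw [← ofReal_norm, ← ENNReal.ofReal_pow (norm_nonneg _), hP, Real.norm_eq_abs, sq_abs]
    rfl
  refine ⟨P, hPd, fun q hq => le_trans ?_ (hIle q hq)⟩
  -- lower semicontinuity, by Fatou's lemma
  have hpm : ∀ k, Measurable (p k) := fun k => (hp k).measurable
  rw [densityEnergy_eq_lintegral_prod hPm]
  have hae1 : ∀ᵐ w ∂(π.prod π), Tendsto (fun i => p (u i) w.1) atTop (𝓝 (P w.1)) :=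
    Measure.quasiMeasurePreserving_fst.ae hae'
  have hae2 : ∀ᵐ w ∂(π.prod π), Tendsto (fun i => p (u i) w.2) atTop (𝓝 (P w.2)) :=
    Measure.quasiMeasurePreserving_snd.ae hae'
  calc _ ≤ ∫⁻ w, liminf (fun i => ENNReal.ofReal (γ / 2) *
      (rieszKernel s w.1 w.2 * (p (u i) w.1 * p (u i) w.2)) +
        ENNReal.ofReal (InformationTheory.klFun (p (u i) w.1))) atTop ∂(π.prod π) := by
        refine lintegral_mono_ae ?_
        filter_upwards [hae1, hae2] with w h1 h2
        have hk : Tendsto (fun i => ENNReal.ofReal (InformationTheory.klFun (p (u i) w.1))) atTop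
            (𝓝 (ENNReal.ofReal (InformationTheory.klFun (P w.1)))) :=
          ENNReal.tendsto_ofReal ((InformationTheory.continuous_klFun.tendsto _).comp
            (NNReal.tendsto_coe.2 h1))
        -- Multiplication by a possibly infinite kernel is continuous only away from `∞ · 0`. Where
        -- the limiting product vanishes, the interaction term is simply dropped.
        by_cases h0 : (P w.1 * P w.2 : ℝ≥0∞) = 0
        · rw [h0, mul_zero, mul_zero, zero_add, ← hk.liminf_eq]
          exact liminf_le_liminf (Eventually.of_forall fun i => le_add_self)
        · refine (Tendsto.liminf_eq ?_).ge
          refine Tendsto.add (ENNReal.Tendsto.const_mul (ENNReal.Tendsto.const_mul ?_ (Or.inl h0))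
            (Or.inr ENNReal.ofReal_ne_top)) hk
          have := ENNReal.tendsto_coe.2 (h1.mul h2)
          simpa using this
    _ ≤ liminf (fun i => ∫⁻ w, (ENNReal.ofReal (γ / 2) *
      (rieszKernel s w.1 w.2 * (p (u i) w.1 * p (u i) w.2)) +
        ENNReal.ofReal (InformationTheory.klFun (p (u i) w.1))) ∂(π.prod π)) atTop :=
        lintegral_liminf_le fun i => by have := hpm (u i); fun_prop
    _ ≤ liminf (fun i => I + ENNReal.ofReal (1 / ((u i : ℝ) + 1))) atTop := by
        refine liminf_le_liminf (Eventually.of_forall fun i => ?_)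
        rw [← densityEnergy_eq_lintegral_prod (hpm _)]
        exact hpI _
    _ = I := by
        refine Tendsto.liminf_eq ?_
        have h1 := (tendsto_one_div_add_atTop_nhds_zero_nat (𝕜 := ℝ)).comp hu.tendsto_atTop
        have := (tendsto_const_nhds (x := I)).add (ENNReal.tendsto_ofReal h1)
        simpa using this

end Existence

end RieszGas

namespace RieszGas

variable {n : ℕ}

/-! ### The Euler-Lagrange equation -/

section EulerLagrange

variable {s γ : ℝ} {C : ℝ≥0∞} {π : Measure (Space n)}

lemma withDensity_le_smul {ρ : Measure (Space n)} {p : Space n → ℝ≥0∞} {c : ℝ≥0∞}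
    (h : ∀ x, p x ≤ c) : ρ.withDensity p ≤ c • ρ := by
  rw [← withDensity_const]
  exact withDensity_mono (ae_of_all _ h)

lemma smul_measure_le_smul_volume {π : Measure (Space n)} (hπ : π ≤ C • volume) (c : ℝ≥0∞) :
    c • π ≤ (c * C) • volume := by
  rw [mul_smul]
  refine Measure.le_iff'.2 fun A => ?_
  simp only [Measure.smul_apply, smul_eq_mul]
  have := hπ A
  simp only [Measure.smul_apply, smul_eq_mul] at this
  gcongr

lemma interactionEnergy_ne_top {μ : Measure (Space n)} [IsProbabilityMeasure μ] (hs : 0 < s)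
    (hsn : s < n) (hC : C ≠ ⊤) (hμ : μ ≤ C • volume) : interactionEnergy s μ ≠ ⊤ := by
  refine ((lintegral_mono fun x => lintegral_rieszKernel_le hs hμ x).trans_lt ?_).ne
  simp only [lintegral_const, measure_univ, mul_one]
  exact ENNReal.add_lt_top.2 ⟨ENNReal.mul_lt_top hC.lt_top (lintegral_ball_rpow_lt_top hs hsn),
    ENNReal.one_lt_top⟩

/-- Here `μ` need not have a bounded density. By symmetry of the kernel the mutual energy is the
integral against `μ` of the potential of `π`, which is bounded. -/
lemma ae_lintegral_rieszKernel_lt_top {μ : Measure (Space n)} [IsProbabilityMeasure μ]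
    [IsProbabilityMeasure π] (hs : 0 < s) (hsn : s < n) (hC : C ≠ ⊤) (hπ : π ≤ C • volume) :
    ∀ᵐ x ∂π, ∫⁻ z, rieszKernel s x z ∂μ < ⊤ := by
  refine ae_lt_top (measurable_lintegral_rieszKernel s μ) ?_
  change mutualEnergy s π μ ≠ ⊤
  rw [mutualEnergy_comm]
  refine ((lintegral_mono fun x => lintegral_rieszKernel_le hs hπ x).trans_lt ?_).ne
  simp only [lintegral_const, measure_univ, mul_one]
  exact ENNReal.add_lt_top.2 ⟨ENNReal.mul_lt_top hC.lt_top (lintegral_ball_rpow_lt_top hs hsn),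
    ENNReal.one_lt_top⟩

lemma measurable_potential (s : ℝ) (μ : Measure (Space n)) [SFinite μ] :
    Measurable (potential s μ) :=
  (measurable_lintegral_rieszKernel s μ).ennreal_toReal

lemma lintegral_potential_mul {μ : Measure (Space n)} [IsProbabilityMeasure μ]
    [IsProbabilityMeasure π] (hs : 0 < s) (hsn : s < n) (hC : C ≠ ⊤) (hπ : π ≤ C • volume)
    {q : Space n → ℝ≥0} (hq : Measurable q) :
    ∫⁻ x, ENNReal.ofReal (potential s μ x * q x) ∂π =
      mutualEnergy s (π.withDensity fun x => (q x : ℝ≥0∞)) μ := by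
  rw [mutualEnergy, lintegral_withDensity_eq_lintegral_mul _ (by fun_prop)
    (measurable_lintegral_rieszKernel s μ)]
  refine lintegral_congr_ae ?_
  filter_upwards [ae_lintegral_rieszKernel_lt_top (μ := μ) hs hsn hC hπ] with x hx
  rw [ENNReal.ofReal_mul (potential_nonneg s μ x), potential, ENNReal.ofReal_toReal hx.ne,
    ENNReal.ofReal_coe_nnreal, Pi.mul_apply, mul_comm]

open InformationTheory in
-- This changes the reference measure from `π` to `σ π` in the entropy density; it identifies the
-- function `G` below as a nonnegative relative entropy.
lemma mul_klFun_div {p σ : ℝ} (hp : 0 ≤ p) (hσ : 0 < σ) :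
    σ * klFun (p / σ) = klFun p - Real.log σ * p + σ - 1 := by
  simp only [klFun_apply]
  rcases hp.eq_or_lt with rfl | hp
  · simp
  · rw [Real.log_div hp.ne' hσ.ne']
    field_simp
    ring

open InformationTheory in
/-- The Euler-Lagrange equation for a minimizing density. -/
lemma density_ae_eq_of_minimizer [IsProbabilityMeasure π] (hs : 0 < s) (hsn : s < n)
    (hγ : 0 < γ) (hC : C ≠ ⊤) (hπ : π ≤ C • volume) {p : Space n → ℝ≥0} (hp : IsDensity π p)
    (hfin : densityEnergy s γ π p ≠ ⊤)
    (hmin : ∀ q, IsDensity π q → densityEnergy s γ π p ≤ densityEnergy s γ π q) :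
    ∃ Z : ℝ, 0 < Z ∧ p =ᵐ[π] fun x => Real.toNNReal
      (Real.exp (-(γ * potential s (π.withDensity fun x => (p x : ℝ≥0∞)) x)) / Z) := by
  have hpm := hp.measurable
  have hkl := measurable_klFun
  set μ := π.withDensity fun x => (p x : ℝ≥0∞) with hμ
  have hμP : IsProbabilityMeasure μ := hp.isProbabilityMeasure
  set w := potential s μ with hw
  have hwm : Measurable w := measurable_potential s μ
  have hw0 : ∀ x, 0 ≤ w x := potential_nonneg s μ
  have hEI : Integrable (fun x => Real.exp (-(γ * w x))) π := by
    refine Integrable.of_bound (C := 1) (Measurable.aestronglyMeasurable (by fun_prop))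
      (ae_of_all _ fun x => ?_)
    rw [Real.norm_of_nonneg (Real.exp_pos _).le, Real.exp_le_one_iff]
    have := hw0 x
    nlinarith
  set Z := ∫ x, Real.exp (-(γ * w x)) ∂π with hZdef
  have hZ : 0 < Z := integral_exp_pos hEI
  -- The candidate is the image of `p` under the mean-field map. The aim is that the entropy of `p`
  -- relative to `σ`, namely `∫ G`, vanishes.
  set σ : Space n → ℝ := fun x => Real.exp (-(γ * w x)) / Z with hσ
  have hσ0 : ∀ x, 0 < σ x := fun x => by positivity
  have hσm : Measurable σ := by fun_prop
  have hσI : Integrable σ π := hEI.div_const Z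
  have hσint : ∫ x, σ x ∂π = 1 := by
    rw [hσ, integral_div, ← hZdef, div_self hZ.ne']
  set q : Space n → ℝ≥0 := fun x => Real.toNNReal (σ x) with hq
  have hqc : ∀ x, (q x : ℝ) = σ x := fun x => Real.coe_toNNReal _ (hσ0 x).le
  have hqm : Measurable q := by fun_prop
  have hqd : IsDensity π q := by
    refine ⟨hqm, ?_⟩
    change ∫⁻ x, ENNReal.ofReal (σ x) ∂π = 1
    rw [← ofReal_integral_eq_lintegral_ofReal hσI (ae_of_all _ fun x => (hσ0 x).le), hσint,
      ENNReal.ofReal_one]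
  refine ⟨Z, hZ, ?_⟩
  set ν := π.withDensity fun x => (q x : ℝ≥0∞) with hν
  have hνP : IsProbabilityMeasure ν := hqd.isProbabilityMeasure
  have hνle : ν ≤ (ENNReal.ofReal (1 / Z) * C) • volume := by
    refine le_trans (withDensity_le_smul fun x => ?_)
      (smul_measure_le_smul_volume hπ (ENNReal.ofReal (1 / Z)))
    change ENNReal.ofReal (σ x) ≤ _
    refine ENNReal.ofReal_le_ofReal (div_le_div_of_nonneg_right ?_ hZ.le)
    rw [Real.exp_le_one_iff]
    have := hw0 x
    nlinarith
  have hEν : interactionEnergy s ν ≠ ⊤ :=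
    interactionEnergy_ne_top hs hsn (ENNReal.mul_ne_top ENNReal.ofReal_ne_top hC) hνle
  -- Only for `γ > 0` does finite free energy force finite interaction energy.
  have hEμ : interactionEnergy s μ ≠ ⊤ := by
    intro h
    apply hfin
    rw [densityEnergy, ← hμ, h, ENNReal.mul_top (ENNReal.ofReal_pos.2 (by linarith)).ne', top_add]
  have hM : mutualEnergy s μ ν ≠ ⊤ := by
    have h := two_mul_mutualEnergy_le hs μ ν
    intro h'
    rw [h', ENNReal.mul_top (by norm_num)] at h
    exact (ENNReal.add_ne_top.2 ⟨hEμ, hEν⟩) (top_le_iff.1 h)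
  have hH : ∫⁻ x, ENNReal.ofReal (klFun (p x)) ∂π ≠ ⊤ := fun h => hfin (by
    rw [densityEnergy, h, add_top])
  have hk0 : ∀ x, 0 ≤ klFun (p x) := fun x => klFun_nonneg (p x).coe_nonneg
  have hHI : Integrable (fun x => klFun (p x)) π :=
    (lintegral_ofReal_ne_top_iff_integrable (Measurable.aestronglyMeasurable (by fun_prop))
      (ae_of_all _ hk0)).1 hH
  have hpI : Integrable (fun x => (p x : ℝ)) π := by
    refine (lintegral_ofReal_ne_top_iff_integrable (Measurable.aestronglyMeasurable (by fun_prop))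
      (ae_of_all _ fun x => (p x).coe_nonneg)).1 ?_
    simp only [ENNReal.ofReal_coe_nnreal, hp.lintegral_eq_one]
    exact ENNReal.one_ne_top
  have hpint : ∫ x, (p x : ℝ) ∂π = 1 := by
    rw [integral_eq_lintegral_of_nonneg_ae (ae_of_all _ fun x => (p x).coe_nonneg)
      (Measurable.aestronglyMeasurable (by fun_prop))]
    simp [ENNReal.ofReal_coe_nnreal, hp.lintegral_eq_one]
  have hwint : ∀ q : Space n → ℝ≥0, Measurable q →
      mutualEnergy s (π.withDensity fun x => (q x : ℝ≥0∞)) μ ≠ ⊤ →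
      Integrable (fun x => w x * q x) π ∧
        ENNReal.ofReal (∫ x, w x * q x ∂π) =
          mutualEnergy s (π.withDensity fun x => (q x : ℝ≥0∞)) μ := by
    intro q hqm hfinq
    rw [← lintegral_potential_mul hs hsn hC hπ hqm] at hfinq ⊢
    have hi : Integrable (fun x => w x * q x) π :=
      (lintegral_ofReal_ne_top_iff_integrable (Measurable.aestronglyMeasurable (by fun_prop))
        (ae_of_all _ fun x => mul_nonneg (hw0 x) (q x).coe_nonneg)).1 hfinq
    exact ⟨hi, ofReal_integral_eq_lintegral_ofReal hi
      (ae_of_all _ fun x => mul_nonneg (hw0 x) (q x).coe_nonneg)⟩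
  obtain ⟨hwp, hA⟩ := hwint p hpm hEμ
  obtain ⟨hwq, hMM⟩ := hwint q hqm (by rw [mutualEnergy_comm]; exact hM)
  rw [mutualEnergy_comm] at hMM
  set A := ∫ x, w x * p x ∂π
  set M := ∫ x, w x * q x ∂π
  have hA0 : 0 ≤ A := integral_nonneg fun x => mul_nonneg (hw0 x) (p x).coe_nonneg
  have hM0 : 0 ≤ M := integral_nonneg fun x => mul_nonneg (hw0 x) (q x).coe_nonneg
  set D := (interactionEnergy s ν).toReal with hD
  have hDe : ENNReal.ofReal D = interactionEnergy s ν := ENNReal.ofReal_toReal hEν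
  have hD0 : 0 ≤ D := ENNReal.toReal_nonneg
  set H := ∫ x, klFun (p x) ∂π with hHdef
  have hHe : ENNReal.ofReal H = ∫⁻ x, ENNReal.ofReal (klFun (p x)) ∂π :=
    ofReal_integral_eq_lintegral_ofReal hHI (ae_of_all _ hk0)
  have hH0 : 0 ≤ H := integral_nonneg hk0
  have hlog : ∀ x, Real.log (σ x) = -(γ * w x) - Real.log Z := fun x => by
    rw [hσ, Real.log_div (Real.exp_pos _).ne' hZ.ne', Real.log_exp]
  -- the relative entropy with respect to the candidate
  set G : Space n → ℝ := fun x => klFun (p x) + (γ * (w x * p x) + Real.log Z * p x) + (σ x - 1)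
    with hG
  have hGe : ∀ x, G x = σ x * klFun (p x / σ x) := fun x => by
    rw [mul_klFun_div (p x).coe_nonneg (hσ0 x), hlog, hG]; ring
  have hG0 : ∀ x, 0 ≤ G x := fun x => by
    rw [hGe]
    exact mul_nonneg (hσ0 x).le (klFun_nonneg (div_nonneg (p x).coe_nonneg (hσ0 x).le))
  have hlin : Integrable (fun x => γ * (w x * p x) + Real.log Z * p x) π :=
    (hwp.const_mul γ).add (hpI.const_mul _)
  have hσ1 : Integrable (fun x => σ x - 1) π := hσI.sub (integrable_const _)
  have hGI : Integrable G π := (hHI.add hlin).add hσ1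
  have hK : ∫ x, G x ∂π = H + γ * A + Real.log Z := by
    have hHL : Integrable (fun x => klFun (p x) + (γ * (w x * p x) + Real.log Z * p x)) π :=
      hHI.add hlin
    simp only [hG]
    rw [integral_add hHL hσ1, integral_add hHI hlin,
      integral_add (hwp.const_mul γ) (hpI.const_mul _), integral_const_mul, integral_const_mul,
      integral_sub hσI (integrable_const _), hσint, hpint]
    simp
    ring
  have hmain : ∀ t : ℝ≥0, 0 < t → t ≤ 1 →
      (∫ x, G x ∂π) ≤ t * (γ / 2 * (A - 2 * M + D)) := by
    intro t ht ht1
    obtain ⟨a, hat⟩ : ∃ a : ℝ≥0, a + t = 1 := ⟨1 - t, tsub_add_cancel_of_le ht1⟩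
    have hatr : (a : ℝ) + t = 1 := by exact_mod_cast hat
    set r : Space n → ℝ≥0 := fun x => a * p x + t * q x with hr
    have hrd : IsDensity π r := hp.combination hqd hat
    -- This is `a klFun p + t klFun σ`, the convexity bound for `klFun r`, rewritten through `G` so
    -- that its integral is explicit.
    set R : Space n → ℝ := fun x => a * G x -
      (a * (γ * (w x * p x) + Real.log Z * p x) + t * (γ * (w x * q x) + Real.log Z * q x)) -
        (σ x - 1) with hR
    have hlinq : Integrable (fun x => γ * (w x * q x) + Real.log Z * q x) π := by
      refine (hwq.const_mul γ).add (Integrable.const_mul ?_ _)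
      simpa only [hqc] using hσI
    have hRI : Integrable R π :=
      ((hGI.const_mul _).sub ((hlin.const_mul _).add (hlinq.const_mul _))).sub hσ1
    have hqint : ∫ x, (q x : ℝ) ∂π = 1 := by simpa only [hqc] using hσint
    have hRint : ∫ x, R x ∂π = a * (∫ x, G x ∂π) - γ * (a * A + t * M) - Real.log Z := by
      have hb : Integrable (fun x => a * (γ * (w x * p x) + Real.log Z * p x) +
          t * (γ * (w x * q x) + Real.log Z * q x)) π := (hlin.const_mul _).add (hlinq.const_mul _)
      have hab : Integrable (fun x => a * G x - (a * (γ * (w x * p x) + Real.log Z * p x) +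
          t * (γ * (w x * q x) + Real.log Z * q x))) π := (hGI.const_mul _).sub hb
      simp only [hR]
      rw [integral_sub hab hσ1, integral_sub (hGI.const_mul _) hb,
        integral_add (hlin.const_mul _) (hlinq.const_mul _), integral_const_mul, integral_const_mul,
        integral_const_mul, integral_add (hwp.const_mul γ) (hpI.const_mul _),
        integral_add (hwq.const_mul γ) (by simpa only [hqc] using hσI.const_mul (Real.log Z)),
        integral_const_mul, integral_const_mul, integral_const_mul, integral_const_mul,
        integral_sub hσI (integrable_const _), hσint, hpint, hqint]
      simp
      linear_combination (-Real.log Z) * hatr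
    have hpt : ∀ x, klFun (r x) ≤ R x := by
      intro x
      have hc := convexOn_klFun.2 (x := (p x : ℝ)) (y := σ x) (p x).coe_nonneg (hσ0 x).le
        a.coe_nonneg t.coe_nonneg hatr
      simp only [smul_eq_mul] at hc
      have e : (r x : ℝ) = a * p x + t * σ x := by simp [hr, hqc]
      rw [e]
      refine hc.trans (le_of_eq ?_)
      have hks : klFun (σ x) = σ x * (-(γ * w x) - Real.log Z) + 1 - σ x := by
        rw [klFun_apply, hlog]
      simp only [hR, hG, hks, hqc]
      linear_combination (1 - σ x) * hatr
    have hRnn : 0 ≤ ∫ x, R x ∂π :=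
      integral_nonneg fun x => (klFun_nonneg (r x).coe_nonneg).trans (hpt x)
    have hle := hmin r hrd
    have e1 : densityEnergy s γ π p = ENNReal.ofReal (γ / 2 * A + H) := by
      rw [ENNReal.ofReal_add (by positivity) hH0, ENNReal.ofReal_mul (by positivity), hA, hHe]
      rfl
    have e2 : densityEnergy s γ π r ≤ ENNReal.ofReal
        (γ / 2 * (a * a * A + 2 * (a * t) * M + t * t * D) + ∫ x, R x ∂π) := by
      rw [ENNReal.ofReal_add (by positivity) hRnn, ENNReal.ofReal_mul (by positivity),
        densityEnergy, hr, withDensity_combination hp hqd, interactionEnergy_combination]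
      refine add_le_add (le_of_eq ?_) ?_
      · congr 1
        rw [ENNReal.ofReal_add (by positivity) (by positivity),
          ENNReal.ofReal_add (by positivity) (by positivity),
          ENNReal.ofReal_mul (q := A) (by positivity),
          ENNReal.ofReal_mul (q := M) (by positivity), ENNReal.ofReal_mul (q := D) (by positivity), hA, hMM, hDe]
        simp only [ENNReal.ofReal_mul, NNReal.coe_nonneg, ENNReal.ofReal_coe_nnreal,
          Nat.ofNat_nonneg, ENNReal.ofReal_ofNat]
        rfl
      · rw [ofReal_integral_eq_lintegral_ofReal hRI
          (ae_of_all _ fun x => (klFun_nonneg (r x).coe_nonneg).trans (hpt x))]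
        exact lintegral_mono fun x => ENNReal.ofReal_le_ofReal (hpt x)
    rw [e1] at hle
    have h3 := (ENNReal.ofReal_le_ofReal_iff (by positivity)).1 (hle.trans e2)
    rw [hRint] at h3
    have ht' : (0 : ℝ) < t := ht
    have ha' : (a : ℝ) = 1 - t := by linarith
    rw [ha'] at h3
    have hH' : H = (∫ x, G x ∂π) - γ * A - Real.log Z := by rw [hK]; ring
    rw [hH'] at h3
    -- The terms of first order in `t` involving `A` and `M` cancel, because `log σ` contains
    -- exactly `-γ w`. Only `t ∫ G` remains at first order, against a remainder of order `t²`.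
    have h4 : t * (∫ x, G x ∂π) ≤ t * (t * (γ / 2 * (A - 2 * M + D))) := by
      nlinarith
    exact le_of_mul_le_mul_left h4 ht'
  have hKle : (∫ x, G x ∂π) ≤ 0 := by
    by_contra hcon
    push Not at hcon
    set K := ∫ x, G x ∂π
    set c := γ / 2 * (A - 2 * M + D)
    have hd : 0 < 2 * (|c| + K) := by positivity
    -- With this `t`, which is at most `1/2`, `hmain` would give `K ≤ K / 2`.
    have h := hmain (Real.toNNReal (K / (2 * (|c| + K)))) (by simpa using div_pos hcon hd) (by
      rw [← NNReal.coe_le_coe, Real.coe_toNNReal _ (by positivity), NNReal.coe_one, div_le_one hd]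
      nlinarith [abs_nonneg c])
    rw [Real.coe_toNNReal _ (by positivity)] at h
    have h5 : K / (2 * (|c| + K)) * c ≤ K / (2 * (|c| + K)) * (|c| + K) := by
      gcongr
      linarith [le_abs_self c]
    have h6 : K / (2 * (|c| + K)) * (|c| + K) = K / 2 := by
      have : |c| + K ≠ 0 := by positivity
      field_simp
    linarith
  have hG00 : ∫ x, G x ∂π = 0 := le_antisymm hKle (integral_nonneg hG0)
  rw [integral_eq_zero_iff_of_nonneg hG0 hGI] at hG00
  filter_upwards [hG00] with x hx
  rw [hGe, Pi.zero_apply, mul_eq_zero, or_iff_right (hσ0 x).ne',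
    klFun_eq_zero_iff (div_nonneg (p x).coe_nonneg (hσ0 x).le), div_eq_one_iff_eq (hσ0 x).ne'] at hx
  rw [← NNReal.coe_inj, hx]
  exact (hqc x).symm

end EulerLagrange

end RieszGas

namespace RieszGas

variable {n : ℕ}

/-! ### The minimizer among all probability measures -/

section Minimizer

variable {s γ : ℝ} {C : ℝ≥0∞} {π : Measure (Space n)}

lemma densityEnergy_eq [IsFiniteMeasure π] {p : Space n → ℝ≥0} (hp : IsDensity π p) :
    ENNReal.ofReal (γ / 2) * interactionEnergy s (π.withDensity fun x => (p x : ℝ≥0∞)) +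
      InformationTheory.klDiv (π.withDensity fun x => (p x : ℝ≥0∞)) π = densityEnergy s γ π p := by
  rw [klDiv_withDensity hp, densityEnergy]

lemma isDensity_one [IsProbabilityMeasure π] : IsDensity π fun _ => 1 :=
  ⟨measurable_const, by simp⟩

lemma densityEnergy_one_ne_top [IsProbabilityMeasure π] (hs : 0 < s) (hsn : s < n) (hC : C ≠ ⊤)
    (hπ : π ≤ C • volume) : densityEnergy s γ π (fun _ => 1) ≠ ⊤ := by
  have h : (π.withDensity fun _ => ((1 : ℝ≥0) : ℝ≥0∞)) = π := by
    rw [withDensity_const]; simp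
  rw [densityEnergy, h]
  simp only [NNReal.coe_one, InformationTheory.klFun_one, ENNReal.ofReal_zero, lintegral_zero,
    add_zero]
  exact ENNReal.mul_ne_top ENNReal.ofReal_ne_top (interactionEnergy_ne_top hs hsn hC hπ)

/-- Existence, uniqueness and Euler-Lagrange equation for the minimizer of the free energy. -/
theorem exists_minimizer [IsProbabilityMeasure π] (hs : 0 < s) (hsn : s < n) (hγ : 0 ≤ γ)
    (hC : C ≠ ⊤) (hπ : π ≤ C • volume) :
    ∃ μ : Measure (Space n), IsProbabilityMeasure μ ∧
      (∀ ν : Measure (Space n), IsProbabilityMeasure ν →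
        ENNReal.ofReal (γ / 2) * interactionEnergy s μ + InformationTheory.klDiv μ π ≤
          ENNReal.ofReal (γ / 2) * interactionEnergy s ν + InformationTheory.klDiv ν π) ∧
      (∀ ν : Measure (Space n), IsProbabilityMeasure ν →
        ENNReal.ofReal (γ / 2) * interactionEnergy s ν + InformationTheory.klDiv ν π ≤
          ENNReal.ofReal (γ / 2) * interactionEnergy s μ + InformationTheory.klDiv μ π → ν = μ) ∧
      ∃ Z : ℝ, 0 < Z ∧
        μ = π.withDensity fun x => ENNReal.ofReal (Real.exp (-(γ * potential s μ x)) / Z) := by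
  obtain ⟨p, hp, hmin⟩ := exists_densityEnergy_le (γ := γ) hs isDensity_one
    (densityEnergy_one_ne_top hs hsn hC hπ)
  have hfin : densityEnergy s γ π p ≠ ⊤ :=
    ((hmin _ isDensity_one).trans_lt (densityEnergy_one_ne_top hs hsn hC hπ).lt_top).ne
  have huniq : ∀ q, IsDensity π q → densityEnergy s γ π q ≤ densityEnergy s γ π p → q =ᵐ[π] p := by
    intro q hq hle
    refine (ae_eq_of_lintegral_sqrt_sub_eq_zero hp.measurable hq.measurable ?_).symm
    have h1 := densityEnergy_midpoint_add_le (γ := γ) hs hp hq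
    have h2 := hmin _ (hp.combination hq (a := 2⁻¹) (b := 2⁻¹)
      (by rw [← NNReal.coe_inj]; norm_num))
    have h3 : densityEnergy s γ π p + ∫⁻ x, ENNReal.ofReal ((√(p x) - √(q x)) ^ 2 / 4) ∂π ≤
        densityEnergy s γ π p + 0 := by
      calc _ ≤ _ := add_le_add h2 le_rfl
        _ ≤ _ := h1
        _ ≤ 2⁻¹ * (densityEnergy s γ π p + densityEnergy s γ π p) := by gcongr
        _ = _ := by
          rw [← two_mul, ← mul_assoc, ENNReal.inv_mul_cancel (by norm_num) (by norm_num), one_mul,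
            add_zero]
    exact le_antisymm (ENNReal.le_of_add_le_add_left hfin h3) zero_le
  refine ⟨π.withDensity fun x => (p x : ℝ≥0∞), hp.isProbabilityMeasure, fun ν hν => ?_,
    fun ν hν hle => ?_, ?_⟩
  · rw [densityEnergy_eq hp]
    by_cases h : ν ≪ π
    · obtain ⟨q, hq, rfl⟩ := exists_density_of_ac ν h
      rw [densityEnergy_eq hq]
      exact hmin q hq
    · rw [InformationTheory.klDiv_of_not_ac h, add_top]; exact le_top
  · rw [densityEnergy_eq hp] at hle
    by_cases h : ν ≪ π
    · obtain ⟨q, hq, rfl⟩ := exists_density_of_ac ν h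
      rw [densityEnergy_eq hq] at hle
      refine withDensity_congr_ae ?_
      filter_upwards [huniq q hq hle] with x hx
      rw [hx]
    · rw [InformationTheory.klDiv_of_not_ac h, add_top] at hle
      exact absurd (top_le_iff.1 hle) hfin
  -- For `γ = 0` the energy is the entropy alone, and uniqueness identifies the minimizer with the
  -- constant density `1`.
  · rcases hγ.eq_or_lt with rfl | hγ
    · refine ⟨1, one_pos, withDensity_congr_ae ?_⟩
      have h1 : densityEnergy s 0 π (fun _ => 1) ≤ densityEnergy s 0 π p := by
        simp [densityEnergy, InformationTheory.klFun_one]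
      filter_upwards [huniq _ isDensity_one h1] with x hx
      simp [← hx]
    · obtain ⟨Z, hZ, h⟩ := density_ae_eq_of_minimizer hs hsn hγ hC hπ hp hfin hmin
      refine ⟨Z, hZ, withDensity_congr_ae ?_⟩
      filter_upwards [h] with x hx
      nth_rewrite 1 [hx]
      rfl

end Minimizer

end RieszGas

namespace RieszGas

variable {n : ℕ}

/-! ### Product measures -/

section Pi

variable {X : Type*} [MeasurableSpace X]

lemma measurable_insertNth {N : ℕ} (i : Fin (N + 1)) :
    Measurable fun q : X × (Fin N → X) => (i.insertNth q.1 q.2 : Fin (N + 1) → X) :=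
  (MeasurableEquiv.piFinSuccAbove (fun _ => X) i).symm.measurable

lemma lintegral_pi_insertNth (m : Measure X) [SigmaFinite m] {N : ℕ} (i : Fin (N + 1))
    {F : (Fin (N + 1) → X) → ℝ≥0∞} (hF : Measurable F) :
    ∫⁻ x, F x ∂(Measure.pi fun _ => m) =
      ∫⁻ a, ∫⁻ y, F (i.insertNth a y) ∂(Measure.pi fun _ => m) ∂m := by
  have h := (measurePreserving_piFinSuccAbove (fun _ : Fin (N + 1) => m) i).symm
  rw [← h.lintegral_comp_emb (MeasurableEquiv.measurableEmbedding _) F, lintegral_prod]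
  · rfl
  · exact (hF.comp (measurable_insertNth i)).aemeasurable

lemma lintegral_pi_prod (m : Measure X) [SigmaFinite m] : ∀ {N : ℕ} {f : Fin N → X → ℝ≥0∞},
    (∀ i, Measurable (f i)) →
    ∫⁻ x, ∏ i, f i (x i) ∂(Measure.pi fun _ => m) = ∏ i, ∫⁻ a, f i a ∂m
  | 0, f, _ => by simp
  | N + 1, f, hf => by
    have hm : Measurable fun x : Fin (N + 1) → X => ∏ i, f i (x i) :=
      Finset.measurable_prod _ fun i _ => (hf i).comp (measurable_pi_apply i)
    have hm' : Measurable fun x : Fin N → X => ∏ i, f i.succ (x i) :=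
      Finset.measurable_prod _ fun i _ => (hf _).comp (measurable_pi_apply i)
    rw [lintegral_pi_insertNth m 0 hm]
    simp only [Fin.prod_univ_succ, Fin.insertNth_zero, Fin.cons_zero, Fin.cons_succ]
    rw [← lintegral_pi_prod m fun i => hf i.succ, ← lintegral_mul_const _ (hf 0)]
    exact lintegral_congr fun a => lintegral_const_mul _ hm'

lemma pi_withDensity (m : Measure X) [SigmaFinite m] {f : X → ℝ≥0∞} (hf : Measurable f)
    [SigmaFinite (m.withDensity f)] (N : ℕ) :
    (Measure.pi fun _ : Fin N => m.withDensity f) =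
      (Measure.pi fun _ : Fin N => m).withDensity fun x => ∏ i, f (x i) := by
  refine Measure.pi_eq fun t ht => ?_
  rw [withDensity_apply _ (MeasurableSet.univ_pi ht),
    ← lintegral_indicator (MeasurableSet.univ_pi ht)]
  have : ∀ x : Fin N → X, (Set.univ.pi t).indicator (fun x => ∏ i, f (x i)) x =
      ∏ i, (t i).indicator f (x i) := by
    intro x
    by_cases hx : x ∈ Set.univ.pi t
    · rw [Set.indicator_of_mem hx]
      exact Finset.prod_congr rfl fun i _ => (Set.indicator_of_mem (hx i trivial) f).symm
    · rw [Set.indicator_of_notMem hx]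
      simp only [Set.mem_pi, Set.mem_univ, true_implies, not_forall] at hx
      obtain ⟨i, hi⟩ := hx
      exact (Finset.prod_eq_zero (Finset.mem_univ i) (Set.indicator_of_notMem hi f)).symm
  simp_rw [this]
  rw [lintegral_pi_prod m fun i => hf.indicator (ht i)]
  refine Finset.prod_congr rfl fun i _ => ?_
  rw [lintegral_indicator (ht i), withDensity_apply _ (ht i)]

end Pi

/-! ### The Gibbs measure -/

/-- The sum of the interactions of all pairs. -/
noncomputable def pairEnergy (s : ℝ) {N : ℕ} (x : Fin N → Space n) : ℝ≥0∞ :=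
  ∑ i, ∑ j ∈ Finset.Ioi i, rieszKernel s (x i) (x j)

/-- The weight `exp (-b ∑_j g(a, y_j))`. -/
noncomputable def fieldWeight (s b : ℝ) {N : ℕ} (a : Space n) (y : Fin N → Space n) : ℝ≥0∞ :=
  expNeg (ENNReal.ofReal b * ∑ j, rieszKernel s a (y j))

/-- The partition function with respect to the reference measure `m`. -/
noncomputable def configZ (s b : ℝ) (m : Measure (Space n)) (N : ℕ) : ℝ≥0∞ :=
  ∫⁻ x, expNeg (ENNReal.ofReal b * pairEnergy s x) ∂(Measure.pi fun _ : Fin N => m)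

/-- The Gibbs measure with respect to the reference measure `m`. -/
noncomputable def configMeasure (s b : ℝ) (m : Measure (Space n)) (N : ℕ) :
    Measure (Fin N → Space n) :=
  (configZ s b m N)⁻¹ •
    (Measure.pi fun _ : Fin N => m).withDensity fun x => expNeg (ENNReal.ofReal b * pairEnergy s x)

@[fun_prop] lemma measurable_pairEnergy (s : ℝ) (N : ℕ) :
    Measurable fun x : Fin N → Space n => pairEnergy s x := by
  unfold pairEnergy
  refine Finset.measurable_sum _ fun i _ => Finset.measurable_sum _ fun j _ => ?_
  fun_prop

@[fun_prop] lemma measurable_fieldWeight {α : Type*} [MeasurableSpace α] (s b : ℝ) {N : ℕ}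
    {f : α → Space n} {g : α → Fin N → Space n} (hf : Measurable f) (hg : Measurable g) :
    Measurable fun q => fieldWeight s b (f q) (g q) := by
  unfold fieldWeight
  refine measurable_expNeg.comp (Measurable.const_mul (Finset.measurable_sum _ fun j _ => ?_) _)
  fun_prop

/-- Doubling removes the order on the indices. Any particle can then be singled out, and the sum can
be compared with a double integral against the empirical measure. -/
lemma sum_sum_ioi_eq {N : ℕ} (k : Fin N → Fin N → ℝ≥0∞) (hk : ∀ i j, k i j = k j i) :
    2 * ∑ i, ∑ j ∈ Finset.Ioi i, k i j = ∑ i, ∑ j, if i = j then 0 else k i j := by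
  have h1 : ∀ i j : Fin N, (if i = j then 0 else k i j) =
      (if i < j then k i j else 0) + if j < i then k j i else 0 := by
    intro i j
    rcases lt_trichotomy i j with h | h | h
    · simp [h, h.ne, h.not_gt]
    · simp [h]
    · simp [h, h.ne', h.not_gt, hk i j]
  have h2 : ∑ i, ∑ j ∈ Finset.Ioi i, k i j = ∑ i, ∑ j, if i < j then k i j else 0 := by
    refine Finset.sum_congr rfl fun i _ => ?_
    rw [← Finset.sum_filter]
    congr 1
    ext j; simp
  simp_rw [h1, Finset.sum_add_distrib]
  rw [Finset.sum_comm (f := fun i j => if j < i then k j i else 0), ← h2, two_mul]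

lemma pairEnergy_insertNth (s : ℝ) {N : ℕ} (i : Fin (N + 1)) (a : Space n) (y : Fin N → Space n) :
    pairEnergy s (i.insertNth a y : Fin (N + 1) → Space n) =
      ∑ j, rieszKernel s a (y j) + pairEnergy s y := by
  have h2 : (2 : ℝ≥0∞) ≠ 0 := two_ne_zero
  have key : 2 * pairEnergy s (i.insertNth a y : Fin (N + 1) → Space n) =
      2 * (∑ j, rieszKernel s a (y j) + pairEnergy s y) := by
    rw [mul_add]
    unfold pairEnergy
    rw [sum_sum_ioi_eq _ fun _ _ => rieszKernel_comm s _ _,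
      sum_sum_ioi_eq _ fun _ _ => rieszKernel_comm s _ _, Fin.sum_univ_succAbove _ i]
    simp only [Fin.sum_univ_succAbove _ i, Fin.insertNth_apply_same, Fin.insertNth_apply_succAbove,
      if_true, zero_add, Fin.succAbove_ne, (Fin.succAbove_ne i _).symm, if_false,
      Fin.succAbove_right_inj, Finset.sum_add_distrib]
    simp_rw [fun j => rieszKernel_comm s (y j) a]
    ring
  exact (ENNReal.mul_right_inj h2 ENNReal.ofNat_ne_top).1 key

lemma expNeg_pairEnergy_insertNth (s b : ℝ) {N : ℕ} (i : Fin (N + 1)) (a : Space n)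
    (y : Fin N → Space n) :
    expNeg (ENNReal.ofReal b * pairEnergy s (i.insertNth a y : Fin (N + 1) → Space n)) =
      fieldWeight s b a y * expNeg (ENNReal.ofReal b * pairEnergy s y) := by
  rw [pairEnergy_insertNth, mul_add, expNeg_add, fieldWeight]

/-- The confinement is absorbed into the one-particle reference measure, so that only the
interaction remains in the weight. -/
lemma gibbs_eq_configMeasure {s b : ℝ} {V : Space n → ℝ≥0∞} (hV : Measurable V)
    [IsFiniteMeasure (volume.withDensity fun x => expNeg (V x))] (N : ℕ) :
    gibbs s b V N = configMeasure s b (volume.withDensity fun x => expNeg (V x)) N := by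
  have hm : Measurable fun x : Fin N → Space n => ∏ i, expNeg (V (x i)) :=
    Finset.measurable_prod _ fun i _ => by fun_prop
  have hpi := pi_withDensity (volume : Measure (Space n)) (f := fun x => expNeg (V x))
    (by fun_prop) N
  have he : ∀ x : Fin N → Space n, expNeg (hamiltonian s b V x) =
      (∏ i, expNeg (V (x i))) * expNeg (ENNReal.ofReal b * pairEnergy s x) := by
    intro x
    rw [hamiltonian, expNeg_add, expNeg_sum, mul_comm]
    rfl
  have hW : Measurable fun x : Fin N → Space n => expNeg (ENNReal.ofReal b * pairEnergy s x) := by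
    fun_prop
  have hd : ((Measure.pi fun _ : Fin N => volume.withDensity fun x => expNeg (V x)).withDensity
      fun x => expNeg (ENNReal.ofReal b * pairEnergy s x)) =
      volume.withDensity fun x => expNeg (hamiltonian s b V x) := by
    rw [hpi, ← withDensity_mul _ hm hW]
    congr 1
    ext x
    exact (he x).symm
  have hZ : partitionFunction s b V N =
      configZ s b (volume.withDensity fun x => expNeg (V x)) N := by
    rw [configZ, hpi, lintegral_withDensity_eq_lintegral_mul _ hm hW, partitionFunction]
    exact lintegral_congr fun x => he x
  rw [gibbs, configMeasure, hd, hZ]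

/-! ### Removing one particle -/

section Recursion

variable {s b : ℝ} {m : Measure (Space n)}

lemma lintegral_configMeasure {N : ℕ} {F : (Fin N → Space n) → ℝ≥0∞} (hF : Measurable F) :
    ∫⁻ x, F x ∂(configMeasure s b m N) = (configZ s b m N)⁻¹ *
      ∫⁻ x, expNeg (ENNReal.ofReal b * pairEnergy s x) * F x ∂(Measure.pi fun _ => m) := by
  rw [configMeasure, lintegral_smul_measure, lintegral_withDensity_eq_lintegral_mul _ (by fun_prop)
    hF, smul_eq_mul]
  rfl

variable [IsFiniteMeasure m]

lemma configZ_ne_top (N : ℕ) : configZ s b m N ≠ ⊤ := by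
  refine ((lintegral_mono fun x => expNeg_le_one _).trans_lt ?_).ne
  simp only [lintegral_const, one_mul]
  exact measure_lt_top _ _

lemma isProbabilityMeasure_configMeasure {N : ℕ} (h0 : configZ s b m N ≠ 0) :
    IsProbabilityMeasure (configMeasure s b m N) := by
  refine ⟨?_⟩
  rw [configMeasure, Measure.smul_apply, withDensity_apply _ MeasurableSet.univ,
    Measure.restrict_univ, smul_eq_mul]
  exact ENNReal.inv_mul_cancel h0 (configZ_ne_top N)

/-- Integration of one particle out of `N + 1`. -/
lemma lintegral_configMeasure_succ {N : ℕ} (h0 : configZ s b m N ≠ 0) (i : Fin (N + 1))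
    {F : (Fin (N + 1) → Space n) → ℝ≥0∞} (hF : Measurable F) :
    ∫⁻ x, F x ∂(configMeasure s b m (N + 1)) = (configZ s b m (N + 1))⁻¹ * configZ s b m N *
      ∫⁻ a, ∫⁻ y, fieldWeight s b a y * F (i.insertNth a y) ∂(configMeasure s b m N) ∂m := by
  have hga : ∀ a, Measurable fun y : Fin N → Space n =>
      fieldWeight s b a y * F (i.insertNth a y) := fun a => by
    have hF' : Measurable fun y : Fin N → Space n => F (i.insertNth a y) :=
      hF.comp ((measurable_insertNth i).comp measurable_prodMk_left)
    fun_prop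
  rw [lintegral_configMeasure hF, lintegral_pi_insertNth m i
    (by fun_prop), mul_assoc]
  congr 1
  rw [← lintegral_const_mul' _ _ (configZ_ne_top N)]
  refine lintegral_congr fun a => ?_
  rw [lintegral_configMeasure (hga a), ← mul_assoc, ENNReal.mul_inv_cancel h0 (configZ_ne_top N),
    one_mul]
  refine lintegral_congr fun y => ?_
  rw [expNeg_pairEnergy_insertNth]
  ring

/-- The recursion at the level of measures is what carries over to Bochner integrals of signed
functions. -/
lemma configMeasure_succ_eq_map {N : ℕ} (h0 : configZ s b m N ≠ 0) (i : Fin (N + 1)) :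
    configMeasure s b m (N + 1) = ((configZ s b m (N + 1))⁻¹ * configZ s b m N) •
      Measure.map (fun q : Space n × (Fin N → Space n) =>
          (i.insertNth q.1 q.2 : Fin (N + 1) → Space n))
        ((m.prod (configMeasure s b m N)).withDensity fun q => fieldWeight s b q.1 q.2) := by
  have := isProbabilityMeasure_configMeasure h0
  refine Measure.ext_of_lintegral _ fun F hF => ?_
  have hF' : Measurable fun q : Space n × (Fin N → Space n) => F (i.insertNth q.1 q.2) :=
    hF.comp (measurable_insertNth i)
  rw [lintegral_configMeasure_succ h0 i hF, lintegral_smul_measure,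
    lintegral_map hF (measurable_insertNth i),
    lintegral_withDensity_eq_lintegral_mul _ (by fun_prop) hF', lintegral_prod]
  · rfl
  · exact Measurable.aemeasurable (Measurable.mul (by fun_prop) hF')

lemma configZ_zero (s b : ℝ) (m : Measure (Space n)) : configZ s b m 0 = 1 := by
  simp [configZ, pairEnergy]

lemma configZ_succ (N : ℕ) : configZ s b m (N + 1) =
    ∫⁻ a, ∫⁻ y, fieldWeight s b a y * expNeg (ENNReal.ofReal b * pairEnergy s y)
      ∂(Measure.pi fun _ : Fin N => m) ∂m := by
  rw [configZ, lintegral_pi_insertNth m 0 (by fun_prop)]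
  simp_rw [expNeg_pairEnergy_insertNth]

end Recursion

end RieszGas

/-! ### The mean-field equation and its first consequences -/

namespace RieszGas

variable {n : ℕ}

/-- `μ` solves the mean-field equation `μ = Z⁻¹ exp (-γ U^μ) m`, and has a bounded density. -/
structure IsEquilibrium (s γ : ℝ) (m μ : Measure (Space n)) (C : ℝ≥0∞) (Z B : ℝ) : Prop where
  s_pos : 0 < s
  s_lt : s < n
  γ_nonneg : 0 ≤ γ
  C_ne_top : C ≠ ⊤
  m_le : m ≤ C • volume
  m_univ_le : m Set.univ ≤ C
  μ_le : μ ≤ C • volume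
  μ_univ_le : μ Set.univ ≤ C
  isProbabilityMeasure : IsProbabilityMeasure μ
  Z_pos : 0 < Z
  eq_withDensity : μ = m.withDensity fun x =>
    ENNReal.ofReal (Real.exp (-(γ * potential s μ x)) / Z)
  potential_le : ∀ x, potential s μ x ≤ B

lemma lintegral_pi_eval {X : Type*} [MeasurableSpace X] (μ : Measure X) [IsProbabilityMeasure μ]
    {N : ℕ} (j : Fin N) {f : X → ℝ≥0∞} (hf : Measurable f) :
    ∫⁻ y, f (y j) ∂(Measure.pi fun _ : Fin N => μ) = ∫⁻ a, f a ∂μ :=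
  (measurePreserving_eval (fun _ : Fin N => μ) j).lintegral_comp hf

namespace IsEquilibrium

variable {s γ b : ℝ} {m μ : Measure (Space n)} {C : ℝ≥0∞} {Z B : ℝ}

lemma isFiniteMeasure (h : IsEquilibrium s γ m μ C Z B) : IsFiniteMeasure m :=
  ⟨h.m_univ_le.trans_lt h.C_ne_top.lt_top⟩

lemma B_nonneg (h : IsEquilibrium s γ m μ C Z B) : 0 ≤ B :=
  (potential_nonneg s μ 0).trans (h.potential_le 0)

lemma ofReal_potential_eq (h : IsEquilibrium s γ m μ C Z B) (x : Space n) :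
    ENNReal.ofReal (potential s μ x) = ∫⁻ y, rieszKernel s x y ∂μ :=
  ofReal_potential h.s_pos h.s_lt h.C_ne_top h.μ_le h.μ_univ_le x

lemma measurable_potential (h : IsEquilibrium s γ m μ C Z B) : Measurable (potential s μ) := by
  have := h.isProbabilityMeasure
  exact RieszGas.measurable_potential s μ

lemma integrable_potential (h : IsEquilibrium s γ m μ C Z B) : Integrable (potential s μ) μ := by
  have := h.isProbabilityMeasure
  refine Integrable.of_bound (C := B) h.measurable_potential.aestronglyMeasurable
    (ae_of_all _ fun x => ?_)
  rw [Real.norm_of_nonneg (potential_nonneg s μ x)]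
  exact h.potential_le x

/-- The mean-field density is positive and can be inverted; Gibbs weights can thus be written
relative to products of `μ`. -/
lemma m_eq_withDensity (h : IsEquilibrium s γ m μ C Z B) :
    m = μ.withDensity fun x => ENNReal.ofReal (Z * Real.exp (γ * potential s μ x)) := by
  have hU := h.measurable_potential
  have hZ := h.Z_pos
  have e : μ.withDensity (fun x => ENNReal.ofReal (Z * Real.exp (γ * potential s μ x))) =
      (m.withDensity fun x => ENNReal.ofReal (Real.exp (-(γ * potential s μ x)) / Z)).withDensity
        (fun x => ENNReal.ofReal (Z * Real.exp (γ * potential s μ x))) :=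
    congrArg (fun ρ : Measure (Space n) => ρ.withDensity _) h.eq_withDensity
  rw [e, ← withDensity_mul _ (by fun_prop) (by fun_prop)]
  conv_lhs => rw [← withDensity_one (μ := m)]
  congr 1
  ext x
  rw [Pi.mul_apply, Pi.one_apply, ← ENNReal.ofReal_mul (by positivity), Real.exp_neg]
  rw [← ENNReal.ofReal_one]
  congr 1
  have := Real.exp_pos (γ * potential s μ x)
  field_simp

lemma smul_lintegral_le (h : IsEquilibrium s γ m μ C Z B) (f : Space n → ℝ≥0∞) :
    ENNReal.ofReal Z * ∫⁻ a, f a ∂μ ≤ ∫⁻ a, f a ∂m := by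
  have hZ := h.Z_pos
  have hle : μ ≤ ENNReal.ofReal (1 / Z) • m := by
    conv_lhs => rw [h.eq_withDensity]
    refine withDensity_le_smul fun x => ENNReal.ofReal_le_ofReal ?_
    gcongr
    rw [Real.exp_le_one_iff]
    have := mul_nonneg h.γ_nonneg (potential_nonneg s μ x)
    linarith
  calc ENNReal.ofReal Z * ∫⁻ a, f a ∂μ
      ≤ ENNReal.ofReal Z * ∫⁻ a, f a ∂(ENNReal.ofReal (1 / Z) • m) := by gcongr
    _ = _ := by
      rw [lintegral_smul_measure, smul_eq_mul, ← mul_assoc, ← ENNReal.ofReal_mul hZ.le,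
        mul_one_div_cancel hZ.ne', ENNReal.ofReal_one, one_mul]

/-! ### Bounds on the partition function -/

/-- Since `Z μ ≤ m`, it suffices to apply Jensen under `μ`: the mean over `a` of the field created
by `y` is `∑ U (y j) ≤ N B`, whatever the configuration. -/
lemma le_lintegral_fieldWeight (h : IsEquilibrium s γ m μ C Z B) (hb : 0 ≤ b) {N : ℕ}
    (y : Fin N → Space n) :
    ENNReal.ofReal (Z * Real.exp (-(b * N * B))) ≤ ∫⁻ a, fieldWeight s b a y ∂m := by
  have := h.isProbabilityMeasure
  have hB := h.B_nonneg
  refine le_trans ?_ (h.smul_lintegral_le _)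
  rw [ENNReal.ofReal_mul h.Z_pos.le, ← expNeg_ofReal (by positivity)]
  gcongr
  refine le_trans (expNeg_antitone ?_) (expNeg_lintegral_le μ (X := fun a =>
    ENNReal.ofReal b * ∑ j, rieszKernel s a (y j)) ?_)
  · rw [lintegral_const_mul _ (Finset.measurable_sum _ fun j _ => by fun_prop),
      lintegral_finsetSum _ (fun j _ => by fun_prop), mul_assoc, ENNReal.ofReal_mul hb]
    gcongr
    calc ∑ j, ∫⁻ a, rieszKernel s a (y j) ∂μ ≤ ∑ _j : Fin N, ENNReal.ofReal B := by
          refine Finset.sum_le_sum fun j _ => ?_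
          simp_rw [fun a => rieszKernel_comm s a (y j)]
          rw [← h.ofReal_potential_eq]
          exact ENNReal.ofReal_le_ofReal (h.potential_le _)
      _ = ENNReal.ofReal (N * B) := by
          rw [ENNReal.ofReal_mul (by positivity)]; simp
  · exact Measurable.const_mul (Finset.measurable_sum _ fun j _ => by fun_prop) _

lemma mul_configZ_le (h : IsEquilibrium s γ m μ C Z B) (hb : 0 ≤ b) (N : ℕ) :
    ENNReal.ofReal (Z * Real.exp (-(b * N * B))) * configZ s b m N ≤ configZ s b m (N + 1) := by
  have := h.isFiniteMeasure
  rw [configZ_succ, lintegral_lintegral_swap (by fun_prop), configZ,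
    ← lintegral_const_mul _ (by fun_prop)]
  refine lintegral_mono fun y => ?_
  rw [lintegral_mul_const _ (by fun_prop)]
  gcongr
  exact h.le_lintegral_fieldWeight hb y

lemma configZ_ne_zero (h : IsEquilibrium s γ m μ C Z B) (hb : 0 ≤ b) :
    ∀ N : ℕ, configZ s b m N ≠ 0
  | 0 => by rw [configZ_zero]; exact one_ne_zero
  | N + 1 => by
    have h1 := h.mul_configZ_le hb N
    have hZ := h.Z_pos
    have h2 : 0 < ENNReal.ofReal (Z * Real.exp (-(b * N * B))) := ENNReal.ofReal_pos.2 (by positivity)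
    exact ((ENNReal.mul_pos h2.ne' (h.configZ_ne_zero hb N)).trans_le h1).ne'

/-- This ratio is the prefactor in every removal of a particle; it stays bounded as long as `b N`
does, and its exact asymptotics are never needed. -/
lemma inv_configZ_mul_le (h : IsEquilibrium s γ m μ C Z B) (hb : 0 ≤ b) (N : ℕ) :
    (configZ s b m (N + 1))⁻¹ * configZ s b m N ≤ ENNReal.ofReal (Real.exp (b * N * B) / Z) := by
  have := h.isFiniteMeasure
  have hZ := h.Z_pos
  have h1 := h.mul_configZ_le hb N
  have h0 := h.configZ_ne_zero hb (N + 1)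
  have e : ENNReal.ofReal (Real.exp (b * N * B) / Z) * ENNReal.ofReal (Z * Real.exp (-(b * N * B)))
      = 1 := by
    rw [← ENNReal.ofReal_mul (by positivity), Real.exp_neg, ← ENNReal.ofReal_one]
    congr 1
    field_simp
  calc (configZ s b m (N + 1))⁻¹ * configZ s b m N
      = (configZ s b m (N + 1))⁻¹ * (ENNReal.ofReal (Real.exp (b * N * B) / Z) *
          (ENNReal.ofReal (Z * Real.exp (-(b * N * B))) * configZ s b m N)) := by
        rw [← mul_assoc (ENNReal.ofReal _), e, one_mul]
    _ ≤ (configZ s b m (N + 1))⁻¹ * (ENNReal.ofReal (Real.exp (b * N * B) / Z) *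
          configZ s b m (N + 1)) := by gcongr
    _ = _ := by
        rw [mul_left_comm, ENNReal.inv_mul_cancel h0 (configZ_ne_top _), mul_one]

/-- The one-particle density of the Gibbs measure is bounded. -/
lemma lintegral_eval_configMeasure_le (h : IsEquilibrium s γ m μ C Z B) (hb : 0 ≤ b) {N : ℕ}
    (i : Fin N) {f : Space n → ℝ≥0∞} (hf : Measurable f) :
    ∫⁻ x, f (x i) ∂(configMeasure s b m N) ≤
      ENNReal.ofReal (Real.exp (b * N * B) / Z) * ∫⁻ a, f a ∂m := by
  have := h.isFiniteMeasure
  have hZ := h.Z_pos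
  have hB := h.B_nonneg
  obtain _ | N := N
  · exact i.elim0
  have hP := isProbabilityMeasure_configMeasure (h.configZ_ne_zero hb N)
  rw [lintegral_configMeasure_succ (h.configZ_ne_zero hb N) i
    (F := fun x => f (x i)) (by fun_prop)]
  simp only [Fin.insertNth_apply_same]
  gcongr
  · refine (h.inv_configZ_mul_le hb N).trans (ENNReal.ofReal_le_ofReal ?_)
    gcongr
    linarith
  · calc _ ≤ ∫⁻ _, f _ ∂(configMeasure s b m N) := lintegral_mono fun y =>
        mul_le_of_le_one_left' (expNeg_le_one _)
      _ = _ := by simp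

/-- By independence the mean is `N(N-1)/2` times the energy of `μ`; the induction adds `N`
interactions at each step. -/
lemma lintegral_pairEnergy_le (h : IsEquilibrium s γ m μ C Z B) : ∀ N : ℕ,
    ∫⁻ x, pairEnergy s x ∂(Measure.pi fun _ : Fin N => μ) ≤
      ENNReal.ofReal ((N : ℝ) ^ 2 / 2 * ∫ x, potential s μ x ∂μ)
  | 0 => by simp [pairEnergy]
  | N + 1 => by
    have := h.isProbabilityMeasure
    have hE : 0 ≤ ∫ x, potential s μ x ∂μ := integral_nonneg (potential_nonneg s μ)
    have hU := h.measurable_potential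
    rw [lintegral_pi_insertNth μ 0 (by fun_prop)]
    simp_rw [pairEnergy_insertNth]
    have h1 : ∀ a, ∫⁻ y, (∑ j, rieszKernel s a (y j) + pairEnergy s y)
        ∂(Measure.pi fun _ : Fin N => μ) = N * ENNReal.ofReal (potential s μ a) +
          ∫⁻ y, pairEnergy s y ∂(Measure.pi fun _ : Fin N => μ) := by
      intro a
      rw [lintegral_add_right _ (by fun_prop), lintegral_finsetSum _ (fun j _ => by fun_prop)]
      congr 1
      rw [Finset.sum_congr rfl fun j _ => lintegral_pi_eval μ j (f := rieszKernel s a) (by fun_prop)]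
      simp [h.ofReal_potential_eq]
    simp_rw [h1]
    rw [lintegral_add_right _ measurable_const, lintegral_const_mul _ (by fun_prop),
      ← ofReal_integral_eq_lintegral_ofReal h.integrable_potential
        (ae_of_all _ (potential_nonneg s μ))]
    simp only [lintegral_const, measure_univ, mul_one]
    calc _ ≤ (N : ℝ≥0∞) * ENNReal.ofReal (∫ x, potential s μ x ∂μ) +
          ENNReal.ofReal ((N : ℝ) ^ 2 / 2 * ∫ x, potential s μ x ∂μ) := by
          gcongr
          exact h.lintegral_pairEnergy_le N
      _ = ENNReal.ofReal (N * (∫ x, potential s μ x ∂μ) + (N : ℝ) ^ 2 / 2 *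
          ∫ x, potential s μ x ∂μ) := by
          rw [ENNReal.ofReal_add (by positivity) (by positivity), ENNReal.ofReal_mul (by positivity)
            (q := ∫ x, potential s μ x ∂μ) (p := (N : ℝ)), ENNReal.ofReal_natCast]
      _ ≤ _ := by
          refine ENNReal.ofReal_le_ofReal ?_
          push_cast
          nlinarith

lemma pi_m_eq (h : IsEquilibrium s γ m μ C Z B) (N : ℕ) :
    (Measure.pi fun _ : Fin N => m) = (Measure.pi fun _ : Fin N => μ).withDensity fun x =>
      ENNReal.ofReal (Z ^ N * Real.exp (∑ i, γ * potential s μ (x i))) := by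
  have := h.isProbabilityMeasure
  have hU := h.measurable_potential
  have hZ := h.Z_pos
  have hfin := h.isFiniteMeasure
  rw [h.m_eq_withDensity] at hfin
  conv_lhs => rw [h.m_eq_withDensity]
  rw [pi_withDensity μ (by fun_prop) N]
  congr 1
  ext x
  rw [← ENNReal.ofReal_prod_of_nonneg fun i _ => by positivity, Finset.prod_mul_distrib,
    Real.exp_sum]
  simp

/-- Lower bound for the partition function, by Jensen's inequality. -/
lemma le_configZ (h : IsEquilibrium s γ m μ C Z B) (hb : 0 ≤ b) (N : ℕ) :
    ENNReal.ofReal (Z ^ N * Real.exp (γ * N * (∫ x, potential s μ x ∂μ) -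
      b * (N : ℝ) ^ 2 / 2 * ∫ x, potential s μ x ∂μ)) ≤ configZ s b m N := by
  have := h.isProbabilityMeasure
  have hU := h.measurable_potential
  have hZ := h.Z_pos
  have hB := h.B_nonneg
  have hγ := h.γ_nonneg
  set E := ∫ x, potential s μ x ∂μ with hEdef
  have hE : 0 ≤ E := integral_nonneg (potential_nonneg s μ)
  have hBU : ∀ x, 0 ≤ γ * (B - potential s μ x) := fun x =>
    mul_nonneg hγ (sub_nonneg.2 (h.potential_le x))
  -- The exponent `γ U - b H` has no sign. Subtracting `γ B` per particle makes it nonpositive, so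
  -- Jensen for `expNeg` applies; the factor `exp (N γ B)` is restored in `hstep`.
  set X : (Fin N → Space n) → ℝ≥0∞ := fun x => ENNReal.ofReal b * pairEnergy s x +
    ∑ i, ENNReal.ofReal (γ * (B - potential s μ (x i))) with hX
  have hs : Measurable fun x : Fin N → Space n =>
      ∑ i, ENNReal.ofReal (γ * (B - potential s μ (x i))) :=
    Finset.measurable_sum _ fun i _ => by fun_prop
  have hXm : Measurable X := by fun_prop
  have hintegral : ∫ a, γ * (B - potential s μ a) ∂μ = γ * (B - E) := by
    rw [integral_const_mul, integral_sub (integrable_const _) h.integrable_potential]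
    simp [hEdef]
  have hBUi : Integrable (fun a => γ * (B - potential s μ a)) μ :=
    ((integrable_const B).sub h.integrable_potential).const_mul γ
  have hEB : 0 ≤ γ * (B - E) := hintegral ▸ integral_nonneg hBU
  have hXle : ∫⁻ x, X x ∂(Measure.pi fun _ : Fin N => μ) ≤
      ENNReal.ofReal (b * ((N : ℝ) ^ 2 / 2 * E) + N * (γ * (B - E))) := by
    rw [hX, lintegral_add_right _ hs, lintegral_const_mul _ (by fun_prop),
      lintegral_finsetSum _ (fun i _ => by fun_prop),
      ENNReal.ofReal_add (by positivity) (by positivity), ENNReal.ofReal_mul hb]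
    gcongr
    · exact h.lintegral_pairEnergy_le N
    · rw [Finset.sum_congr rfl fun j _ => lintegral_pi_eval μ j
        (f := fun a => ENNReal.ofReal (γ * (B - potential s μ a))) (by fun_prop),
        ← ofReal_integral_eq_lintegral_ofReal hBUi (ae_of_all _ hBU)]
      rw [hintegral, ENNReal.ofReal_mul (p := (N : ℝ)) (by positivity)]
      simp
  have hstep : ENNReal.ofReal (Z ^ N * Real.exp (N * (γ * B))) *
      expNeg (∫⁻ x, X x ∂(Measure.pi fun _ : Fin N => μ)) ≤ configZ s b m N := by
    rw [configZ, h.pi_m_eq, lintegral_withDensity_eq_lintegral_mul _ (by fun_prop) (by fun_prop)]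
    calc _ ≤ ENNReal.ofReal (Z ^ N * Real.exp (N * (γ * B))) *
          ∫⁻ x, expNeg (X x) ∂(Measure.pi fun _ : Fin N => μ) := by
          gcongr; exact expNeg_lintegral_le _ hXm
      _ = _ := by
          rw [← lintegral_const_mul _ (by fun_prop)]
          refine lintegral_congr fun x => ?_
          rw [Pi.mul_apply, hX, expNeg_add, ← ENNReal.ofReal_sum_of_nonneg fun i _ => hBU _,
            expNeg_ofReal (Finset.sum_nonneg fun i _ => hBU _), mul_left_comm,
            ← ENNReal.ofReal_mul (by positivity), mul_comm]
          congr 2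
          rw [mul_assoc, ← Real.exp_add]
          congr 2
          rw [← sub_eq_add_neg, sub_eq_iff_eq_add, ← Finset.sum_add_distrib]
          simp only [← mul_add, add_sub_cancel]
          simp
  refine le_trans ?_ hstep
  refine le_trans (le_of_eq ?_) (mul_le_mul_right (expNeg_antitone hXle) _)
  rw [expNeg_ofReal (by positivity), ← ENNReal.ofReal_mul (by positivity),
    mul_assoc (Z ^ N), ← Real.exp_add]
  congr 3
  ring

end IsEquilibrium

end RieszGas

/-! ### Comparison of the Gibbs measure with a product measure -/

namespace RieszGas

variable {n : ℕ}

namespace IsEquilibrium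

variable {s γ b : ℝ} {m μ : Measure (Space n)} {C : ℝ≥0∞} {Z B : ℝ}

/-- Positive definiteness of the regularized kernel, applied to the empirical measure. -/
lemma two_mul_sum_le_pairEnergy (h : IsEquilibrium s γ m μ C Z B) {ε : ℝ} (hε : 0 < ε) {N : ℕ}
    (x : Fin N → Space n) :
    2 * ENNReal.ofReal (N * ∑ i, ∫ y, softKernel s ε (x i) y ∂μ) ≤
      2 * pairEnergy s x + ENNReal.ofReal (N * ε ^ (-(s / 2))) +
        ENNReal.ofReal ((N : ℝ) ^ 2 * ∫ y, potential s μ y ∂μ) := by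
  have := h.isProbabilityMeasure
  have hs := h.s_pos
  have hU0 : ∀ a, 0 ≤ ∫ y, softKernel s ε a y ∂μ := fun a =>
    integral_nonneg fun y => (softKernel_pos s hε a y).le
  have hUe : ∀ a, ∫⁻ y, ENNReal.ofReal (softKernel s ε a y) ∂μ =
      ENNReal.ofReal (∫ y, softKernel s ε a y ∂μ) := fun a =>
    (ofReal_integral_eq_lintegral_ofReal (integrable_softKernel hs hε μ a)
      (ae_of_all _ fun y => (softKernel_pos s hε a y).le)).symm
  -- Regularization is what makes the diagonal of the empirical measure finite: it costs `N
  -- ε^{-s/2}`, negligible against `N²`.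
  have key := two_mul_softEnergy_le hs hε (∑ i, Measure.dirac (x i)) ((N : ℝ≥0∞) • μ)
  simp only [lintegral_smul_measure, hUe, smul_eq_mul] at key
  have hms : ∀ a : Space n, Measurable fun y => ENNReal.ofReal (softKernel s ε a y) := fun a => by fun_prop
  have hmu : Measurable fun a => ENNReal.ofReal (∫ y, softKernel s ε a y ∂μ) :=
    ENNReal.measurable_ofReal.comp (continuous_integral_softKernel hs hε μ).measurable
  have e1 : ∫⁻ a, (N : ℝ≥0∞) * ENNReal.ofReal (∫ y, softKernel s ε a y ∂μ)
      ∂(∑ i, Measure.dirac (x i)) = ENNReal.ofReal (N * ∑ i, ∫ y, softKernel s ε (x i) y ∂μ) := by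
    rw [lintegral_finsetSum_measure, ENNReal.ofReal_mul (by positivity),
      ENNReal.ofReal_sum_of_nonneg (fun i _ => hU0 _), ENNReal.ofReal_natCast, Finset.mul_sum]
    refine Finset.sum_congr rfl fun i _ => ?_
    rw [lintegral_dirac' _ (by fun_prop)]
  have e2 : ∫⁻ a, ∫⁻ y, ENNReal.ofReal (softKernel s ε a y) ∂(∑ i, Measure.dirac (x i))
      ∂(∑ i, Measure.dirac (x i)) ≤ 2 * pairEnergy s x + ENNReal.ofReal (N * ε ^ (-(s / 2))) := by
    have h1 : ∀ a, ∫⁻ y, ENNReal.ofReal (softKernel s ε a y) ∂(∑ i, Measure.dirac (x i)) =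
        ∑ j, ENNReal.ofReal (softKernel s ε a (x j)) := by
      intro a
      rw [lintegral_finsetSum_measure]
      exact Finset.sum_congr rfl fun j _ => lintegral_dirac' _ (hms a)
    simp_rw [h1]
    have hm2 : Measurable fun a => ∑ j, ENNReal.ofReal (softKernel s ε a (x j)) :=
      Finset.measurable_sum _ fun j _ => by fun_prop
    rw [lintegral_finsetSum_measure, Finset.sum_congr rfl fun i _ => lintegral_dirac' (x i) hm2,
      pairEnergy, sum_sum_ioi_eq _ fun _ _ => rieszKernel_comm s _ _]
    have h2 : ENNReal.ofReal (N * ε ^ (-(s / 2))) =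
        ∑ i : Fin N, ∑ j : Fin N, if i = j then ENNReal.ofReal (ε ^ (-(s / 2))) else 0 := by
      rw [ENNReal.ofReal_mul (by positivity)]; simp
    rw [h2, ← Finset.sum_add_distrib]
    refine Finset.sum_le_sum fun i _ => ?_
    rw [← Finset.sum_add_distrib]
    refine Finset.sum_le_sum fun j _ => ?_
    by_cases hij : i = j
    · simp [hij, softKernel_self]
    · simpa [hij] using softKernel_le_rieszKernel hs hε (x i) (x j)
  have e3 : (N : ℝ≥0∞) * ∫⁻ a, (N : ℝ≥0∞) * ENNReal.ofReal (∫ y, softKernel s ε a y ∂μ) ∂μ ≤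
      ENNReal.ofReal ((N : ℝ) ^ 2 * ∫ y, potential s μ y ∂μ) := by
    rw [lintegral_const_mul _ hmu, ← mul_assoc, ENNReal.ofReal_mul (by positivity),
      ofReal_integral_eq_lintegral_ofReal h.integrable_potential
        (ae_of_all _ (potential_nonneg s μ)), ENNReal.ofReal_pow (by positivity),
      ENNReal.ofReal_natCast, pow_two]
    gcongr with a
    rw [← ENNReal.ofReal_le_ofReal_iff (potential_nonneg s μ a), ← hUe, h.ofReal_potential_eq]
    exact lintegral_softKernel_le s hs hε μ a
  rw [e1] at key
  exact key.trans (add_le_add e2 e3)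

/-- The Gibbs measure is dominated by the product measure, up to a subexponential factor. -/
lemma configMeasure_le (h : IsEquilibrium s γ m μ C Z B) (hb : 0 < b) {ε τ : ℝ} (hε : 0 < ε)
    (hτ : ∀ x, potential s μ x ≤ ∫ y, softKernel s ε x y ∂μ + τ) (N : ℕ) :
    configMeasure s b m N ≤ ENNReal.ofReal (Real.exp (N * (2 * |b * N - γ| * B + b * N * τ +
      b * ε ^ (-(s / 2)) / 2))) • (Measure.pi fun _ : Fin N => μ) := by
  have := h.isProbabilityMeasure
  have := h.isFiniteMeasure
  have hU := h.measurable_potential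
  have hZ := h.Z_pos
  set E := ∫ x, potential s μ x ∂μ with hEdef
  have hE : 0 ≤ E := integral_nonneg (potential_nonneg s μ)
  have hEB : E ≤ B := by
    have := integral_mono h.integrable_potential (integrable_const B) h.potential_le
    simpa using this
  -- The rate per particle. The mismatch `|b N - γ| B` occurs twice, once in replacing `γ U` by `b N
  -- U` and once in comparing with the exponent of `D`; the other terms are the regularization error
  -- and the diagonal.
  set κ := 2 * |b * N - γ| * B + b * N * τ + b * ε ^ (-(s / 2)) / 2 with hκ
  set D := Real.exp (γ * N * E - b * (N : ℝ) ^ 2 / 2 * E) with hD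
  -- pointwise bound on the weight
  have hpt : ∀ x : Fin N → Space n,
      ENNReal.ofReal (Z ^ N * Real.exp (∑ i, γ * potential s μ (x i))) *
        expNeg (ENNReal.ofReal b * pairEnergy s x) ≤
      ENNReal.ofReal (Z ^ N * D) * ENNReal.ofReal (Real.exp (N * κ)) := by
    intro x
    rcases eq_or_ne (pairEnergy s x) ⊤ with htop | hfin
    · rw [htop, ENNReal.mul_top (ENNReal.ofReal_pos.2 hb).ne', expNeg_top, mul_zero]
      exact zero_le
    have hp := h.two_mul_sum_le_pairEnergy hε x
    set S := ∑ i, ∫ y, softKernel s ε (x i) y ∂μ with hS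
    have hS0 : 0 ≤ S := Finset.sum_nonneg fun i _ =>
      integral_nonneg fun y => (softKernel_pos s hε (x i) y).le
    set p := (pairEnergy s x).toReal with hpdef
    have hp0 : 0 ≤ p := ENNReal.toReal_nonneg
    rw [← hEdef, ← ENNReal.ofReal_toReal hfin, ← hpdef, ← ENNReal.ofReal_ofNat,
      ← ENNReal.ofReal_mul (by norm_num), ← ENNReal.ofReal_mul (by norm_num),
      ← ENNReal.ofReal_add (by positivity) (by positivity),
      ← ENNReal.ofReal_add (by positivity) (by positivity),
      ENNReal.ofReal_le_ofReal_iff (by positivity)] at hp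
    rw [← ENNReal.ofReal_toReal hfin, ← hpdef, ← ENNReal.ofReal_mul hb.le,
      expNeg_ofReal (by positivity), ← ENNReal.ofReal_mul (by positivity),
      ← ENNReal.ofReal_mul (by positivity)]
    refine ENNReal.ofReal_le_ofReal ?_
    rw [mul_assoc, mul_assoc, hD, ← Real.exp_add, ← Real.exp_add]
    refine mul_le_mul_of_nonneg_left (Real.exp_le_exp.2 ?_) (by positivity)
    have h1 : ∑ i, γ * potential s μ (x i) - b * N * S ≤ N * (|b * N - γ| * B + b * N * τ) := by
      rw [hS, Finset.mul_sum, ← Finset.sum_sub_distrib]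
      calc _ ≤ ∑ _i : Fin N, (|b * N - γ| * B + b * N * τ) := by
            refine Finset.sum_le_sum fun i _ => ?_
            have a1 := hτ (x i)
            have a2 := h.potential_le (x i)
            have a3 := potential_nonneg s μ (x i)
            have a4 : 0 ≤ b * N := by positivity
            have a5 : (γ - b * N) * potential s μ (x i) ≤ |b * N - γ| * B := by
              rw [abs_sub_comm]
              exact mul_le_mul (le_abs_self _) a2 a3 (abs_nonneg _)
            nlinarith [mul_le_mul_of_nonneg_left a1 a4]
        _ = _ := by rw [Finset.sum_const, Finset.card_univ, Fintype.card_fin, nsmul_eq_mul]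
    have h2 : -(b * p) ≤ -(b * N * S) + b * (N * ε ^ (-(s / 2))) / 2 + b * ((N : ℝ) ^ 2 * E) / 2 := by
      nlinarith
    have h3 : (b * N - γ) * E ≤ |b * N - γ| * B :=
      mul_le_mul (le_abs_self _) hEB hE (abs_nonneg _)
    have h4 : (N : ℝ) * ((b * N - γ) * E) ≤ N * (|b * N - γ| * B) := by gcongr
    rw [hκ]
    nlinarith
  -- The factor `Z ^ N * D` of the pointwise bound is exactly the Jensen lower bound for the
  -- partition function, and cancels.
  have hZN := h.le_configZ hb.le N
  rw [← hEdef, ← hD] at hZN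
  rw [configMeasure, h.pi_m_eq, ← withDensity_mul _ (by fun_prop) (by fun_prop)]
  refine le_trans ?_ (le_of_eq (one_smul ℝ≥0∞ _))
  have hle : ((Measure.pi fun _ : Fin N => μ).withDensity ((fun x : Fin N → Space n =>
      ENNReal.ofReal (Z ^ N * Real.exp (∑ i, γ * potential s μ (x i)))) *
        fun x => expNeg (ENNReal.ofReal b * pairEnergy s x))) ≤
      (ENNReal.ofReal (Z ^ N * D) * ENNReal.ofReal (Real.exp (N * κ))) •
        (Measure.pi fun _ : Fin N => μ) := by
    rw [← withDensity_const]
    exact withDensity_mono (ae_of_all _ hpt)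
  refine Measure.le_iff'.2 fun A => ?_
  have hA := hle A
  simp only [Measure.smul_apply, smul_eq_mul, one_mul] at hA ⊢
  calc _ ≤ (configZ s b m N)⁻¹ * (ENNReal.ofReal (Z ^ N * D) * ENNReal.ofReal (Real.exp (N * κ)) *
        (Measure.pi fun _ : Fin N => μ) A) := by gcongr
    _ ≤ (configZ s b m N)⁻¹ * (configZ s b m N * ENNReal.ofReal (Real.exp (N * κ)) *
        (Measure.pi fun _ : Fin N => μ) A) := by gcongr
    _ = _ := by
        rw [mul_assoc, ← mul_assoc, ENNReal.inv_mul_cancel (h.configZ_ne_zero hb.le N)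
          (configZ_ne_top N), one_mul]

end IsEquilibrium

/-! ### A law of large numbers -/

/-- For `|u| ≤ 1` one has `e^u ≤ 1 + u + u²`, and the linear term integrates to zero. -/
lemma lintegral_exp_le {X : Type*} [MeasurableSpace X] (μ : Measure X) [IsProbabilityMeasure μ]
    {f : X → ℝ} (hf : Measurable f) {β t : ℝ} (hfβ : ∀ x, |f x| ≤ β) (hf0 : ∫ x, f x ∂μ = 0)
    (ht : |t| * β ≤ 1) :
    ∫⁻ x, ENNReal.ofReal (Real.exp (t * f x)) ∂μ ≤ ENNReal.ofReal (Real.exp (β ^ 2 * t ^ 2)) := by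
  have hfi : Integrable f μ := Integrable.of_bound (C := β) hf.aestronglyMeasurable (ae_of_all _ hfβ)
  have hpt : ∀ x, Real.exp (t * f x) ≤ 1 + t * f x + β ^ 2 * t ^ 2 := by
    intro x
    have h1 : |t * f x| ≤ 1 := by
      rw [abs_mul]; exact (mul_le_mul_of_nonneg_left (hfβ x) (abs_nonneg _)).trans ht
    have h2 := (abs_le.1 (Real.abs_exp_sub_one_sub_id_le h1)).2
    have h3 : (f x) ^ 2 ≤ β ^ 2 := sq_le_sq' (abs_le.1 (hfβ x)).1 (abs_le.1 (hfβ x)).2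
    nlinarith [mul_le_mul_of_nonneg_right h3 (sq_nonneg t)]
  have hi : Integrable (fun x => 1 + t * f x + β ^ 2 * t ^ 2) μ :=
    ((integrable_const _).add (hfi.const_mul t)).add (integrable_const _)
  calc _ ≤ ∫⁻ x, ENNReal.ofReal (1 + t * f x + β ^ 2 * t ^ 2) ∂μ :=
        lintegral_mono fun x => ENNReal.ofReal_le_ofReal (hpt x)
    _ = ENNReal.ofReal (∫ x, (1 + t * f x + β ^ 2 * t ^ 2) ∂μ) :=
        (ofReal_integral_eq_lintegral_ofReal hi
          (ae_of_all _ fun x => (Real.exp_pos _).le.trans (hpt x))).symm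
    _ = ENNReal.ofReal (1 + β ^ 2 * t ^ 2) := by
        have e : Integrable (fun x => 1 + t * f x) μ := (integrable_const _).add (hfi.const_mul t)
        rw [integral_add e (integrable_const _), integral_add (integrable_const _) (hfi.const_mul t),
          integral_const_mul, hf0]
        simp
    _ ≤ _ := ENNReal.ofReal_le_ofReal (by linarith [Real.add_one_le_exp (β ^ 2 * t ^ 2)])

lemma lintegral_exp_sum_le {X : Type*} [MeasurableSpace X] (μ : Measure X) [IsProbabilityMeasure μ]
    {f : X → ℝ} (hf : Measurable f) {β t : ℝ} (hfβ : ∀ x, |f x| ≤ β) (hf0 : ∫ x, f x ∂μ = 0)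
    (ht : |t| * β ≤ 1) {N : ℕ} {κ : ℝ} {P : Measure (Fin N → X)}
    (hP : P ≤ ENNReal.ofReal (Real.exp (N * κ)) • (Measure.pi fun _ : Fin N => μ)) :
    ∫⁻ y, ENNReal.ofReal (Real.exp (t * ∑ j, f (y j))) ∂P ≤
      ENNReal.ofReal (Real.exp (N * (κ + β ^ 2 * t ^ 2))) := by
  calc _ ≤ ∫⁻ y, ENNReal.ofReal (Real.exp (t * ∑ j, f (y j)))
        ∂(ENNReal.ofReal (Real.exp (N * κ)) • (Measure.pi fun _ : Fin N => μ)) :=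
        lintegral_mono' hP le_rfl
    _ = ENNReal.ofReal (Real.exp (N * κ)) *
        ∫⁻ y, ∏ j, ENNReal.ofReal (Real.exp (t * f (y j))) ∂(Measure.pi fun _ : Fin N => μ) := by
        rw [lintegral_smul_measure, smul_eq_mul]
        congr 1
        refine lintegral_congr fun y => ?_
        rw [Finset.mul_sum, Real.exp_sum, ENNReal.ofReal_prod_of_nonneg fun _ _ => (Real.exp_pos _).le]
    _ ≤ ENNReal.ofReal (Real.exp (N * κ)) * ∏ _j : Fin N, ENNReal.ofReal (Real.exp (β ^ 2 * t ^ 2)) := by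
        rw [lintegral_pi_prod μ (f := fun _ x => ENNReal.ofReal (Real.exp (t * f x)))
          (fun _ => by fun_prop)]
        gcongr
        exact lintegral_exp_le μ hf hfβ hf0 ht
    _ = _ := by
        rw [Finset.prod_const, Finset.card_univ, Fintype.card_fin, ← ENNReal.ofReal_pow
          (Real.exp_pos _).le, ← ENNReal.ofReal_mul (Real.exp_pos _).le, ← Real.exp_nat_mul,
          ← Real.exp_add]
        congr 2
        ring

/-- Centered sums are small under measures with subexponential density with respect to a product
measure. -/
lemma lintegral_abs_sum_le {X : Type*} [MeasurableSpace X] (μ : Measure X) [IsProbabilityMeasure μ]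
    {f : X → ℝ} (hf : Measurable f) {β t : ℝ} (hfβ : ∀ x, |f x| ≤ β) (hf0 : ∫ x, f x ∂μ = 0)
    (ht0 : 0 < t) (ht : t * β ≤ 1) {N : ℕ} {κ : ℝ} (hκ : 0 ≤ κ) {P : Measure (Fin N → X)}
    [IsProbabilityMeasure P]
    (hP : P ≤ ENNReal.ofReal (Real.exp (N * κ)) • (Measure.pi fun _ : Fin N => μ)) :
    ∫⁻ y, ENNReal.ofReal |∑ j, f (y j)| ∂P ≤
      ENNReal.ofReal ((N * (κ + β ^ 2 * t ^ 2) + 2) / t) := by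
  set L := N * (κ + β ^ 2 * t ^ 2) with hL
  have hL0 : 0 ≤ L := by positivity
  have hm : Measurable fun y : Fin N → X => ∑ j, f (y j) :=
    Finset.measurable_sum _ fun j _ => by fun_prop
  have h1 := lintegral_exp_sum_le μ hf hfβ hf0 (t := t) (by rwa [abs_of_pos ht0]) hP
  have h2 := lintegral_exp_sum_le μ hf hfβ hf0 (t := -t) (by rwa [abs_neg, abs_of_pos ht0]) hP
  rw [neg_sq] at h2
  -- This is `u ≤ L + e^{-L} e^u` at `u = t|S|`. Taking for `L` the logarithm of the exponential
  -- moment bound, the last term contributes only `2/t` on average.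
  have hpt : ∀ S : ℝ, |S| ≤ L / t + Real.exp (-L) / t * (Real.exp (t * S) + Real.exp (-t * S)) := by
    intro S
    have a1 : Real.exp (t * |S|) ≤ Real.exp (t * S) + Real.exp (-t * S) := by
      rcases abs_cases S with ⟨h, -⟩ | ⟨h, -⟩
      · rw [h]; linarith [Real.exp_pos (-t * S)]
      · rw [h, mul_neg, ← neg_mul]; linarith [Real.exp_pos (t * S)]
    have a2 : t * |S| - L ≤ Real.exp (-L) * Real.exp (t * |S|) := by
      rw [← Real.exp_add]
      have := Real.add_one_le_exp (-L + t * |S|)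
      linarith
    have a3 : t * |S| ≤ L + Real.exp (-L) * (Real.exp (t * S) + Real.exp (-t * S)) := by
      have := mul_le_mul_of_nonneg_left a1 (Real.exp_pos (-L)).le
      linarith
    have a4 : |S| = t * |S| / t := by field_simp
    rw [a4]
    calc t * |S| / t ≤ (L + Real.exp (-L) * (Real.exp (t * S) + Real.exp (-t * S))) / t := by gcongr
      _ = _ := by ring
  calc _ ≤ ∫⁻ y, (ENNReal.ofReal (L / t) + ENNReal.ofReal (Real.exp (-L) / t) *
        (ENNReal.ofReal (Real.exp (t * ∑ j, f (y j))) +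
          ENNReal.ofReal (Real.exp (-t * ∑ j, f (y j))))) ∂P := by
        refine lintegral_mono fun y => ?_
        rw [← ENNReal.ofReal_add (Real.exp_pos _).le (Real.exp_pos _).le,
          ← ENNReal.ofReal_mul (by positivity), ← ENNReal.ofReal_add (by positivity) (by positivity)]
        exact ENNReal.ofReal_le_ofReal (hpt _)
    _ ≤ ENNReal.ofReal (L / t) + ENNReal.ofReal (Real.exp (-L) / t) *
        (ENNReal.ofReal (Real.exp L) + ENNReal.ofReal (Real.exp L)) := by
        rw [lintegral_add_left measurable_const, lintegral_const_mul _ (by fun_prop),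
          lintegral_add_left (by fun_prop)]
        simp only [lintegral_const, measure_univ, mul_one]
        gcongr
    _ = _ := by
        rw [← ENNReal.ofReal_add (Real.exp_pos _).le (Real.exp_pos _).le,
          ← ENNReal.ofReal_mul (by positivity), ← ENNReal.ofReal_add (by positivity) (by positivity)]
        congr 1
        rw [Real.exp_neg]
        have := (Real.exp_pos L).ne'
        field_simp
        ring

end RieszGas

/-! ### Decoupling of a test particle -/

namespace RieszGas

variable {n : ℕ}

lemma abs_exp_neg_sub_exp_neg_le {x y : ℝ} (hx : 0 ≤ x) (hy : 0 ≤ y) :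
    |Real.exp (-x) - Real.exp (-y)| ≤ |x - y| := by
  wlog h : x ≤ y generalizing x y
  · rw [abs_sub_comm, abs_sub_comm x y]; exact this hy hx (le_of_not_ge h)
  have h1 : Real.exp (-y) ≤ Real.exp (-x) := Real.exp_le_exp.2 (by linarith)
  rw [abs_of_nonneg (by linarith), abs_of_nonpos (by linarith)]
  have h2 : Real.exp (-y) = Real.exp (-x) * Real.exp (x - y) := by rw [← Real.exp_add]; ring_nf
  have h3 := Real.add_one_le_exp (x - y)
  have h4 : Real.exp (-x) ≤ 1 := Real.exp_le_one_iff.2 (by linarith)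
  have h5 := Real.exp_pos (-x)
  rw [h2]
  nlinarith

/-- The function `e^{-x}` is 1-Lipschitz on `[0, ∞)`, so the singular remainder of the kernel enters
linearly. An `L¹` bound on it suffices; exponential moments are needed only for the bounded part. -/
lemma abs_fieldWeight_sub_le {s b : ℝ} (hs : 0 < s) (hb : 0 < b) {ε : ℝ} (hε : 0 < ε) {N : ℕ}
    (a : Space n) (y : Fin N → Space n) {u : ℝ} (hu : 0 ≤ u) :
    ENNReal.ofReal |(fieldWeight s b a y).toReal - Real.exp (-u)| ≤
      ENNReal.ofReal b * ∑ j, (rieszKernel s a (y j) - ENNReal.ofReal (softKernel s ε a (y j))) +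
        ENNReal.ofReal |b * ∑ j, softKernel s ε a (y j) - u| := by
  set R := ∑ j, (rieszKernel s a (y j) - ENNReal.ofReal (softKernel s ε a (y j))) with hR
  rcases eq_or_ne R ⊤ with htop | hfin
  · rw [htop, ENNReal.mul_top (ENNReal.ofReal_pos.2 hb).ne', top_add]; exact le_top
  set T := ∑ j, softKernel s ε a (y j) with hT
  have hT0 : 0 ≤ T := Finset.sum_nonneg fun j _ => (softKernel_pos s hε a (y j)).le
  set r := R.toReal with hr
  have hr0 : 0 ≤ r := ENNReal.toReal_nonneg
  have hsum : ∑ j, rieszKernel s a (y j) = ENNReal.ofReal (T + r) := by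
    rw [ENNReal.ofReal_add hT0 hr0, hr, ENNReal.ofReal_toReal hfin, hT,
      ENNReal.ofReal_sum_of_nonneg fun j _ => (softKernel_pos s hε a (y j)).le, hR,
      ← Finset.sum_add_distrib]
    exact Finset.sum_congr rfl fun j _ =>
      (add_tsub_cancel_of_le (softKernel_le_rieszKernel hs hε a (y j))).symm
  have hfw : (fieldWeight s b a y).toReal = Real.exp (-(b * (T + r))) := by
    rw [fieldWeight, hsum, ← ENNReal.ofReal_mul hb.le, expNeg_ofReal (by positivity),
      ENNReal.toReal_ofReal (Real.exp_pos _).le]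
  rw [hfw, ← ENNReal.ofReal_toReal hfin, ← hr, ← ENNReal.ofReal_mul hb.le,
    ← ENNReal.ofReal_add (by positivity) (abs_nonneg _)]
  refine ENNReal.ofReal_le_ofReal ((abs_exp_neg_sub_exp_neg_le (by positivity) hu).trans ?_)
  have e : b * (T + r) - u = b * r + (b * T - u) := by ring
  rw [e]
  refine (abs_add_le _ _).trans (add_le_add (le_of_eq (abs_of_nonneg (by positivity))) le_rfl)

namespace IsEquilibrium

variable {s γ b : ℝ} {m μ : Measure (Space n)} {C : ℝ≥0∞} {Z B : ℝ}

/-- Quantitative decoupling of one particle from the others. -/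
lemma lintegral_abs_fieldWeight_sub_le (h : IsEquilibrium s γ m μ C Z B) (hb : 0 < b)
    {ε τ : ℝ} (hε : 0 < ε) (hτ0 : 0 < τ)
    (hτm : ∀ x, ∫⁻ y, (rieszKernel s x y - ENNReal.ofReal (softKernel s ε x y)) ∂m ≤
      ENNReal.ofReal τ)
    (hτ : ∀ x, ∫ y, softKernel s ε x y ∂μ ≤ potential s μ x ∧
      potential s μ x ≤ ∫ y, softKernel s ε x y ∂μ + τ)
    {ε' τ' : ℝ} (hε' : 0 < ε') (hτ'0 : 0 < τ')
    (hτ' : ∀ x, potential s μ x ≤ ∫ y, softKernel s ε' x y ∂μ + τ')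
    {t : ℝ} (ht : 0 < t) (htε : t * ε ^ (-(s / 2)) ≤ 1) (N : ℕ) (a : Space n) :
    ∫⁻ y, ENNReal.ofReal |(fieldWeight s b a y).toReal - Real.exp (-(γ * potential s μ a))|
        ∂(configMeasure s b m N) ≤
      ENNReal.ofReal (b * N * (Real.exp (b * N * B) / Z * τ) +
        (b * N * ((2 * |b * N - γ| * B + b * N * τ' + b * ε' ^ (-(s / 2)) / 2) / t +
          (ε ^ (-(s / 2))) ^ 2 * t) + 2 * b / t + |b * N - γ| * B + γ * τ)) := by
  have := h.isProbabilityMeasure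
  have := h.isFiniteMeasure
  have hP := isProbabilityMeasure_configMeasure (h.configZ_ne_zero hb.le N)
  have hs := h.s_pos
  have hZ := h.Z_pos
  have hB := h.B_nonneg
  have hγ := h.γ_nonneg
  set P := configMeasure s b m N with hPdef
  set β := ε ^ (-(s / 2)) with hβ
  have hβ0 : 0 < β := Real.rpow_pos_of_pos hε _
  have hβ' : 0 < ε' ^ (-(s / 2)) := Real.rpow_pos_of_pos hε' _
  set κ := 2 * |b * N - γ| * B + b * N * τ' + b * ε' ^ (-(s / 2)) / 2 with hκ
  have hκ0 : 0 ≤ κ := by positivity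
  set Uε := ∫ y, softKernel s ε a y ∂μ with hUε
  set U := potential s μ a with hU
  have hU0 : 0 ≤ U := potential_nonneg s μ a
  have hUε0 : 0 ≤ Uε := integral_nonneg fun y => (softKernel_pos s hε a y).le
  set f : Space n → ℝ := fun y => softKernel s ε a y - Uε with hf
  have hfm : Measurable f := by simp only [hf]; fun_prop
  have hUεβ : Uε ≤ β := by
    have := integral_mono (integrable_softKernel hs hε μ a) (integrable_const β)
      (fun y => softKernel_le hs hε a y)
    simpa using this
  have hfβ : ∀ y, |f y| ≤ β := fun y => by
    rw [abs_le]
    have h1 := softKernel_pos s hε a y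
    have h2 := softKernel_le hs hε a y
    constructor <;> simp only [hf] <;> linarith
  have hf0 : ∫ y, f y ∂μ = 0 := by
    simp only [hf]
    rw [integral_sub (integrable_softKernel hs hε μ a) (integrable_const _)]
    simp [hUε]
  -- Two regularization scales are in play: `ε` for the kernel seen by the test particle, and `ε'`
  -- for the domination by the product measure.
  have hsum := lintegral_abs_sum_le μ hfm hfβ hf0 ht htε hκ0 (h.configMeasure_le hb hε' hτ' N)
  have hRm : Measurable fun y : Fin N → Space n =>
      ∑ j, (rieszKernel s a (y j) - ENNReal.ofReal (softKernel s ε a (y j))) :=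
    Finset.measurable_sum _ fun j _ => by fun_prop
  have hR : ENNReal.ofReal b * ∫⁻ y, ∑ j, (rieszKernel s a (y j) -
      ENNReal.ofReal (softKernel s ε a (y j))) ∂P ≤
      ENNReal.ofReal (b * N * (Real.exp (b * N * B) / Z * τ)) := by
    rw [lintegral_finsetSum _ (fun j _ => by fun_prop), mul_assoc, ENNReal.ofReal_mul hb.le]
    gcongr
    calc _ ≤ ∑ _j : Fin N, ENNReal.ofReal (Real.exp (b * N * B) / Z) * ENNReal.ofReal τ := by
          refine Finset.sum_le_sum fun j _ => ?_
          refine (h.lintegral_eval_configMeasure_le hb.le j (f := fun z => rieszKernel s a z -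
            ENNReal.ofReal (softKernel s ε a z)) (by fun_prop)).trans ?_
          gcongr
          exact hτm a
      _ = _ := by
          rw [← ENNReal.ofReal_mul (by positivity), Finset.sum_const, Finset.card_univ,
            Fintype.card_fin, nsmul_eq_mul, ENNReal.ofReal_mul (p := (N : ℝ)) (by positivity),
            ENNReal.ofReal_natCast]
  have hpt : ∀ y : Fin N → Space n, |b * ∑ j, softKernel s ε a (y j) - γ * U| ≤
      b * |∑ j, f (y j)| + (|b * N - γ| * B + γ * τ) := by
    intro y
    -- Fluctuation of the empirical field, mismatch of the coupling, and regularization bias,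
    -- respectively.
    have e1 : b * ∑ j, softKernel s ε a (y j) - γ * U =
        b * ∑ j, f (y j) + ((b * N - γ) * Uε + γ * (Uε - U)) := by
      simp only [hf, Finset.sum_sub_distrib, Finset.sum_const, Finset.card_univ, Fintype.card_fin,
        nsmul_eq_mul]
      ring
    rw [e1]
    refine (abs_add_le _ _).trans (add_le_add (le_of_eq ?_) ((abs_add_le _ _).trans
      (add_le_add ?_ ?_)))
    · rw [abs_mul, abs_of_pos hb]
    · rw [abs_mul, abs_of_nonneg hUε0]
      gcongr
      exact (hτ a).1.trans (h.potential_le a)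
    · rw [abs_mul, abs_of_nonneg hγ]
      gcongr
      rw [abs_le]
      constructor <;> linarith [hτ a]
  have hsm : Measurable fun y : Fin N → Space n => ∑ j, f (y j) :=
    Finset.measurable_sum _ fun j _ => by fun_prop
  calc _ ≤ ∫⁻ y, (ENNReal.ofReal b * ∑ j, (rieszKernel s a (y j) -
          ENNReal.ofReal (softKernel s ε a (y j))) + (ENNReal.ofReal b *
            ENNReal.ofReal |∑ j, f (y j)| + ENNReal.ofReal (|b * N - γ| * B + γ * τ))) ∂P := by
        refine lintegral_mono fun y => (abs_fieldWeight_sub_le hs hb hε a y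
          (mul_nonneg hγ hU0)).trans ?_
        gcongr
        rw [← ENNReal.ofReal_mul hb.le, ← ENNReal.ofReal_add (by positivity) (by positivity)]
        exact ENNReal.ofReal_le_ofReal (hpt y)
    _ ≤ ENNReal.ofReal (b * N * (Real.exp (b * N * B) / Z * τ)) + (ENNReal.ofReal b *
          ENNReal.ofReal ((N * (κ + β ^ 2 * t ^ 2) + 2) / t) +
            ENNReal.ofReal (|b * N - γ| * B + γ * τ)) := by
        rw [lintegral_add_left (by fun_prop), lintegral_add_left (by fun_prop),
          lintegral_const_mul _ hRm, lintegral_const_mul _ (by fun_prop)]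
        simp only [lintegral_const, measure_univ, mul_one]
        gcongr
    _ = _ := by
        rw [← ENNReal.ofReal_mul hb.le, ← ENNReal.ofReal_add (by positivity) (by positivity),
          ← ENNReal.ofReal_add (by positivity) (by positivity)]
        congr 1
        field_simp
        ring

/-- Asymptotically, a test particle feels only the mean field, uniformly in its position. -/
lemma eventually_fieldWeight (h : IsEquilibrium s γ m μ C Z B) {β : ℕ → ℝ} (hβ : ∀ N, 0 < β N)
    (hlim : Tendsto (fun N : ℕ => (N : ℝ) * β N) atTop (𝓝 γ)) {η : ℝ} (hη : 0 < η) :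
    ∀ᶠ N in atTop, ∀ a, ∫⁻ y, ENNReal.ofReal
      |(fieldWeight s (β N) a y).toReal - Real.exp (-(γ * potential s μ a))|
        ∂(configMeasure s (β N) m N) ≤ ENNReal.ofReal η := by
  have := h.isProbabilityMeasure
  have hZ := h.Z_pos
  have hγ := h.γ_nonneg
  have hlim' : Tendsto (fun N : ℕ => β N * N) atTop (𝓝 γ) := by simpa only [mul_comm] using hlim
  have hβ0 : Tendsto β atTop (𝓝 0) := by
    have h1 := hlim.mul (tendsto_inv_atTop_nhds_zero_nat (𝕜 := ℝ))
    rw [mul_zero] at h1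
    refine h1.congr' ?_
    filter_upwards [eventually_gt_atTop 0] with N hN
    have : (N : ℝ) ≠ 0 := by exact_mod_cast hN.ne'
    field_simp
  -- The order of choice is `ε`, then `t`, then `ε'`, then `N`. The first makes `K τ ≤ η/4`, the
  -- second `γ q² t ≤ η/4`, the third `γ² τ' / t ≤ η/4`. The limiting bound is thus at most `3η/4`.
  set K := γ * (Real.exp (γ * B) / Z) + γ with hK
  have hK0 : 0 ≤ K := by positivity
  obtain ⟨ε, hε, hεm, hεμ⟩ := exists_integral_softKernel_approx h.s_pos h.s_lt h.C_ne_top h.μ_le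
    h.μ_univ_le (τ := η / (4 * (K + 1))) (by positivity)
  set τ := η / (4 * (K + 1)) with hτ
  have hτ0 : 0 < τ := by positivity
  set q := ε ^ (-(s / 2)) with hq
  have hq0 : 0 < q := Real.rpow_pos_of_pos hε _
  obtain ⟨t, ht, htq, htη⟩ : ∃ t : ℝ, 0 < t ∧ t * q ≤ 1 ∧ γ * (q ^ 2 * t) ≤ η / 4 := by
    refine ⟨min (1 / q) (η / (4 * (γ * q ^ 2 + 1))), by positivity, ?_, ?_⟩
    · calc _ ≤ 1 / q * q := by gcongr; exact min_le_left _ _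
        _ = 1 := by field_simp
    · calc γ * (q ^ 2 * min (1 / q) (η / (4 * (γ * q ^ 2 + 1))))
          ≤ γ * (q ^ 2 * (η / (4 * (γ * q ^ 2 + 1)))) := by gcongr; exact min_le_right _ _
        _ = η / 4 * (γ * q ^ 2 / (γ * q ^ 2 + 1)) := by field_simp
        _ ≤ η / 4 * 1 := by
            gcongr
            rw [div_le_one (by positivity)]; linarith
        _ = _ := mul_one _
  obtain ⟨ε', hε', -, hεμ'⟩ := exists_integral_softKernel_approx h.s_pos h.s_lt h.C_ne_top h.μ_le
    h.μ_univ_le (τ := η * t / (4 * (γ ^ 2 + 1))) (by positivity)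
  set τ' := η * t / (4 * (γ ^ 2 + 1)) with hτ'
  have hτ'0 : 0 < τ' := by positivity
  have hT : Tendsto (fun N : ℕ => β N * N * (Real.exp (β N * N * B) / Z * τ) +
        (β N * N * ((2 * |β N * N - γ| * B + β N * N * τ' + β N * ε' ^ (-(s / 2)) / 2) / t +
          q ^ 2 * t) + 2 * β N / t + |β N * N - γ| * B + γ * τ)) atTop
      (𝓝 (γ * (Real.exp (γ * B) / Z * τ) +
        (γ * ((2 * |γ - γ| * B + γ * τ' + 0 * ε' ^ (-(s / 2)) / 2) / t +
          q ^ 2 * t) + 2 * 0 / t + |γ - γ| * B + γ * τ))) := by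
    have habs : Tendsto (fun N : ℕ => |β N * N - γ|) atTop (𝓝 |γ - γ|) :=
      (hlim'.sub tendsto_const_nhds).abs
    refine Tendsto.add ?_ (((Tendsto.add ?_ ?_).add (habs.mul_const B)).add tendsto_const_nhds)
    · exact hlim'.mul (((((Real.continuous_exp.tendsto _).comp (hlim'.mul_const B))).div_const
        Z).mul_const τ)
    · exact hlim'.mul ((((((habs.const_mul 2).mul_const B).add (hlim'.mul_const τ')).add
        ((hβ0.mul_const _).div_const 2)).div_const t).add_const _)
    · exact (hβ0.const_mul 2).div_const t
  have hlt : γ * (Real.exp (γ * B) / Z * τ) +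
        (γ * ((2 * |γ - γ| * B + γ * τ' + 0 * ε' ^ (-(s / 2)) / 2) / t +
          q ^ 2 * t) + 2 * 0 / t + |γ - γ| * B + γ * τ) < η := by
    have e1 : γ * (Real.exp (γ * B) / Z * τ) + γ * τ ≤ η / 4 := by
      calc _ = η / 4 * (K / (K + 1)) := by rw [hτ, hK]; field_simp
        _ ≤ η / 4 * 1 := by
            gcongr
            rw [div_le_one (by positivity)]; linarith
        _ = _ := mul_one _
    have e2 : γ * (γ * τ' / t) ≤ η / 4 := by
      calc _ = η / 4 * (γ ^ 2 / (γ ^ 2 + 1)) := by rw [hτ']; field_simp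
        _ ≤ η / 4 * 1 := by
            gcongr
            rw [div_le_one (by positivity)]; linarith
        _ = _ := mul_one _
    simp only [sub_self, abs_zero, mul_zero, zero_mul, zero_add, zero_div, add_zero]
    rw [mul_add]
    linarith
  filter_upwards [hT.eventually (gt_mem_nhds hlt)] with N hN a
  refine (h.lintegral_abs_fieldWeight_sub_le (hβ N) hε hτ0 (hεm m h.m_le h.m_univ_le) hεμ hε' hτ'0
    (fun x => (hεμ' x).2) ht htq N a).trans (ENNReal.ofReal_le_ofReal hN.le)

end IsEquilibrium

end RieszGas

namespace RieszGas

variable {n : ℕ}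

/-! ### The Laplace functional -/

/-- With the integrating factor `e^{cθ}` the derivative is at most `e^c δ` on `[0, 1]`, and this
`e^c` is cancelled on returning to `f 1`. -/
lemma abs_sub_exp_neg_le {f f' : ℝ → ℝ} {c δ : ℝ} (hc : 0 ≤ c)
    (hf : ∀ θ, HasDerivAt f (f' θ) θ) (h0 : f 0 = 1)
    (hδ : ∀ θ ∈ Set.Icc (0 : ℝ) 1, |f' θ + c * f θ| ≤ δ) : |f 1 - Real.exp (-c)| ≤ δ := by
  have hG : ∀ θ, HasDerivAt (fun θ => Real.exp (c * θ) * f θ)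
      (Real.exp (c * θ) * (f' θ + c * f θ)) θ := by
    intro θ
    have h1 : HasDerivAt (fun θ : ℝ => Real.exp (c * θ)) (Real.exp (c * θ) * c) θ := by
      simpa using ((hasDerivAt_id θ).const_mul c).exp
    exact (h1.mul (hf θ)).congr_deriv (by ring)
  have hb := (convex_Icc (0 : ℝ) 1).norm_image_sub_le_of_norm_hasDerivWithin_le
    (C := Real.exp c * δ) (fun θ _ => (hG θ).hasDerivWithinAt) (fun θ hθ => by
      rw [norm_mul, Real.norm_of_nonneg (Real.exp_pos _).le]
      refine mul_le_mul (Real.exp_le_exp.2 ?_) (hδ θ hθ) (norm_nonneg _) (Real.exp_pos _).le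
      nlinarith [hθ.2]) (Set.left_mem_Icc.2 zero_le_one) (Set.right_mem_Icc.2 zero_le_one)
  simp only [mul_one, mul_zero, Real.exp_zero, h0, sub_zero, norm_one, Real.norm_eq_abs] at hb
  have e : f 1 - Real.exp (-c) = Real.exp (-c) * (Real.exp c * f 1 - 1) := by
    rw [mul_sub, ← mul_assoc, ← Real.exp_add]; simp
  rw [e, abs_mul, abs_of_pos (Real.exp_pos _)]
  calc _ ≤ Real.exp (-c) * (Real.exp c * δ) := by gcongr
    _ = δ := by rw [← mul_assoc, ← Real.exp_add]; simp

/-- Each term of the derivative singles out one particle, which can then be integrated out. As `N`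
is fixed, a crude bound on the products suffices for domination. -/
lemma hasDerivAt_integral_prod {X : Type*} [MeasurableSpace X] {N : ℕ} (P : Measure (Fin N → X))
    [IsProbabilityMeasure P] {φ : X → ℝ} (hφ : Measurable φ) (h0 : ∀ x, 0 ≤ φ x)
    (h1 : ∀ x, φ x ≤ 1) (θ₀ : ℝ) :
    HasDerivAt (fun θ => ∫ x, ∏ j, (1 - θ * φ (x j)) ∂P)
      (∫ x, ∑ i, (∏ j ∈ Finset.univ.erase i, (1 - θ₀ * φ (x j))) * (-φ (x i)) ∂P) θ₀ := by
  have hm : ∀ θ : ℝ, ∀ S : Finset (Fin N), Measurable fun x : Fin N → X =>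
      ∏ j ∈ S, (1 - θ * φ (x j)) := fun θ S => Finset.measurable_prod _ fun j _ => by fun_prop
  have habs : ∀ θ ∈ Metric.ball θ₀ 1, ∀ x, |1 - θ * φ x| ≤ |θ₀| + 2 := by
    intro θ hθ x
    rw [Metric.mem_ball, Real.dist_eq] at hθ
    have a1 : |θ| ≤ |θ₀| + 1 := by
      have := abs_sub_abs_le_abs_sub θ θ₀
      linarith
    calc |1 - θ * φ x| ≤ |1| + |θ * φ x| := abs_sub _ _
      _ ≤ 1 + |θ| * 1 := by
          rw [abs_one, abs_mul, abs_of_nonneg (h0 x)]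
          gcongr
          exact h1 x
      _ ≤ _ := by linarith
  have hprod : ∀ θ ∈ Metric.ball θ₀ 1, ∀ (S : Finset (Fin N)) (x : Fin N → X),
      |∏ j ∈ S, (1 - θ * φ (x j))| ≤ (|θ₀| + 2) ^ N := by
    intro θ hθ S x
    rw [Finset.abs_prod]
    calc _ ≤ ∏ _j ∈ S, (|θ₀| + 2) :=
          Finset.prod_le_prod (fun j _ => abs_nonneg _) fun j _ => habs θ hθ _
      _ = (|θ₀| + 2) ^ S.card := by rw [Finset.prod_const]
      _ ≤ _ := pow_le_pow_right₀ (by linarith [abs_nonneg θ₀]) (by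
          simpa using Finset.card_le_univ S)
  refine (hasDerivAt_integral_of_dominated_loc_of_deriv_le (μ := P)
    (F := fun θ x => ∏ j, (1 - θ * φ (x j)))
    (F' := fun θ x => ∑ i, (∏ j ∈ Finset.univ.erase i, (1 - θ * φ (x j))) * (-φ (x i)))
    (bound := fun _ => N * (|θ₀| + 2) ^ N) (Metric.ball_mem_nhds θ₀ one_pos)
    (Eventually.of_forall fun θ => (hm θ _).aestronglyMeasurable) ?_ ?_ ?_ (integrable_const _) ?_).2
  · exact Integrable.of_bound (hm θ₀ _).aestronglyMeasurable _
      (ae_of_all _ fun x => hprod θ₀ (Metric.mem_ball_self one_pos) _ x)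
  · refine Measurable.aestronglyMeasurable (Finset.measurable_sum _ fun i _ => ?_)
    have := hm θ₀ (Finset.univ.erase i)
    fun_prop
  · refine ae_of_all _ fun x θ hθ => ?_
    rw [Real.norm_eq_abs]
    refine (Finset.abs_sum_le_sum_abs _ _).trans ?_
    calc _ ≤ ∑ _i : Fin N, (|θ₀| + 2) ^ N := by
          refine Finset.sum_le_sum fun i _ => ?_
          rw [abs_mul, abs_neg, abs_of_nonneg (h0 _)]
          calc _ ≤ (|θ₀| + 2) ^ N * 1 :=
                mul_le_mul (hprod θ hθ _ x) (h1 _) (h0 _) (by positivity)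
            _ = _ := mul_one _
      _ = _ := by simp
  · refine ae_of_all _ fun x θ _ => ?_
    have := HasDerivAt.fun_finsetProd (u := (Finset.univ : Finset (Fin N)))
      (f := fun j θ => 1 - θ * φ (x j)) (f' := fun j => -φ (x j)) (x := θ) (fun j _ => by
        simpa using ((hasDerivAt_id θ).mul_const (φ (x j))).const_sub 1)
    simpa only [smul_eq_mul] using this

section

variable {s b : ℝ} {m : Measure (Space n)} [IsFiniteMeasure m]

/-- Integration of one particle out of `N + 1`, for real-valued functions. -/
lemma integral_configMeasure_succ {N : ℕ} (h0 : configZ s b m N ≠ 0) (i : Fin (N + 1))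
    {F : (Fin (N + 1) → Space n) → ℝ} (hF : Measurable F) {K : ℝ} (hK : ∀ x, |F x| ≤ K) :
    ∫ x, F x ∂(configMeasure s b m (N + 1)) =
      ((configZ s b m (N + 1))⁻¹ * configZ s b m N).toReal *
        ∫ a, ∫ y, (fieldWeight s b a y).toReal * F (i.insertNth a y) ∂(configMeasure s b m N) ∂m := by
  have := isProbabilityMeasure_configMeasure h0
  have hF' : Measurable fun q : Space n × (Fin N → Space n) => F (i.insertNth q.1 q.2) :=
    hF.comp (measurable_insertNth i)
  rw [configMeasure_succ_eq_map h0 i, integral_smul_measure, integral_map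
    (measurable_insertNth i).aemeasurable hF.aestronglyMeasurable,
    integral_withDensity_eq_integral_toReal_smul
      (f := fun q : Space n × (Fin N → Space n) => fieldWeight s b q.1 q.2) (by fun_prop)
      (ae_of_all _ fun q => (expNeg_ne_top _).lt_top), integral_prod, smul_eq_mul]
  · rfl
  · refine Integrable.of_bound (C := 1 * K) (Measurable.aestronglyMeasurable (by fun_prop))
      (ae_of_all _ fun q => ?_)
    rw [norm_smul, Real.norm_of_nonneg ENNReal.toReal_nonneg]
    refine mul_le_mul ?_ (hK _) (norm_nonneg _) zero_le_one
    exact ENNReal.toReal_le_of_le_ofReal zero_le_one (by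
      rw [ENNReal.ofReal_one]; exact expNeg_le_one _)

/-- Uniformity in `a` makes the error proportional to the `L¹` norm of `F`. For `F` of integral of
order `1/N`, the error remains small after multiplication by the number of particles. -/
lemma abs_integral_fieldWeight_sub_le {N : ℕ} {P : Measure (Fin N → Space n)}
    [IsProbabilityMeasure P] {w : Space n → ℝ} (hw : Measurable w) (hw1 : ∀ a, |w a| ≤ 1)
    {η : ℝ} (hη : 0 ≤ η)
    (hkey : ∀ a, ∫⁻ y, ENNReal.ofReal |(fieldWeight s b a y).toReal - w a| ∂P ≤ ENNReal.ofReal η)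
    {F : Space n → ℝ} (hF : Measurable F) {K : ℝ} (hK : ∀ x, |F x| ≤ K)
    {G : (Fin N → Space n) → ℝ} (hG : Measurable G) (hG0 : ∀ y, |G y| ≤ 1) :
    |(∫ a, ∫ y, (fieldWeight s b a y).toReal * (F a * G y) ∂P ∂m) -
      (∫ a, w a * F a ∂m) * ∫ y, G y ∂P| ≤ η * ∫ a, |F a| ∂m := by
  have hfw1 : ∀ (a : Space n) (y : Fin N → Space n), |(fieldWeight s b a y).toReal| ≤ 1 := by
    intro a y
    rw [abs_of_nonneg ENNReal.toReal_nonneg]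
    exact ENNReal.toReal_le_of_le_ofReal zero_le_one (by
      rw [ENNReal.ofReal_one]; exact expNeg_le_one _)
  have hK0 : 0 ≤ K := (abs_nonneg _).trans (hK 0)
  have hi : Integrable (fun q : Space n × (Fin N → Space n) =>
      (fieldWeight s b q.1 q.2).toReal * (F q.1 * G q.2)) (m.prod P) := by
    refine Integrable.of_bound (C := 1 * (K * 1)) (Measurable.aestronglyMeasurable (by fun_prop))
      (ae_of_all _ fun q => ?_)
    rw [Real.norm_eq_abs, abs_mul, abs_mul]
    gcongr
    · exact hfw1 _ _
    · exact hK _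
    · exact hG0 _
  have hwF : Integrable (fun a => w a * F a) m := by
    refine Integrable.of_bound (C := 1 * K) (Measurable.aestronglyMeasurable (by fun_prop))
      (ae_of_all _ fun q => ?_)
    rw [Real.norm_eq_abs, abs_mul]
    gcongr
    · exact hw1 _
    · exact hK _
  have hFi : Integrable (fun a => |F a|) m :=
    (Integrable.of_bound (C := K) hF.aestronglyMeasurable (ae_of_all _ hK)).abs
  rw [← integral_mul_const, ← integral_sub hi.integral_prod_left (hwF.mul_const _),
    ← integral_const_mul]
  refine (abs_integral_le_integral_abs).trans (integral_mono_of_nonneg (ae_of_all _ fun a =>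
    abs_nonneg _) (hFi.const_mul η) (ae_of_all _ fun a => ?_))
  have hdm : Measurable fun y : Fin N → Space n => (fieldWeight s b a y).toReal - w a := by fun_prop
  have hGi : Integrable G P := Integrable.of_bound hG.aestronglyMeasurable 1 (ae_of_all _ hG0)
  have hei : Integrable (fun y => (fieldWeight s b a y).toReal * G y) P := by
    refine Integrable.of_bound (C := 1 * 1) (Measurable.aestronglyMeasurable (by fun_prop))
      (ae_of_all _ fun q => ?_)
    rw [Real.norm_eq_abs, abs_mul]
    gcongr
    · exact hfw1 _ _
    · exact hG0 _
  have hdi : Integrable (fun y => |(fieldWeight s b a y).toReal - w a|) P := by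
    refine Integrable.abs (Integrable.of_bound (C := 1 + 1) hdm.aestronglyMeasurable
      (ae_of_all _ fun y => ?_))
    exact (abs_sub _ _).trans (add_le_add (hfw1 a y) (hw1 a))
  have e : (∫ y, (fieldWeight s b a y).toReal * (F a * G y) ∂P) - w a * F a * ∫ y, G y ∂P =
      F a * ∫ y, ((fieldWeight s b a y).toReal - w a) * G y ∂P := by
    have e1 : ∀ y, (fieldWeight s b a y).toReal * (F a * G y) =
        F a * ((fieldWeight s b a y).toReal * G y) := fun y => by ring
    simp_rw [e1, sub_mul]
    rw [integral_const_mul, integral_sub hei (hGi.const_mul _), integral_const_mul]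
    ring
  simp only
  rw [e, abs_mul, mul_comm]
  gcongr
  refine abs_integral_le_integral_abs.trans ?_
  calc _ ≤ ∫ y, |(fieldWeight s b a y).toReal - w a| ∂P := by
        refine integral_mono_of_nonneg (ae_of_all _ fun y => abs_nonneg _) hdi
          (ae_of_all _ fun y => ?_)
        simp only
        rw [abs_mul]
        exact mul_le_of_le_one_right (abs_nonneg _) (hG0 y)
    _ ≤ η := by
        rw [integral_eq_lintegral_of_nonneg_ae (ae_of_all _ fun y => abs_nonneg _)
          hdm.abs.aestronglyMeasurable]
        exact ENNReal.toReal_le_of_le_ofReal hη (hkey a)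

end

namespace IsEquilibrium

variable {s γ b : ℝ} {m μ : Measure (Space n)} {C : ℝ≥0∞} {Z B : ℝ}

lemma integral_exp_neg_potential (h : IsEquilibrium s γ m μ C Z B) :
    ∫ a, Real.exp (-(γ * potential s μ a)) ∂m = Z := by
  have hU := h.measurable_potential
  have hZ := h.Z_pos
  have hp := h.isProbabilityMeasure
  have h1 : ∫⁻ a, ENNReal.ofReal (Real.exp (-(γ * potential s μ a)) / Z) ∂m = 1 := by
    have e := congrArg (fun ρ : Measure (Space n) => ρ Set.univ) h.eq_withDensity
    simp only [measure_univ, withDensity_apply _ MeasurableSet.univ, Measure.restrict_univ] at e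
    exact e.symm
  have h2 : ∫ a, Real.exp (-(γ * potential s μ a)) / Z ∂m = 1 := by
    rw [integral_eq_lintegral_of_nonneg_ae (ae_of_all _ fun a => by positivity)
      (Measurable.aestronglyMeasurable (by fun_prop)), h1, ENNReal.toReal_one]
  rw [integral_div] at h2
  exact (div_eq_one_iff_eq hZ.ne').1 h2

lemma exp_neg_potential_le (h : IsEquilibrium s γ m μ C Z B) (a : Space n) :
    |Real.exp (-(γ * potential s μ a))| ≤ 1 := by
  rw [abs_of_pos (Real.exp_pos _), Real.exp_le_one_iff, neg_nonpos]
  exact mul_nonneg h.γ_nonneg (potential_nonneg s μ a)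

/-- Removing a particle turns the expectation into `r Y` and its `θ`-derivative into `-(N + 1) r X`,
where `Y ≈ (Z - θ J) D` and `X ≈ J D` with the same `D` over `N` particles. Hence the derivative
plus `α / Z` times the expectation is nearly `r D (α - (N + 1) J)`, and neither `r` nor `D` needs to
be computed. -/
lemma abs_integral_prod_sub_le (h : IsEquilibrium s γ m μ C Z B) (hb : 0 < b) {N : ℕ}
    {φ : Space n → ℝ} (hφ : Measurable φ) (h0 : ∀ x, 0 ≤ φ x) (h1 : ∀ x, φ x ≤ 1)
    {η α : ℝ} (hη : 0 ≤ η) (hα : 0 ≤ α)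
    (hkey : ∀ a, ∫⁻ y, ENNReal.ofReal |(fieldWeight s b a y).toReal -
      Real.exp (-(γ * potential s μ a))| ∂(configMeasure s b m N) ≤ ENNReal.ofReal η) :
    |(∫ x, ∏ j, (1 - φ (x j)) ∂(configMeasure s b m (N + 1))) - Real.exp (-(α / Z))| ≤
      ((configZ s b m (N + 1))⁻¹ * configZ s b m N).toReal *
        (η * ((N + 1) * ∫ a, φ a ∂m) +
        |α - (N + 1) * ∫ a, Real.exp (-(γ * potential s μ a)) * φ a ∂m| +
        α / Z * (η * m.real Set.univ + ∫ a, Real.exp (-(γ * potential s μ a)) * φ a ∂m)) := by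
  have := h.isFiniteMeasure
  have hN := h.configZ_ne_zero hb.le N
  have := isProbabilityMeasure_configMeasure hN
  have := isProbabilityMeasure_configMeasure (h.configZ_ne_zero hb.le (N + 1))
  have hU := h.measurable_potential
  have hZ := h.Z_pos
  have hwm : Measurable fun a => Real.exp (-(γ * potential s μ a)) := by fun_prop
  have hw1 := h.exp_neg_potential_le
  set w : Space n → ℝ := fun a => Real.exp (-(γ * potential s μ a)) with hw
  set r := ((configZ s b m (N + 1))⁻¹ * configZ s b m N).toReal with hr
  have hr0 : 0 ≤ r := ENNReal.toReal_nonneg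
  set J := ∫ a, w a * φ a ∂m with hJ
  have hJ0 : 0 ≤ J := integral_nonneg fun a => mul_nonneg (Real.exp_pos _).le (h0 a)
  have hd := hasDerivAt_integral_prod (configMeasure s b m (N + 1)) hφ h0 h1
  have hwi : Integrable w m :=
    Integrable.of_bound hwm.aestronglyMeasurable 1 (ae_of_all _ hw1)
  have hwφ : Integrable (fun a => w a * φ a) m := by
    refine Integrable.of_bound (C := 1) (hwm.mul hφ).aestronglyMeasurable (ae_of_all _ fun a => ?_)
    rw [Real.norm_eq_abs, abs_mul, abs_of_nonneg (h0 a)]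
    exact mul_le_one₀ (hw1 a) (h0 a) (h1 a)
  have key := abs_sub_exp_neg_le (c := α / Z) (by positivity) hd (by simp) (δ := r *
        (η * ((N + 1) * ∫ a, φ a ∂m) + |α - (N + 1) * J| +
        α / Z * (η * m.real Set.univ + J))) (fun θ hθ => ?_)
  · simpa only [one_mul] using key
  have hf0 : ∀ x, 0 ≤ 1 - θ * φ x := fun x => by nlinarith [hθ.1, hθ.2, h0 x, h1 x]
  have hf1 : ∀ x, 1 - θ * φ x ≤ 1 := fun x => by nlinarith [hθ.1, hθ.2, h0 x, h1 x]
  have habs : ∀ x, |1 - θ * φ x| ≤ 1 := fun x => by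
    rw [abs_of_nonneg (hf0 x)]; exact hf1 x
  have hGp : ∀ {k : ℕ} (S : Finset (Fin k)) (y : Fin k → Space n),
      |∏ j ∈ S, (1 - θ * φ (y j))| ≤ 1 := fun S y => by
    rw [Finset.abs_prod]
    exact Finset.prod_le_one (fun j _ => abs_nonneg _) fun j _ => habs _
  have hGm : ∀ {k : ℕ} (S : Finset (Fin k)), Measurable fun y : Fin k → Space n =>
      ∏ j ∈ S, (1 - θ * φ (y j)) := fun S => Finset.measurable_prod _ fun j _ => by fun_prop
  set D := ∫ y, ∏ j, (1 - θ * φ (y j)) ∂(configMeasure s b m N) with hD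
  have hD1 : |D| ≤ 1 := by
    have := norm_integral_le_of_norm_le_const (μ := configMeasure s b m N)
      (f := fun y => ∏ j, (1 - θ * φ (y j))) (C := 1) (ae_of_all _ fun y => hGp _ y)
    simpa using this
  set X := ∫ a, ∫ y, (fieldWeight s b a y).toReal * (φ a * ∏ j, (1 - θ * φ (y j)))
    ∂(configMeasure s b m N) ∂m with hX
  set Y := ∫ a, ∫ y, (fieldWeight s b a y).toReal * ((1 - θ * φ a) * ∏ j, (1 - θ * φ (y j)))
    ∂(configMeasure s b m N) ∂m with hY
  have hXle : |X - J * D| ≤ η * ∫ a, φ a ∂m := by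
    have := abs_integral_fieldWeight_sub_le (m := m) hwm hw1 hη hkey hφ (K := 1)
      (fun x => by rw [abs_of_nonneg (h0 x)]; exact h1 x) (hGm Finset.univ) (hGp Finset.univ)
    simpa only [abs_of_nonneg (h0 _)] using this
  have hYle : |Y - (Z - θ * J) * D| ≤ η * m.real Set.univ := by
    have := abs_integral_fieldWeight_sub_le (m := m) hwm hw1 hη hkey
      (F := fun a => 1 - θ * φ a) (by fun_prop) (K := 1) habs (hGm Finset.univ) (hGp Finset.univ)
    have e : ∫ a, w a * (1 - θ * φ a) ∂m = Z - θ * J := by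
      have e1 : ∀ a, w a * (1 - θ * φ a) = w a - θ * (w a * φ a) := fun a => by ring
      simp_rw [e1]
      rw [integral_sub hwi (hwφ.const_mul θ), integral_const_mul,
        show ∫ a, w a ∂m = Z from h.integral_exp_neg_potential]
    rw [e] at this
    refine this.trans (mul_le_mul_of_nonneg_left ?_ hη)
    calc ∫ a, |1 - θ * φ a| ∂m ≤ ∫ _a, (1 : ℝ) ∂m :=
          integral_mono_of_nonneg (ae_of_all _ fun a => abs_nonneg _) (integrable_const _)
            (ae_of_all _ habs)
      _ = _ := by simp
  have eD : ∫ x, ∏ j, (1 - θ * φ (x j)) ∂(configMeasure s b m (N + 1)) = r * Y := by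
    rw [integral_configMeasure_succ hN 0 (hGm Finset.univ) (hGp Finset.univ)]
    simp only [Fin.prod_univ_succAbove _ 0, Fin.insertNth_apply_same,
      Fin.insertNth_apply_succAbove]
    rfl
  have hdb : ∀ (i : Fin (N + 1)) (x : Fin (N + 1) → Space n),
      |(∏ j ∈ Finset.univ.erase i, (1 - θ * φ (x j))) * (-φ (x i))| ≤ 1 := fun i x => by
    rw [abs_mul, abs_neg, abs_of_nonneg (h0 _)]
    exact mul_le_one₀ (hGp _ _) (h0 _) (h1 _)
  have hdm : ∀ i : Fin (N + 1), Measurable fun x : Fin (N + 1) → Space n =>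
      (∏ j ∈ Finset.univ.erase i, (1 - θ * φ (x j))) * (-φ (x i)) := fun i => by
    have := hGm (Finset.univ.erase i)
    fun_prop
  have eD' : ∫ x, ∑ i, (∏ j ∈ Finset.univ.erase i, (1 - θ * φ (x j))) * (-φ (x i))
      ∂(configMeasure s b m (N + 1)) = -((N + 1) * (r * X)) := by
    rw [integral_finsetSum _ fun i _ => Integrable.of_bound (hdm i).aestronglyMeasurable 1
      (ae_of_all _ (hdb i))]
    have : ∀ i : Fin (N + 1), ∫ x, (∏ j ∈ Finset.univ.erase i, (1 - θ * φ (x j))) * (-φ (x i))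
      ∂(configMeasure s b m (N + 1)) = -(r * X) := by
      intro i
      rw [integral_configMeasure_succ hN i (hdm i) (hdb i), ← mul_neg]
      congr 1
      rw [hX, ← integral_neg]
      refine integral_congr_ae (ae_of_all _ fun a => ?_)
      simp only
      rw [← integral_neg]
      refine integral_congr_ae (ae_of_all _ fun y => ?_)
      have e2 : ∏ j ∈ Finset.univ.erase i, (1 - θ * φ ((i.insertNth a y : Fin (N + 1) → Space n) j))
          = ∏ j, (1 - θ * φ (y j)) := by
        rw [← Finset.compl_singleton, ← Fin.image_succAbove_univ, Finset.prod_image fun _ _ _ _ h =>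
          Fin.succAbove_right_injective h]
        simp only [Fin.insertNth_apply_succAbove]
      simp only [e2, Fin.insertNth_apply_same]
      ring
    simp_rw [this]
    simp
  rw [eD, eD']
  -- The combination `α / Z * (Z - θ J) D` leaves `α D`, which pairs with `(N + 1) J D`; all other
  -- terms are errors.
  have e3 : -((N + 1) * (r * X)) + α / Z * (r * Y) = r * (-((N + 1) * (X - J * D)) +
      D * (α - (N + 1) * J) + α / Z * ((Y - (Z - θ * J) * D) - D * (θ * J))) := by
    field_simp
    ring
  rw [e3, abs_mul, abs_of_nonneg hr0]
  refine mul_le_mul_of_nonneg_left ?_ hr0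
  refine (abs_add_three _ _ _).trans (add_le_add (add_le_add ?_ ?_) ?_)
  · rw [abs_neg, abs_mul, abs_of_nonneg (by positivity : (0 : ℝ) ≤ N + 1)]
    calc _ ≤ ((N : ℝ) + 1) * (η * ∫ a, φ a ∂m) := by gcongr
      _ = _ := by ring
  · rw [abs_mul]
    exact mul_le_of_le_one_left (abs_nonneg _) hD1
  · rw [abs_mul, abs_of_nonneg (by positivity : 0 ≤ α / Z)]
    refine mul_le_mul_of_nonneg_left ((abs_sub _ _).trans (add_le_add hYle ?_)) (by positivity)
    rw [abs_mul, abs_mul, abs_of_nonneg hθ.1, abs_of_nonneg hJ0]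
    calc _ ≤ 1 * (1 * J) := by
          have := hθ.1
          gcongr
          exact hθ.2
      _ = J := by ring

/-- The differential inequality holds with an error that vanishes because the field estimate is
uniform, `N ∫ φ_N dm` is bounded, and `J` tends to zero. -/
theorem tendsto_integral_prod (h : IsEquilibrium s γ m μ C Z B) {β : ℕ → ℝ} (hβ : ∀ N, 0 < β N)
    (hlim : Tendsto (fun N : ℕ => (N : ℝ) * β N) atTop (𝓝 γ)) {φ : ℕ → Space n → ℝ}
    (hφ : ∀ N, Measurable (φ N)) (h0 : ∀ N x, 0 ≤ φ N x) (h1 : ∀ N x, φ N x ≤ 1) {A α : ℝ}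
    (hA : ∀ N : ℕ, N * ∫ a, φ N a ∂m ≤ A) (hα : 0 ≤ α)
    (hφα : Tendsto (fun N : ℕ => N * ∫ a, Real.exp (-(γ * potential s μ a)) * φ N a ∂m) atTop
      (𝓝 α)) :
    Tendsto (fun N => ∫ x, ∏ j, (1 - φ N (x j)) ∂(configMeasure s (β N) m N)) atTop
      (𝓝 (Real.exp (-(α / Z)))) := by
  have := h.isFiniteMeasure
  have hZ := h.Z_pos
  have hB := h.B_nonneg
  rw [← tendsto_add_atTop_iff_nat 1]
  have hβ0 : Tendsto (fun N : ℕ => β (N + 1)) atTop (𝓝 0) := by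
    have := (tendsto_add_atTop_iff_nat 1).2 (hlim.mul
      (tendsto_inv_atTop_zero.comp (tendsto_natCast_atTop_atTop (R := ℝ))))
    rw [mul_zero] at this
    refine this.congr fun N => ?_
    have : ((N + 1 : ℕ) : ℝ) ≠ 0 := by positivity
    simp only [Function.comp]
    field_simp
  -- After the removal, `N` particles remain at the parameter `β (N + 1)`; their coupling still
  -- tends to `γ`.
  have hlim' : Tendsto (fun N : ℕ => (N : ℝ) * β (N + 1)) atTop (𝓝 γ) := by
    have := ((tendsto_add_atTop_iff_nat 1).2 hlim).sub hβ0
    rw [sub_zero] at this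
    refine this.congr fun N => ?_
    push_cast
    ring
  have hφα' := (tendsto_add_atTop_iff_nat 1).2 hφα
  set J : ℕ → ℝ := fun N => ∫ a, Real.exp (-(γ * potential s μ a)) * φ N a ∂m with hJ
  have hJ0 : Tendsto (fun N : ℕ => J (N + 1)) atTop (𝓝 0) := by
    have := (tendsto_add_atTop_iff_nat 1).2 (hφα.mul
      (tendsto_inv_atTop_zero.comp (tendsto_natCast_atTop_atTop (R := ℝ))))
    rw [mul_zero] at this
    refine this.congr fun N => ?_
    have : ((N + 1 : ℕ) : ℝ) ≠ 0 := by positivity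
    simp only [Function.comp]
    field_simp
    rfl
  set R := Real.exp ((γ + 1) * B) / Z with hR
  have hR0 : 0 < R := by positivity
  set M := m.real Set.univ
  have hM : 0 ≤ M := measureReal_nonneg
  have hA0 : 0 ≤ A := by simpa using hA 0
  rw [Metric.tendsto_nhds]
  intro ε hε
  set η := ε / (2 * (R * (A + α / Z * M) + 1)) with hη
  have hden : 0 < 2 * (R * (A + α / Z * M) + 1) := by positivity
  have hη0 : 0 < η := by positivity
  have hηε : R * (A + α / Z * M) * η < ε / 2 := by
    have e : (R * (A + α / Z * M) + 1) * η = ε / 2 := by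
      rw [hη]; field_simp
    nlinarith
  have hrest : Tendsto (fun N : ℕ => R * (|α - ((N + 1 : ℕ) : ℝ) * J (N + 1)| +
      α / Z * J (N + 1))) atTop (𝓝 0) := by
    have := (((tendsto_const_nhds (x := α)).sub hφα').abs.add (hJ0.const_mul (α / Z))).const_mul R
    simpa using this
  filter_upwards [h.eventually_fieldWeight (fun N => hβ (N + 1)) hlim' hη0,
    hlim'.eventually (gt_mem_nhds (lt_add_one γ)),
    hrest.eventually (gt_mem_nhds (half_pos hε))] with N hN hγN hr
  have hbd := h.abs_integral_prod_sub_le (hβ (N + 1)) (hφ (N + 1)) (h0 _) (h1 _) hη0.le hα hN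
  rw [Real.dist_eq]
  refine hbd.trans_lt ?_
  have hrR : ((configZ s (β (N + 1)) m (N + 1))⁻¹ * configZ s (β (N + 1)) m N).toReal ≤ R := by
    refine ENNReal.toReal_le_of_le_ofReal hR0.le
      ((h.inv_configZ_mul_le (hβ _).le N).trans (ENNReal.ofReal_le_ofReal ?_))
    rw [hR]
    gcongr
    linarith
  have hJN : 0 ≤ J (N + 1) := integral_nonneg fun a => mul_nonneg (Real.exp_pos _).le (h0 _ a)
  have hI := hA (N + 1)
  push_cast at hI hr
  calc _ ≤ R * (η * A + |α - (N + 1) * J (N + 1)| + α / Z * (η * M + J (N + 1))) := by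
        have : 0 ≤ ∫ a, φ (N + 1) a ∂m := integral_nonneg (h0 _)
        gcongr
    _ = R * (A + α / Z * M) * η + R * (|α - (N + 1) * J (N + 1)| + α / Z * J (N + 1)) := by ring
    _ < ε := by linarith

end IsEquilibrium

end RieszGas

namespace RieszGas

variable {n : ℕ}

/-! ### Poisson point processes -/

open ProbabilityTheory in
lemma lintegral_pow_poissonMeasure (r : ℝ≥0) {L : ℝ≥0∞} (hL : L ≤ 1) :
    ∫⁻ k, L ^ k ∂(poissonMeasure r) = expNeg (r * (1 - L)) := by
  lift L to ℝ≥0 using (hL.trans_lt ENNReal.one_lt_top).ne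
  have hL1 : L ≤ 1 := by exact_mod_cast hL
  rw [lintegral_countable']
  have hs : HasSum (fun k : ℕ => Real.exp (-r) * ((r * L : ℝ) ^ k / k.factorial))
      (Real.exp (-r) * Real.exp (r * L)) := by
    rw [Real.exp_eq_exp_ℝ]
    exact (NormedSpace.expSeries_div_hasSum_exp (r * L : ℝ)).mul_left _
  have e : ∀ k : ℕ, (L : ℝ≥0∞) ^ k * poissonMeasure r {k} =
      ENNReal.ofReal (Real.exp (-r) * ((r * L : ℝ) ^ k / k.factorial)) := by
    intro k
    rw [poissonMeasure_singleton, ← ENNReal.ofReal_coe_nnreal,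
      ← ENNReal.ofReal_pow L.coe_nonneg, ← ENNReal.ofReal_mul (by positivity), mul_pow]
    congr 1
    ring
  simp_rw [e]
  rw [← ENNReal.ofReal_tsum_of_nonneg (fun k => by positivity) hs.summable, hs.tsum_eq,
    ← ENNReal.coe_one, ← ENNReal.coe_sub, ← ENNReal.coe_mul, expNeg_coe, ← Real.exp_add]
  congr 2
  rw [NNReal.coe_mul, NNReal.coe_sub hL1]
  push_cast
  ring

section PoissonSum

variable {X : Type*} [MeasurableSpace X]

/-- For each `k` the number of points of the `k`-th kind is `ω.1 k`, and these points are
`ω.2 ⟨k, j⟩` for `j < ω.1 k`. -/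
noncomputable def markedSum (ω : (ℕ → ℕ) × ((_ : ℕ) × ℕ → X)) : Measure X :=
  Measure.sum fun i : (_ : ℕ) × ℕ => if i.2 < ω.1 i.1 then Measure.dirac (ω.2 i) else 0

/-- Independent numbers of points with Poisson distributions `lam k`, and independent points
of the `k`-th kind with distribution `ν k`. -/
noncomputable def markedLaw (lam : ℕ → ℝ≥0) (ν : ℕ → Measure X)
    [∀ k, IsProbabilityMeasure (ν k)] : Measure ((ℕ → ℕ) × ((_ : ℕ) × ℕ → X)) :=
  (Measure.infinitePi fun k => ProbabilityTheory.poissonMeasure (lam k)).prod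
    (Measure.infinitePi fun i : (_ : ℕ) × ℕ => ν i.1)

instance (lam : ℕ → ℝ≥0) (ν : ℕ → Measure X) [∀ k, IsProbabilityMeasure (ν k)] :
    IsProbabilityMeasure (markedLaw lam ν) := by
  unfold markedLaw; infer_instance

lemma measurable_ite_lt {f : X → ℝ≥0∞} (hf : Measurable f) (i : (_ : ℕ) × ℕ) :
    Measurable fun ω : (ℕ → ℕ) × ((_ : ℕ) × ℕ → X) => if i.2 < ω.1 i.1 then f (ω.2 i) else 0 := by
  refine Measurable.ite ?_ (by fun_prop) measurable_const
  exact measurableSet_lt measurable_const (by fun_prop)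

lemma lintegral_markedSum {f : X → ℝ≥0∞} (hf : Measurable f)
    (ω : (ℕ → ℕ) × ((_ : ℕ) × ℕ → X)) :
    ∫⁻ x, f x ∂(markedSum ω) = ∑' i : (_ : ℕ) × ℕ, if i.2 < ω.1 i.1 then f (ω.2 i) else 0 := by
  rw [markedSum, lintegral_sum_measure]
  refine tsum_congr fun i => ?_
  split_ifs
  · exact lintegral_dirac' _ hf
  · simp

lemma measurable_markedSum : Measurable (markedSum (X := X)) := by
  refine Measure.measurable_of_measurable_coe _ fun t ht => ?_
  have : ∀ ω : (ℕ → ℕ) × ((_ : ℕ) × ℕ → X), markedSum ω t =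
      ∑' i : (_ : ℕ) × ℕ, if i.2 < ω.1 i.1 then t.indicator 1 (ω.2 i) else 0 := by
    intro ω
    rw [← lintegral_markedSum (measurable_one.indicator ht), lintegral_indicator_one ht]
  simp_rw [this]
  exact Measurable.tsum fun i => measurable_ite_lt (measurable_one.indicator ht) i

variable (lam : ℕ → ℝ≥0) (ν : ℕ → Measure X) [∀ k, IsProbabilityMeasure (ν k)]

lemma lintegral_prod_pow_poissonMeasure {L : ℕ → ℝ≥0∞} (hL : ∀ k, L k ≤ 1) (K : ℕ) :
    ∫⁻ c : ℕ → ℕ, ∏ k ∈ Finset.range K, L k ^ c k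
        ∂(Measure.infinitePi fun k => ProbabilityTheory.poissonMeasure (lam k)) =
      expNeg (∑ k ∈ Finset.range K, lam k * (1 - L k)) := by
  have hind := ProbabilityTheory.iIndepFun_infinitePi
    (P := fun k => ProbabilityTheory.poissonMeasure (lam k)) (X := fun k (c : ℕ) => L k ^ c)
    fun k => measurable_from_top
  rw [ProbabilityTheory.lintegral_prod_eq_prod_lintegral_of_indepFun _ _ hind fun k => by
    exact (measurable_from_top (f := fun c : ℕ => L k ^ c)).comp (measurable_pi_apply k),
    expNeg_sum]
  refine Finset.prod_congr rfl fun k _ => ?_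
  rw [← lintegral_pow_poissonMeasure (lam k) (hL k)]
  exact (measurePreserving_eval_infinitePi
    (fun k => ProbabilityTheory.poissonMeasure (lam k)) k).lintegral_comp measurable_from_top

lemma lintegral_expNeg_sum_marks {f : X → ℝ≥0∞} (hf : Measurable f) (K : ℕ) (c : ℕ → ℕ) :
    ∫⁻ x, expNeg (∑ i ∈ (Finset.range K).sigma fun k => Finset.range (c k), f (x i))
        ∂(Measure.infinitePi fun i : (_ : ℕ) × ℕ => ν i.1) =
      ∏ k ∈ Finset.range K, (∫⁻ a, expNeg (f a) ∂(ν k)) ^ c k := by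
  have hm : Measurable fun a => expNeg (f a) := by fun_prop
  have hind := ProbabilityTheory.iIndepFun_infinitePi
    (P := fun i : (_ : ℕ) × ℕ => ν i.1) (X := fun _ a => expNeg (f a)) fun _ => hm
  simp_rw [expNeg_sum]
  rw [ProbabilityTheory.lintegral_prod_eq_prod_lintegral_of_indepFun _ _ hind fun k => by
    fun_prop, Finset.prod_sigma]
  refine Finset.prod_congr rfl fun k _ => ?_
  rw [Finset.prod_congr rfl fun j _ => (measurePreserving_eval_infinitePi
    (fun i : (_ : ℕ) × ℕ => ν i.1) ⟨k, j⟩).lintegral_comp hm]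
  simp

/-- Given the counts, the marks integrate to powers of `∫ e^{-f} dν_k`, and the Poisson generating
function handles the counts. This is done for finitely many kinds and passed to the limit by
dominated convergence. -/
theorem laplaceFunctional_markedSum {f : X → ℝ≥0} (hf : Measurable f) :
    laplaceFunctional (markedLaw lam ν) markedSum f =
      expNeg (∫⁻ x, (1 - expNeg (f x : ℝ≥0∞)) ∂(Measure.sum fun k => lam k • ν k)) := by
  have hf' : Measurable fun x => (f x : ℝ≥0∞) := by fun_prop
  set G : ℕ → (ℕ → ℕ) × ((_ : ℕ) × ℕ → X) → ℝ≥0∞ := fun k ω =>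
    ∑' j, if j < ω.1 k then (f (ω.2 ⟨k, j⟩) : ℝ≥0∞) else 0 with hG
  have hGm : ∀ k, Measurable (G k) := fun k =>
    Measurable.tsum fun j => measurable_ite_lt hf' ⟨k, j⟩
  have hGs : ∀ k ω, G k ω = ∑ j ∈ Finset.range (ω.1 k), (f (ω.2 ⟨k, j⟩) : ℝ≥0∞) := by
    intro k ω
    rw [hG]
    simp only
    rw [tsum_eq_sum (s := Finset.range (ω.1 k)) (fun j hj => if_neg (by simpa using hj))]
    exact Finset.sum_congr rfl fun j hj => if_pos (by simpa using hj)
  have hL : ∀ k, ∫⁻ a, expNeg (f a) ∂(ν k) ≤ 1 := fun k =>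
    (lintegral_mono fun a => expNeg_le_one _).trans (by simp)
  have hK : ∀ K, ∫⁻ ω, expNeg (∑ k ∈ Finset.range K, G k ω) ∂(markedLaw lam ν) =
      expNeg (∑ k ∈ Finset.range K, lam k * (1 - ∫⁻ a, expNeg (f a) ∂(ν k))) := by
    intro K
    rw [markedLaw, lintegral_prod _ (by fun_prop), ← lintegral_prod_pow_poissonMeasure lam hL K]
    refine lintegral_congr fun c => ?_
    rw [← lintegral_expNeg_sum_marks ν hf']
    refine lintegral_congr fun x => ?_
    rw [Finset.sum_sigma]
    simp_rw [hGs]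
  have hlim1 : Tendsto (fun K => ∫⁻ ω, expNeg (∑ k ∈ Finset.range K, G k ω) ∂(markedLaw lam ν))
      atTop (𝓝 (laplaceFunctional (markedLaw lam ν) markedSum f)) := by
    refine tendsto_lintegral_of_dominated_convergence (fun _ => 1) (fun K => by fun_prop)
      (fun K => ae_of_all _ fun ω => expNeg_le_one _) (by simp) (ae_of_all _ fun ω => ?_)
    rw [lintegral_markedSum hf', ENNReal.tsum_sigma']
    exact (continuous_expNeg.tendsto _).comp (ENNReal.tendsto_nat_tsum _)
  have hintegral : ∫⁻ x, (1 - expNeg (f x : ℝ≥0∞)) ∂(Measure.sum fun k => lam k • ν k) =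
      ∑' k, lam k * (1 - ∫⁻ a, expNeg (f a) ∂(ν k)) := by
    rw [lintegral_sum_measure]
    refine tsum_congr fun k => ?_
    rw [lintegral_smul_measure, lintegral_sub (by fun_prop)
      ((hL k).trans_lt ENNReal.one_lt_top).ne (ae_of_all _ fun a => expNeg_le_one _)]
    simp [ENNReal.smul_def]
  rw [hintegral]
  simp_rw [hK] at hlim1
  exact tendsto_nhds_unique hlim1
    ((continuous_expNeg.tendsto _).comp (ENNReal.tendsto_nat_tsum _))

/-- Distinct marks rule out multiplicities, so that the sum over indices is a sum over a set of
points. -/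
lemma markedSum_eq_sum_dirac {ω : (ℕ → ℕ) × ((_ : ℕ) × ℕ → X)} (hω : Function.Injective ω.2) :
    markedSum ω = Measure.sum fun l : (ω.2 '' {i | i.2 < ω.1 i.1} : Set X) =>
      Measure.dirac (l : X) := by
  ext t ht
  rw [markedSum, Measure.sum_apply _ ht, Measure.sum_apply _ ht,
    tsum_image (f := fun x => Measure.dirac x t) hω.injOn,
    tsum_subtype {i : (_ : ℕ) × ℕ | i.2 < ω.1 i.1} (fun i => Measure.dirac (ω.2 i) t)]
  refine tsum_congr fun i => ?_
  by_cases hi : i.2 < ω.1 i.1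
  · rw [if_pos hi, Set.indicator_of_mem (by exact hi)]
  · rw [if_neg hi, Set.indicator_of_notMem (by exact hi)]
    rfl

/-- For laws without atoms the diagonal is null by Fubini, and there are countably many pairs of
marks. -/
lemma ae_injective_marks [MeasurableEq X] [∀ k, NullSingletonClass (ν k)] :
    ∀ᵐ x ∂(Measure.infinitePi fun i : (_ : ℕ) × ℕ => ν i.1), Function.Injective x := by
  have : ∀ i j : (_ : ℕ) × ℕ, i ≠ j →
      ∀ᵐ x ∂(Measure.infinitePi fun i : (_ : ℕ) × ℕ => ν i.1), x i ≠ x j := by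
    intro i j hij
    have hm := Measure.infinitePi_map_eval_prod (P := fun i : (_ : ℕ) × ℕ => ν i.1) hij
    have h0 : (ν i.1).prod (ν j.1) (Set.diagonal X) = 0 := by
      rw [Measure.measure_prod_null measurableSet_diagonal]
      refine ae_of_all _ fun a => ?_
      have : Prod.mk a ⁻¹' Set.diagonal X = {a} := by
        ext b; simp [Set.mem_diagonal_iff, eq_comm]
      simp only [this, measure_singleton, Pi.zero_apply]
    rw [← hm, Measure.map_apply (by fun_prop) measurableSet_diagonal] at h0
    exact measure_eq_zero_iff_ae_notMem.1 h0
  have h := ae_all_iff.2 fun i => ae_all_iff.2 fun j =>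
    Filter.eventually_imp_distrib_left.2 (this i j)
  filter_upwards [h] with x hx i j hij
  by_contra hne
  exact hx i j hne hij

end PoissonSum

lemma not_accPt_of_finite_inter_ball {E : Type*} [NormedAddCommGroup E] {Λ : Set E} {x : E}
    {r : ℝ} (hr : 0 < r) (h : (Metric.ball x r ∩ Λ).Finite) : ¬ AccPt x (𝓟 Λ) := by
  rw [accPt_iff_nhds]
  push Not
  refine ⟨Metric.ball x r \ ((Metric.ball x r ∩ Λ) \ {x}), ?_, ?_⟩
  · exact (Metric.isOpen_ball.sdiff (h.subset Set.sdiff_subset).isClosed).mem_nhds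
      ⟨Metric.mem_ball_self hr, fun hx => hx.2 rfl⟩
  · rintro y ⟨⟨hy, hy'⟩, hyΛ⟩
    by_contra hne
    exact hy' ⟨⟨hy, hyΛ⟩, hne⟩

/-- The points whose norm has integer part `k`. -/
def shell (n k : ℕ) : Set (Space n) := {x | ⌊‖x‖⌋₊ = k}

lemma measurableSet_shell (n k : ℕ) : MeasurableSet (shell n k) :=
  (Nat.measurable_floor.comp measurable_norm) (measurableSet_singleton k)

lemma volume_shell_ne_top (n k : ℕ) : volume (shell n k) ≠ ⊤ := by
  refine (lt_of_le_of_lt (measure_mono fun x (hx : ⌊‖x‖⌋₊ = k) => ?_)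
    (measure_ball_lt_top (x := (0 : Space n)) (r := k + 1))).ne
  rw [mem_ball_zero_iff, ← hx]
  exact Nat.lt_floor_add_one _

lemma volume_shell_ne_zero (hn : n ≠ 0) (k : ℕ) : volume (shell n k) ≠ 0 := by
  have : NeZero n := ⟨hn⟩
  obtain ⟨x, hx⟩ := exists_norm_eq (Space n) (c := k + 1 / 2) (by positivity)
  have ho : IsOpen {x : Space n | (k : ℝ) < ‖x‖ ∧ ‖x‖ < k + 1} :=
    (isOpen_lt continuous_const continuous_norm).inter (isOpen_lt continuous_norm continuous_const)
  have h0 := (ho.measure_pos volume ⟨x, by constructor <;> rw [hx] <;> linarith⟩).ne'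
  refine fun h => h0 (measure_mono_null (fun y hy => ?_) h)
  exact (Nat.floor_eq_iff (norm_nonneg y)).2 ⟨hy.1.le, hy.2⟩

/-- Existence of homogeneous Poisson point processes on `ℝⁿ`. -/
theorem exists_isPoissonPointProcess (hn : n ≠ 0) (c : ℝ≥0) :
    ∃ (Ω : Type) (_ : MeasurableSpace Ω) (P : Measure Ω) (_ : IsProbabilityMeasure P)
      (Ξ : Ω → Measure (Space n)), IsPoissonPointProcess P Ξ (c • volume) := by
  -- Shells of finite positive volume partition the space. The `k`-th carries a Poisson number of
  -- uniform points with mean `c` times its volume.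
  set ν : ℕ → Measure (Space n) := fun k => ProbabilityTheory.cond volume (shell n k) with hν
  have hprob : ∀ k, IsProbabilityMeasure (ν k) := fun k =>
    ProbabilityTheory.cond_isProbabilityMeasure_of_finite (volume_shell_ne_zero hn k)
      (volume_shell_ne_top n k)
  have : NeZero n := ⟨hn⟩
  have hatoms : ∀ k, NullSingletonClass (ν k) := fun k => ⟨fun x =>
    ProbabilityTheory.cond_absolutelyContinuous (measure_singleton x)⟩
  set lam : ℕ → ℝ≥0 := fun k => c * (volume (shell n k)).toNNReal with hlam
  have hsum : (Measure.sum fun k => lam k • ν k) = c • volume := by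
    have h1 : ∀ k, lam k • ν k = c • volume.restrict (shell n k) := by
      intro k
      rw [hlam, mul_smul]
      congr 1
      rw [show ν k = (volume (shell n k))⁻¹ • volume.restrict (shell n k) from rfl, ENNReal.smul_def, ENNReal.coe_toNNReal (volume_shell_ne_top n k), smul_smul,
        ENNReal.mul_inv_cancel (volume_shell_ne_zero hn k) (volume_shell_ne_top n k), one_smul]
    have h2 : (⋃ k, shell n k) = Set.univ := Set.eq_univ_of_forall fun x =>
      Set.mem_iUnion.2 ⟨⌊‖x‖⌋₊, rfl⟩
    have h3 : Pairwise (Function.onFun Disjoint (shell n)) := fun i j hij =>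
      Set.disjoint_left.2 fun x (hx : _ = i) (hx' : _ = j) => hij (hx.symm.trans hx')
    simp_rw [h1]
    conv_rhs => rw [← Measure.restrict_univ (μ := (volume : Measure (Space n))), ← h2,
      Measure.restrict_iUnion h3 (measurableSet_shell n)]
    ext t ht
    simp only [Measure.sum_apply _ ht, Measure.smul_apply, ENNReal.smul_def, smul_eq_mul,
      ENNReal.tsum_mul_left]
  refine ⟨_, inferInstance, markedLaw lam ν, inferInstance, markedSum, ⟨measurable_markedSum, ?_⟩,
    fun f hf => ?_⟩
  · have hmem : ∀ᵐ x ∂(Measure.infinitePi fun i : (_ : ℕ) × ℕ => ν i.1),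
        ∀ i, x i ∈ shell n i.1 := by
      refine ae_all_iff.2 fun i => ?_
      refine (measurePreserving_eval_infinitePi (fun i : (_ : ℕ) × ℕ => ν i.1)
        i).quasiMeasurePreserving.ae ?_
      exact ProbabilityTheory.ae_cond_mem (measurableSet_shell n _)
    have h2 := (Measure.quasiMeasurePreserving_snd (μ := Measure.infinitePi fun k =>
      ProbabilityTheory.poissonMeasure (lam k))
      (ν := Measure.infinitePi fun i : (_ : ℕ) × ℕ => ν i.1)).ae (hmem.and (ae_injective_marks ν))
    filter_upwards [h2] with ω hω
    refine ⟨_, Set.Countable.image (Set.to_countable _) _, fun x => ?_,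
      markedSum_eq_sum_dirac hω.2⟩
    -- A unit ball around `x` meets only the shells of index at most `⌊‖x‖ + 1⌋`, each with finitely
    -- many points.
    refine not_accPt_of_finite_inter_ball one_pos (((((Finset.range (⌊‖x‖ + 1⌋₊ + 1)).sigma
      fun k => Finset.range (ω.1 k)).finite_toSet).image ω.2).subset ?_)
    rintro _ ⟨hy, i, hi, rfl⟩
    refine ⟨i, ?_, rfl⟩
    have hi' : ⌊‖ω.2 i‖⌋₊ = i.1 := hω.1 i
    rw [Finset.mem_coe, Finset.mem_sigma, Finset.mem_range, Finset.mem_range, ← hi']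
    refine ⟨Nat.lt_succ_of_le (Nat.floor_le_floor ?_), by rw [hi']; exact hi⟩
    rw [Metric.mem_ball, dist_eq_norm] at hy
    have := norm_sub_norm_le (ω.2 i) x
    linarith
  · rw [laplaceFunctional_markedSum lam ν hf, hsum]

end RieszGas

namespace RieszGas

variable {n : ℕ}

/-! ### The local limit -/

/-- The dilation by `N^{1/n}` has Jacobian `N`, which cancels the prefactor. -/
lemma mul_integral_rescale (hn : n ≠ 0) (E : Space n) (g φ : Space n → ℝ) {N : ℕ} (hN : N ≠ 0) :
    N * ∫ x, g x * φ (((N : ℝ) ^ (1 / (n : ℝ))) • (x - E)) =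
      ∫ y, g (E + ((N : ℝ) ^ (1 / (n : ℝ)))⁻¹ • y) * φ y := by
  have hN' : (0 : ℝ) < N := by positivity
  set R := (N : ℝ) ^ (1 / (n : ℝ)) with hR
  have hR0 : 0 < R := Real.rpow_pos_of_pos hN' _
  have hRn : R ^ n = N := by
    rw [hR, one_div, Real.rpow_inv_natCast_pow hN'.le hn]
  have h1 := Measure.integral_comp_smul (volume : Measure (Space n))
    (fun y => g (E + R⁻¹ • y) * φ y) R
  have h2 := integral_sub_right_eq_self (μ := (volume : Measure (Space n)))
    (fun x => g (E + R⁻¹ • R • x) * φ (R • x)) E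
  simp only [smul_smul, inv_mul_cancel₀ hR0.ne', one_smul, add_sub_cancel] at h1 h2
  rw [h2, h1, finrank_euclideanSpace_fin, hRn, abs_of_pos (by positivity), smul_eq_mul,
    ← mul_assoc, mul_inv_cancel₀ hN'.ne', one_mul]

lemma tendsto_mul_integral_rescale (hn : n ≠ 0) {E : Space n} {g φ : Space n → ℝ}
    (hg : Measurable g) {G : ℝ} (hG : ∀ x, |g x| ≤ G) (hgE : ContinuousAt g E)
    (hφ : Integrable φ) :
    Tendsto (fun N : ℕ => N * ∫ x, g x * φ (((N : ℝ) ^ (1 / (n : ℝ))) • (x - E))) atTop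
      (𝓝 (g E * ∫ y, φ y)) := by
  rw [← integral_const_mul]
  have hR : Tendsto (fun N : ℕ => ((N : ℝ) ^ (1 / (n : ℝ)))⁻¹) atTop (𝓝 0) :=
    tendsto_inv_atTop_zero.comp ((tendsto_rpow_atTop (by positivity)).comp
      tendsto_natCast_atTop_atTop)
  have hlim : Tendsto (fun N : ℕ => ∫ y, g (E + ((N : ℝ) ^ (1 / (n : ℝ)))⁻¹ • y) * φ y) atTop
      (𝓝 (∫ y, g E * φ y)) := by
    refine tendsto_integral_of_dominated_convergence (fun y => G * |φ y|) (fun N => ?_)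
      (hφ.abs.const_mul G) (fun N => ae_of_all _ fun y => ?_) (ae_of_all _ fun y => ?_)
    · have : Measurable fun y : Space n => g (E + ((N : ℝ) ^ (1 / (n : ℝ)))⁻¹ • y) :=
        hg.comp (by fun_prop)
      exact this.aestronglyMeasurable.mul hφ.aestronglyMeasurable
    · rw [Real.norm_eq_abs, abs_mul]
      gcongr
      exact hG _
    · refine Tendsto.mul_const _ (hgE.tendsto.comp ?_)
      simpa using (hR.smul_const y).const_add E
  refine hlim.congr' ?_
  filter_upwards [eventually_ne_atTop 0] with N hN
  exact (mul_integral_rescale hn E g φ hN).symm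

lemma laplaceFunctional_localProcess {N : ℕ} (P : Measure (Fin N → Space n))
    [IsProbabilityMeasure P] (E : Space n) {f : Space n → ℝ≥0} (hf : Measurable f) :
    laplaceFunctional P (localProcess E N) f = ENNReal.ofReal (∫ x, ∏ j,
      (1 - (1 - Real.exp (-(f (((N : ℝ) ^ (1 / (n : ℝ))) • (x j - E)))))) ∂P) := by
  have hm : Measurable fun x : Fin N → Space n => ∏ j,
      (1 - (1 - Real.exp (-(f (((N : ℝ) ^ (1 / (n : ℝ))) • (x j - E)))))) :=
    Finset.measurable_prod _ fun j _ => by fun_prop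
  have h0 : ∀ x : Fin N → Space n, 0 ≤ ∏ j,
      (1 - (1 - Real.exp (-(f (((N : ℝ) ^ (1 / (n : ℝ))) • (x j - E)))))) := fun x =>
    Finset.prod_nonneg fun j _ => by simpa using (Real.exp_pos _).le
  have h1 : ∀ x : Fin N → Space n, ∏ j,
      (1 - (1 - Real.exp (-(f (((N : ℝ) ^ (1 / (n : ℝ))) • (x j - E)))))) ≤ 1 := fun x =>
    Finset.prod_le_one (fun j _ => by simpa using (Real.exp_pos _).le) fun j _ => by simp
  rw [ofReal_integral_eq_lintegral_ofReal (Integrable.of_bound hm.aestronglyMeasurable 1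
    (ae_of_all _ fun x => by rw [Real.norm_of_nonneg (h0 x)]; exact h1 x)) (ae_of_all _ h0)]
  refine lintegral_congr fun x => ?_
  rw [localProcess, lintegral_finsetSum_measure, expNeg_sum, ENNReal.ofReal_prod_of_nonneg
    fun j _ => by simpa using (Real.exp_pos _).le]
  refine Finset.prod_congr rfl fun j _ => ?_
  rw [lintegral_dirac' _ (by fun_prop), expNeg_coe, sub_sub_cancel]

/-- The Laplace functional is the expectation of `∏ (1 - φ_N (x_j))` with `φ_N` concentrating at
`E`. Continuity of `V` and of the potential at `E` yields the limit `α`, and `α / Z` is `c` times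
the integral of `1 - e^{-f}`. -/
lemma IsEquilibrium.convergesInDistribution {s γ : ℝ} {V : Space n → ℝ≥0∞} (hV : Measurable V)
    {μ : Measure (Space n)} {C : ℝ≥0∞} {Z B : ℝ}
    (h : IsEquilibrium s γ (volume.withDensity fun x => expNeg (V x)) μ C Z B) {E : Space n}
    (hVE : ContinuousAt V E) {Ω : Type*} [MeasurableSpace Ω] {P : Measure Ω}
    {Ξ : Ω → Measure (Space n)} {c : ℝ≥0}
    (hc : (c : ℝ) = (expNeg (V E)).toReal * Real.exp (-(γ * potential s μ E)) / Z)
    (hP : IsPoissonPointProcess P Ξ (c • volume)) {β : ℕ → ℝ} (hβ : ∀ N, 0 < β N)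
    (hlim : Tendsto (fun N : ℕ => (N : ℝ) * β N) atTop (𝓝 γ)) :
    ConvergesInDistribution (fun N => gibbs s (β N) V N) (fun N => localProcess E N) P Ξ := by
  intro f hfc hfs
  have hn : n ≠ 0 := by
    rintro rfl
    have := h.s_pos.trans h.s_lt
    simp at this
  have hfin := h.isFiniteMeasure
  have hZ := h.Z_pos
  have hfm := hfc.measurable
  have hprob := h.isProbabilityMeasure
  have hUm := h.measurable_potential
  have hUc := continuous_potential h.s_pos h.s_lt h.C_ne_top h.μ_le h.μ_univ_le
  set φ : Space n → ℝ := fun y => 1 - Real.exp (-f y) with hφ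
  have hφ0 : ∀ y, 0 ≤ φ y := fun y => by simp [hφ]
  have hφ1 : ∀ y, φ y ≤ 1 := fun y => by simpa [hφ] using (Real.exp_pos _).le
  have hφc : Continuous φ := by fun_prop
  have hφi : Integrable φ := hφc.integrable_of_hasCompactSupport
    (hfs.comp_left (g := fun t : ℝ≥0 => 1 - Real.exp (-t)) (by simp))
  set Φ := ∫ y, φ y with hΦ
  have hΦ0 : 0 ≤ Φ := integral_nonneg hφ0
  set v : Space n → ℝ := fun x => (expNeg (V x)).toReal with hv
  have hvm : Measurable v := by fun_prop
  have hv0 : ∀ x, 0 ≤ v x := fun x => ENNReal.toReal_nonneg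
  have hv1 : ∀ x, v x ≤ 1 := fun x =>
    ENNReal.toReal_le_of_le_ofReal zero_le_one (by simpa using expNeg_le_one _)
  have hvE : ContinuousAt v E := 
    (ENNReal.continuousAt_toReal (expNeg_ne_top (V E))).comp
      (f := fun x => expNeg (V x)) (continuous_expNeg.continuousAt.comp hVE)
  have hwd : ∀ k : Space n → ℝ, ∫ x, k x ∂(volume.withDensity fun x => expNeg (V x)) =
      ∫ x, v x * k x := fun k => by
    rw [integral_withDensity_eq_integral_toReal_smul (f := fun x => expNeg (V x)) (by fun_prop)
      (ae_of_all _ fun q => (expNeg_ne_top _).lt_top)]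
    rfl
  have key := h.tendsto_integral_prod hβ hlim
    (φ := fun N x => φ (((N : ℝ) ^ (1 / (n : ℝ))) • (x - E))) (fun N => by fun_prop)
    (fun N x => hφ0 _) (fun N x => hφ1 _) (A := Φ) (fun N => ?_)
    (α := v E * Real.exp (-(γ * potential s μ E)) * Φ)
    (mul_nonneg (mul_nonneg (hv0 E) (Real.exp_pos _).le) hΦ0) ?_
  · have hl : laplaceFunctional P Ξ f = ENNReal.ofReal (Real.exp (-(v E *
        Real.exp (-(γ * potential s μ E)) * Φ / Z))) := by
      rw [hP.laplace_eq f hfm, lintegral_smul_measure]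
      have e : ∫⁻ x, (1 - expNeg (f x : ℝ≥0∞)) = ENNReal.ofReal Φ := by
        rw [hΦ, ofReal_integral_eq_lintegral_ofReal hφi (ae_of_all _ hφ0)]
        refine lintegral_congr fun x => ?_
        rw [hφ, expNeg_coe, ENNReal.ofReal_sub _ (Real.exp_pos _).le, ENNReal.ofReal_one]
      rw [e, ENNReal.smul_def, smul_eq_mul, ← ENNReal.ofReal_coe_nnreal,
        ← ENNReal.ofReal_mul c.coe_nonneg, expNeg_ofReal (by positivity), hc]
      congr 3
      ring
    rw [hl]
    refine ((ENNReal.continuous_ofReal.tendsto _).comp key).congr fun N => ?_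
    have := isProbabilityMeasure_configMeasure (h.configZ_ne_zero (hβ N).le N)
    simp only [gibbs_eq_configMeasure hV]
    rw [laplaceFunctional_localProcess _ E hfm]
    rfl
  · rcases eq_or_ne N 0 with rfl | hN
    · simpa using hΦ0
    have e := mul_integral_rescale hn E (fun _ => 1) φ hN
    simp only [one_mul] at e
    rw [hΦ, ← e, hwd]
    refine mul_le_mul_of_nonneg_left ?_ (Nat.cast_nonneg _)
    have hi : Integrable fun x : Space n => φ (((N : ℝ) ^ (1 / (n : ℝ))) • (x - E)) := by
      have h1 := (integrable_comp_smul_iff (volume : Measure (Space n)) φ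
        (R := (N : ℝ) ^ (1 / (n : ℝ))) (Real.rpow_pos_of_pos (by positivity) _).ne').2 hφi
      exact h1.comp_sub_right E
    exact integral_mono_of_nonneg (ae_of_all _ fun x => mul_nonneg (hv0 x) (hφ0 _)) hi
      (ae_of_all _ fun x => mul_le_of_le_one_left (hφ0 _) (hv1 x))
  · have hg := tendsto_mul_integral_rescale hn (E := E) (φ := φ)
      (g := fun x => v x * Real.exp (-(γ * potential s μ x))) (by fun_prop) (G := 1)
      (fun x => by
        rw [abs_mul, abs_of_nonneg (hv0 x)]
        exact mul_le_one₀ (hv1 x) (abs_nonneg _) (h.exp_neg_potential_le x))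
      (hvE.mul (by fun_prop)) hφi
    refine hg.congr fun N => ?_
    rw [hwd]
    simp only [mul_assoc]

/-! ### The reference measure -/

/-- Off the open set `{V < ∞}` the function is constantly `∞`, so it is a measurable piecewise
function. -/
lemma measurable_of_continuousOn_lt_top {V : Space n → ℝ≥0∞} (hV_open : IsOpen {x | V x < ⊤})
    (hV_cont : ContinuousOn V {x | V x < ⊤}) : Measurable V := by
  classical
  have := hV_cont.measurable_piecewise (g := fun _ => ⊤) continuousOn_const
    hV_open.measurableSet
  convert this using 1
  ext x
  by_cases hx : x ∈ {x | V x < ⊤}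
  · rw [Set.piecewise_eq_of_mem _ _ _ hx]
  · rw [Set.piecewise_eq_of_notMem _ _ _ hx]
    simpa using hx

lemma lintegral_expNeg_ne_zero {V : Space n → ℝ≥0∞} (hV : Measurable V)
    (hV_open : IsOpen {x | V x < ⊤}) (hV_nonempty : {x | V x < ⊤}.Nonempty) :
    ∫⁻ x, expNeg (V x) ≠ 0 := by
  rw [Ne, lintegral_eq_zero_iff (by fun_prop)]
  intro h
  refine (hV_open.measure_pos volume hV_nonempty).ne' (measure_mono_null (fun x hx => ?_) h)
  exact (expNeg_pos (ne_of_lt hx)).ne'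

/-- The minimizer of the free energy solves the mean-field equation. -/
theorem exists_isEquilibrium {s γ : ℝ} (hs : 0 < s) (hsn : s < n) (hγ : 0 ≤ γ)
    {V : Space n → ℝ≥0∞} (hV_int : ∫⁻ x, expNeg (V x) ≠ ⊤)
    (hV0 : ∫⁻ x, expNeg (V x) ≠ 0) :
    ∃ μ : ProbabilityMeasure (Space n), IsFreeEnergyMinimizer s γ V μ ∧
      (∀ ν, IsFreeEnergyMinimizer s γ V ν → ν = μ) ∧ ∃ (C : ℝ≥0∞) (Z B : ℝ),
        IsEquilibrium s γ (volume.withDensity fun x => expNeg (V x)) (μ : Measure (Space n))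
          C Z B := by
  set I := ∫⁻ x, expNeg (V x) with hI
  set m : Measure (Space n) := volume.withDensity fun x => expNeg (V x) with hm
  have hmI : m Set.univ = I := by
    rw [hm, withDensity_apply _ MeasurableSet.univ, Measure.restrict_univ]
  have hmle : m ≤ (1 : ℝ≥0∞) • volume := withDensity_le_smul fun x => expNeg_le_one _
  have hπ : referenceMeasure V = I⁻¹ • m := rfl
  have hπp : IsProbabilityMeasure (referenceMeasure V) := ⟨by
    rw [hπ, Measure.smul_apply, hmI, smul_eq_mul, ENNReal.inv_mul_cancel hV0 hV_int]⟩
  have hπle : referenceMeasure V ≤ (I⁻¹ * 1) • volume := smul_measure_le_smul_volume hmle _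
  obtain ⟨μ, hμ, hmin, huniq, Z, hZ, hμe⟩ := exists_minimizer hs hsn hγ
    (C := I⁻¹ * 1) (by simpa using hV0) hπle
  have hIr : 0 < I.toReal := ENNReal.toReal_pos hV0 hV_int
  have hUm := RieszGas.measurable_potential s μ
  -- The mean-field equation relative to the normalized measure becomes one relative to `m`,
  -- multiplying the constant `Z` by the mass of `m`.
  have hμm : μ = m.withDensity fun x =>
      ENNReal.ofReal (Real.exp (-(γ * potential s μ x)) / (Z * I.toReal)) := by
    conv_lhs => rw [hμe, hπ, withDensity_smul_measure]
    rw [← withDensity_smul _ (by fun_prop)]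
    congr 1
    ext x
    rw [Pi.smul_apply, smul_eq_mul, ← ENNReal.ofReal_toReal (ENNReal.inv_ne_top.2 hV0),
      ← ENNReal.ofReal_mul ENNReal.toReal_nonneg, ENNReal.toReal_inv]
    congr 1
    field_simp
  set D := ENNReal.ofReal (1 / (Z * I.toReal)) with hD
  have hμle : μ ≤ (D * 1) • volume := by
    refine le_trans ?_ (smul_measure_le_smul_volume hmle D)
    conv_lhs => rw [hμm]
    refine withDensity_le_smul fun x => ENNReal.ofReal_le_ofReal ?_
    gcongr
    exact Real.exp_le_one_iff.2 (neg_nonpos.2 (mul_nonneg hγ (potential_nonneg s μ x)))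
  -- One constant bounds everything: the density of `m` and the mass of `μ` by `1`, the mass of `m`
  -- by `I`, the density of `μ` by `D`.
  have hC : 1 + I + D ≠ ⊤ := by
    simp only [ne_eq, ENNReal.add_eq_top, ENNReal.one_ne_top, hV_int, hD, ENNReal.ofReal_ne_top,
      or_self, not_false_eq_true]
  have hmono : ∀ {a : ℝ≥0∞}, a ≤ 1 + I + D →
      a • (volume : Measure (Space n)) ≤ (1 + I + D) • volume := fun ha t => by
    simp only [Measure.smul_apply, smul_eq_mul]
    gcongr
  have hμC : μ ≤ (1 + I + D) • volume := hμle.trans (hmono (by rw [mul_one]; exact le_add_self))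
  have h1C : 1 ≤ 1 + I + D := by rw [add_assoc]; exact le_self_add
  have hμ1 : μ Set.univ ≤ 1 + I + D := by rw [measure_univ]; exact h1C
  obtain ⟨B, hB⟩ := exists_potential_le hs hsn hC hμC hμ1
  refine ⟨⟨μ, hμ⟩, fun ν => hmin ν ν.2, fun ν hν => Subtype.ext (huniq ν ν.2 (hν ⟨μ, hμ⟩)),
    1 + I + D, Z * I.toReal, B, ?_⟩
  exact
    { s_pos := hs
      s_lt := hsn
      γ_nonneg := hγ
      C_ne_top := hC
      m_le := hmle.trans (hmono h1C)
      m_univ_le := by rw [hmI, add_comm 1 I, add_assoc]; exact le_self_add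
      μ_le := hμC
      μ_univ_le := hμ1
      isProbabilityMeasure := hμ
      Z_pos := by positivity
      eq_withDensity := hμm
      potential_le := hB }

end RieszGas
-- The main theorem
theorem mainTheorem2 (n : ℕ) (s : ℝ) (hs : 0 < s) (hsn : s < n)
    (V : RieszGas.Space n → ℝ≥0∞)
    (hV_open : IsOpen {x | V x < ⊤}) (hV_nonempty : {x | V x < ⊤}.Nonempty)
    (hV_cont : ContinuousOn V {x | V x < ⊤})
    (hV_int : ∫⁻ x, RieszGas.expNeg (V x) < ⊤)
    (γ : ℝ) (hγ : 0 ≤ γ) :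
    -- the free energy has a unique minimizer `μ`, with a density `ρ` continuous on `{V < ∞}`
    ∃ μ : ProbabilityMeasure (RieszGas.Space n),
      RieszGas.IsFreeEnergyMinimizer s γ V μ ∧
      (∀ ν, RieszGas.IsFreeEnergyMinimizer s γ V ν → ν = μ) ∧
      ∃ ρ : RieszGas.Space n → ℝ≥0,
        Measurable ρ ∧ ContinuousOn ρ {x | V x < ⊤} ∧
        (μ : Measure (RieszGas.Space n)) = volume.withDensity (fun x => (ρ x : ℝ≥0∞)) ∧
        -- around each `E` in `{V < ∞}` there is Poisson convergence, with intensity `ρ E > 0`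
        ∀ E : RieszGas.Space n, V E < ⊤ → 0 < ρ E ∧
          ∃ (Ω : Type) (_ : MeasurableSpace Ω) (P : Measure Ω) (_ : IsProbabilityMeasure P)
            (Ξ : Ω → Measure (RieszGas.Space n)),
            RieszGas.IsPoissonPointProcess P Ξ (ρ E • volume) ∧
            ∀ β : ℕ → ℝ, (∀ N, 0 < β N) →
              Tendsto (fun N : ℕ => (N : ℝ) * β N) atTop (𝓝 γ) →
              RieszGas.ConvergesInDistribution
                (fun N => RieszGas.gibbs s (β N) V N) (fun N => RieszGas.localProcess E N) P Ξ := by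
  have hV := RieszGas.measurable_of_continuousOn_lt_top hV_open hV_cont
  obtain ⟨μ, hmin, huniq, C, Z, B, h⟩ := RieszGas.exists_isEquilibrium hs hsn hγ hV_int.ne
    (RieszGas.lintegral_expNeg_ne_zero hV hV_open hV_nonempty)
  have hn : n ≠ 0 := by
    rintro rfl
    have := hs.trans hsn
    simp at this
  have hZ := h.Z_pos
  have hUm := h.measurable_potential
  have hUc := RieszGas.continuous_potential h.s_pos h.s_lt h.C_ne_top h.μ_le h.μ_univ_le
  -- The mean-field equation provides the version `e^{-V} e^{-γ U} / Z` of the density, which is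
  -- continuous and positive wherever `V` is finite.
  refine ⟨μ, hmin, huniq, fun x => (RieszGas.expNeg (V x)).toNNReal *
    Real.toNNReal (Real.exp (-(γ * RieszGas.potential s (μ : Measure (RieszGas.Space n)) x)) / Z),
    by fun_prop, ?_, ?_, fun E hE => ⟨?_, ?_⟩⟩
  · refine ContinuousOn.mul ?_ (Continuous.continuousOn (by fun_prop))
    exact ENNReal.continuousOn_toNNReal.comp
      (RieszGas.continuous_expNeg.comp_continuousOn hV_cont) fun x _ => RieszGas.expNeg_ne_top _
  · conv_lhs => rw [h.eq_withDensity, ← withDensity_mul _ (by fun_prop) (by fun_prop)]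
    congr 1
    ext x
    rw [Pi.mul_apply, ENNReal.coe_mul, ENNReal.coe_toNNReal (RieszGas.expNeg_ne_top _)]
    rfl
  · exact mul_pos (ENNReal.toNNReal_pos (RieszGas.expNeg_pos hE.ne).ne'
      (RieszGas.expNeg_ne_top _)) (Real.toNNReal_pos.2 (by positivity))
  · obtain ⟨Ω, hΩ, P, hP, Ξ, hΞ⟩ := RieszGas.exists_isPoissonPointProcess hn
      ((RieszGas.expNeg (V E)).toNNReal * Real.toNNReal
        (Real.exp (-(γ * RieszGas.potential s (μ : Measure (RieszGas.Space n)) E)) / Z))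
    refine ⟨Ω, hΩ, P, hP, Ξ, hΞ, fun β hβ hlim => ?_⟩
    refine h.convergesInDistribution hV (hV_cont.continuousAt (hV_open.mem_nhds hE)) ?_ hΞ hβ hlim
    rw [NNReal.coe_mul, Real.coe_toNNReal _ (by positivity), ENNReal.coe_toNNReal_eq_toReal,
      mul_div_assoc]
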